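/- **Protocol.** Fix a constant $\gamma\in(0,1)$. The nodes are the vertices of the complete graph $K_n$; each node $v$ has a generation $\mathrm{gen}(v)$, initially $0$, and one of $k$ opinions $\mathrm{col}(v)$. The bias $\alpha$ is the ratio between the initial support of the dominant opinion and that of the second largest opinion (which is held by at least one node). For $i\ge 1$ let $$X_i=\frac{2\ln\left(\alpha^{2^{i-1}}+k-1\right)-\ln\left(\alpha^{2^i}+k-1\right)-\ln\gamma}{\ln(2-\gamma)}+2,$$ $t_1=1$, $t_{i+1}=t_i+\lceil X_i\rceil$, and let $\mathcal G^*=\lceil\log_2\log_\alpha n\rceil+1$. In each round $t=1,2,\dots$ all nodes update in parallel. Each node $v$ samples two neighbors independently and uniformly at random (with replacement, independently of all other samples); let $v'$ be the sample of higher generation (the first one in case of a tie) and $v''$ the other one. If $t\in\{t_1,\dots,t_{\mathcal G^*}\}$, $\mathrm{gen}(v)\le\mathrm{gen}(v')=\mathrm{gen}(v'')$ and $\mathrm{col}(v')=\mathrm{col}(v'')$, then $v$ adopts the opinion $\mathrm{col}(v')$ and the generation $\mathrm{gen}(v')+1$ (two-choices step). Otherwise, if $\mathrm{gen}(v')>\mathrm{gen}(v)$,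 then $v$ adopts the opinion and the generation of $v'$ (propagation step). Otherwise $v$ does not change. **Theorem.** For all constants $\varepsilon\in(0,\tfrac12)$ and $\gamma\in(0,1)$ there are constants $C,c>0$ and $N$, depending only on $\varepsilon$ and $\gamma$, such that the following holds for all $n\ge N$, all $k$ with $2\le k\le n^{\varepsilon}$, and all initial assignments of $k$ opinions to the $n$ nodes of $K_n$ whose bias satisfies $$\alpha>1+\frac{k\log_2 n}{\sqrt n}\cdot\log_2 k .$$ With probability at least $1-n^{-c}$, all nodes hold the initially dominant opinion at every time $$t\ \ge\ C\cdot\left(\max\{0,\log_2\log_\alpha k\}\cdot\log_2 k+\log_2\log_2 n\right).$$ -/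

import Mathlib

open MeasureTheory ProbabilityTheory

namespace Plurality

/-- The state of a node: its generation and its opinion (one of `k` opinions). -/
structure NodeState (k : ℕ) where
  /-- The generation of the node. -/
  gen : ℕ
  /-- The opinion of the node. -/
  col : Fin k

/-- The neighbors of `v` in the complete graph on `Fin n`. -/
abbrev Neighbor {n : ℕ} (v : Fin n) : Type := {u : Fin n // u ≠ v}

/-- The random choices of all nodes in one round: every node samples two neighbors. -/
abbrev Samples (n : ℕ) : Type := (v : Fin n) → Neighbor v × Neighbor v

/-- One synchronous round: all nodes update in parallel, on the basis of the configuration `s`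
before the round. The flag `twoChoices` says whether two-choices steps are allowed in this round.
Of the two samples, `v'` is the one of higher generation (the first one in case of a tie). -/
def step {n k : ℕ} (twoChoices : Prop) [Decidable twoChoices] (smp : Samples n)
    (s : Fin n → NodeState k) : Fin n → NodeState k := fun v =>
  let x : NodeState k := s (smp v).1
  let y : NodeState k := s (smp v).2
  let v' : NodeState k := if y.gen ≤ x.gen then x else y
  let v'' : NodeState k := if y.gen ≤ x.gen then y else x
  if twoChoices ∧ (s v).gen ≤ v'.gen ∧ v'.gen = v''.gen ∧ v'.col = v''.col then
    ⟨v'.gen + 1, v'.col⟩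
  else if (s v).gen < v'.gen then
    v'
  else
    s v

/-- The number of nodes that hold opinion `j`. -/
def support {n k : ℕ} (op : Fin n → Fin k) (j : Fin k) : ℕ :=
  (Finset.univ.filter fun v => op v = j).card

/-- The ratio between the support of opinion `a` and the largest support of any other opinion.
If `a` is the dominant opinion, this is the bias. (If no other opinion is held by any node, the
ratio does not exist, and the value is `0`.) -/
noncomputable def bias {n k : ℕ} (op : Fin n → Fin k) (a : Fin k) : ℝ :=
  (support op a : ℝ) / (((Finset.univ.erase a).sup (support op) : ℕ) : ℝ)

/-- The length `X_i` (before rounding) of the life cycle of generation `i ≥ 1`. -/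
noncomputable def lifeCycle (γ α : ℝ) (k i : ℕ) : ℝ :=
  (2 * Real.log (α ^ (2 ^ (i - 1)) + k - 1) - Real.log (α ^ (2 ^ i) + k - 1) - Real.log γ)
    / Real.log (2 - γ) + 2

/-- The round `t_i` in which generation `i ≥ 1` is born: `t_1 = 1` and
`t_{i+1} = t_i + ⌈X_i⌉`. -/
noncomputable def birthTime (γ α : ℝ) (k i : ℕ) : ℕ :=
  1 + ∑ j ∈ Finset.Ico 1 i, ⌈lifeCycle γ α k j⌉₊

/-- The total number of generations, `⌈log₂ log_α n⌉ + 1`. -/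
noncomputable def numGenerations (α : ℝ) (n : ℕ) : ℕ :=
  ⌈Real.logb 2 (Real.logb α n)⌉₊ + 1

/-- Round `t` is one of the predefined rounds in which two-choices steps are allowed. -/
def IsTwoChoicesRound (γ α : ℝ) (n k t : ℕ) : Prop :=
  ∃ i : ℕ, 1 ≤ i ∧ i ≤ numGenerations α n ∧ t = birthTime γ α k i

open Classical in
/-- The configuration after `t` rounds of the protocol with parameters `γ` and `α`, started with
the opinions `op` in generation `0`; `ω t` are the samples taken in round `t + 1`. -/
noncomputable def run {n k : ℕ} (γ α : ℝ) (op : Fin n → Fin k) (ω : ℕ → Samples n) :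
    ℕ → Fin n → NodeState k
  | 0 => fun v => ⟨0, op v⟩
  | t + 1 => step (IsTwoChoicesRound γ α n k (t + 1)) (ω t) (run γ α op ω t)

/-- The law of the samples: in all rounds, all nodes take two samples, all of them independent and
each of them uniform among the neighbors of the node. -/
noncomputable def samplingMeasure (n : ℕ) : Measure (ℕ → Samples n) :=
  Measure.infinitePi fun _ : ℕ => uniformOn (Set.univ : Set (Samples n))

/-- From time `T` on, all nodes hold opinion `a`. -/
def ConvergedBy {n k : ℕ} (γ α : ℝ) (op : Fin n → Fin k) (a : Fin k) (T : ℝ)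
    (ω : ℕ → Samples n) : Prop :=
  ∀ t : ℕ, T ≤ t → ∀ v : Fin n, (run γ α op ω t v).col = a

end Plurality

/-! Only the newest generation matters, and inside it only the ratio between the dominant opinion
and every other opinion. In a propagation round all opinions of the newest generation grow in
expectation by one and the same factor (`expectedCount_joinsClass`), so ratios persist. In a
two-choices round a class of size x sends about x²/n nodes into the next generation
(`expectedCount_bothIn`), so ratios are squared. A generation is born with about a fraction
γ²·`collision` of the nodes and then grows by a factor of at least 2 - γ per round as long as it
holds at most a fraction γ; its life cycle is just long enough to bring it back to γ
(`fraction_reached`). After about log₂ log_α n squarings the bias is at least of order n^{3/4}; the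
next two-choices round then creates a monochromatic generation, and the fraction h of nodes outside
it falls to about h³ in each round, hence vanishes within O(log log n) rounds (`Schedule.ending`).

Randomness is handled one round at a time. For a fixed configuration, Chernoff bounds with deviation
parameter l = 16 log n fail with probability n⁻⁴ each; `leads_step` carries such a bound over to the
process, and `Leads.trans` adds up the failures.

The core is the bookkeeping of the logarithm ρ of the bias. A round in which the tracked class sizes
are at least V costs at most 3√(l/V) (`ratio_after_deviation`). While ρ ≤ 2, these sizes are of
order Γn/k, where Γ is the fraction held by the generation; Γ grows geometrically, so the losses of
a life cycle add up to e = O(k√(log n / n)) (`exists_cycleLoss_le`). The hypothesis on α makes log α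
larger than this by a factor of order √(log n)·log k. When ρ > 2, sizes down to U = n^θ are
admitted, and the loss √(l/U) is charged to ρ as a tiny relative error. So a life cycle turns ρ into
at least min(2ρ, κ)(1 - ν) - e (`generation_phase`, `logBias`), where the cap κ keeps the tracked
sizes above U.

The lengths of the life cycles are computed from the ideal bias α^(2^m), so the true `collision`
must match the ideal one up to a constant factor p (`Schedule.collision_le`). This is delicate only
while the ideal log-bias is O(log k), and there it suffices that the total relative error η
satisfies η·log k ≤ ζ for a small constant ζ.

For the running time, the life cycle of generation m + 1 takes O(1 + log k·min(1, max(0, L - m)))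
rounds with L = log₂ log_α k, and these bounds sum up to the claimed time (`birthTime_le`). -/

namespace Plurality

/-! ### Uniform probability on finite products, Chernoff bounds -/

section FiniteProbability

open Finset

open Classical in
/-- The probability of an event under the uniform distribution on a finite type. -/
noncomputable def freq {Ω : Type*} [Fintype Ω] (p : Ω → Prop) : ℝ :=
  ((univ.filter p).card : ℝ) / Fintype.card Ω

theorem freq_nonneg {Ω : Type*} [Fintype Ω] (p : Ω → Prop) : 0 ≤ freq p := by
  unfold freq; positivity

theorem freq_mono {Ω : Type*} [Fintype Ω] {p q : Ω → Prop} (h : ∀ ω, p ω → q ω) :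
    freq p ≤ freq q := by
  unfold freq
  gcongr with ω
  exact h ω

theorem freq_or_le {Ω : Type*} [Fintype Ω] (p q : Ω → Prop) :
    freq (fun ω => p ω ∨ q ω) ≤ freq p + freq q := by
  classical
  unfold freq
  rw [← add_div]
  gcongr
  have : (univ.filter fun ω => p ω ∨ q ω) ⊆ univ.filter p ∪ univ.filter q := by
    intro ω; simp
  exact_mod_cast (card_le_card (by convert this)).trans (card_union_le _ _)

theorem freq_exists_le {Ω ι : Type*} [Fintype Ω] [Fintype ι] (p : ι → Ω → Prop) (δ : ℝ)
    (h : ∀ i, freq (p i) ≤ δ) : freq (fun ω => ∃ i, p i ω) ≤ Fintype.card ι * δ := by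
  classical
  have h1 : freq (fun ω => ∃ i, p i ω) ≤ ∑ i, freq (p i) := by
    unfold freq
    rw [← sum_div]
    gcongr
    have : (univ.filter fun ω => ∃ i, p i ω) ⊆ univ.biUnion fun i => univ.filter (p i) := by
      intro ω; simp
    have h2 := (card_le_card this).trans card_biUnion_le
    have h3 : ((univ.filter fun ω => ∃ i, p i ω).card : ℝ)
        ≤ ∑ i, ((univ.filter (p i)).card : ℝ) := by exact_mod_cast h2
    refine le_of_eq_of_le ?_ h3
    congr!
  refine h1.trans ((sum_le_sum fun i _ => h i).trans ?_)
  simp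

theorem freq_eq_measureReal {Ω : Type*} [Fintype Ω] [MeasurableSpace Ω]
    [MeasurableSingletonClass Ω] (p : Ω → Prop) :
    (uniformOn (Set.univ : Set Ω)).real {ω | p ω} = freq p := by
  classical
  unfold freq
  rw [measureReal_def, uniformOn_univ, Measure.count_apply_finite _ (Set.toFinite _)]
  rw [ENNReal.toReal_div]
  simp

/-- The expected number of indices `i` for which the `i`-th of independent uniform variables
satisfies `P i`. -/
noncomputable def expectedCount {ι : Type*} [Fintype ι] {S : ι → Type*} [∀ i, Fintype (S i)]
    (P : ∀ i, S i → Prop) : ℝ := ∑ i, freq (P i)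

open Classical in
/-- The number of indices `i` with `P i (ω i)`. -/
noncomputable def occurrences {ι : Type*} [Fintype ι] {S : ι → Type*}
    (P : ∀ i, S i → Prop) (ω : ∀ i, S i) : ℕ := (univ.filter fun i => P i (ω i)).card

variable {ι : Type*} [Fintype ι] {S : ι → Type*} [∀ i, Fintype (S i)] [∀ i, Nonempty (S i)]
  (P : ∀ i, S i → Prop)

omit [∀ i, Nonempty (S i)] in
theorem expectedCount_nonneg : 0 ≤ expectedCount P := sum_nonneg fun _ _ => freq_nonneg _

/-- Under the uniform law on a product the coordinates are independent, so the exponential moment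
factorizes; a factor 1 + (e^lam - 1)q is at most exp((e^lam - 1)q), and only the sum of the q
survives. -/
theorem exponential_moment_le [DecidableEq ι] (lam : ℝ) :
    (∑ ω : ∀ i, S i, Real.exp (lam * occurrences P ω)) / Fintype.card (∀ i, S i)
      ≤ Real.exp ((Real.exp lam - 1) * expectedCount P) := by
  classical
  have h1 : ∀ ω : ∀ i, S i, Real.exp (lam * occurrences P ω)
      = ∏ i, (if P i (ω i) then Real.exp lam else 1) := by
    intro ω
    rw [prod_ite, prod_const, prod_const_one, mul_one, ← Real.exp_nat_mul, mul_comm]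
    simp only [occurrences]
  have h2 : ∑ ω : ∀ i, S i, ∏ i, (if P i (ω i) then Real.exp lam else 1)
      = ∏ i, ∑ x : S i, (if P i x then Real.exp lam else 1) := by
    rw [prod_univ_sum]
    simp
  rw [sum_congr rfl fun ω _ => h1 ω, h2, Fintype.card_pi]
  push_cast
  rw [← prod_div_distrib, expectedCount, mul_sum, Real.exp_sum]
  refine prod_le_prod (fun i _ => by positivity) fun i _ => ?_
  have h0 : (0 : ℝ) < Fintype.card (S i) := by exact_mod_cast Fintype.card_pos
  have h3 : (∑ x : S i, if P i x then Real.exp lam else 1) / (Fintype.card (S i) : ℝ)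
      = 1 + (Real.exp lam - 1) * freq (P i) := by
    have : ∀ x : S i, (if P i x then Real.exp lam else 1)
        = 1 + (if P i x then (Real.exp lam - 1) else 0) := by
      intro x; split_ifs <;> ring
    rw [sum_congr rfl fun x _ => this x, sum_add_distrib, ← sum_filter, sum_const, sum_const,
      freq, card_univ]
    field_simp
    simp
    ring
  rw [h3]
  linarith [Real.add_one_le_exp ((Real.exp lam - 1) * freq (P i))]

/-- The exponential Markov inequality for the number of occurrences. -/
theorem freq_le_exp [DecidableEq ι] (lam y : ℝ) (p : (∀ i, S i) → Prop)
    (h : ∀ ω, p ω → y ≤ lam * occurrences P ω) :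
    freq p ≤ Real.exp ((Real.exp lam - 1) * expectedCount P - y) := by
  classical
  rw [Real.exp_sub, le_div_iff₀ (Real.exp_pos _)]
  refine le_trans ?_ (exponential_moment_le P lam)
  rw [freq, div_mul_eq_mul_div]
  gcongr
  calc ((univ.filter p).card : ℝ) * Real.exp y = ∑ ω ∈ univ.filter p, Real.exp y := by simp
    _ ≤ ∑ ω ∈ univ.filter p, Real.exp (lam * occurrences P ω) := by
        refine sum_le_sum fun ω hω => Real.exp_le_exp.2 (h ω (by simpa using hω))
    _ ≤ _ := sum_le_univ_sum_of_nonneg fun _ => (Real.exp_pos _).le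

/-- Chernoff bound, upper tail. -/
theorem freq_upper_tail [DecidableEq ι] {M l : ℝ} (hl : 0 ≤ l) (hM : 0 < M) (hlM : l ≤ 4 * M)
    (h : expectedCount P ≤ M) :
    freq (fun ω => M + Real.sqrt (l * M) ≤ occurrences P ω) ≤ Real.exp (-l / 4) := by
  set d := Real.sqrt (l / M) with hd
  have hd0 : 0 ≤ d := Real.sqrt_nonneg _
  have hdd : d ^ 2 = l / M := Real.sq_sqrt (by positivity)
  have hd2 : d ≤ 2 := by
    rw [hd, Real.sqrt_le_left (by norm_num), div_le_iff₀ hM]; linarith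
  have hs : Real.sqrt (l * M) = d * M := by
    rw [hd, show l * M = l / M * (M * M) by field_simp, Real.sqrt_mul (by positivity),
      Real.sqrt_mul_self hM.le]
  -- The deviation is d·M. With e^lam - 1 ≤ lam + lam² the exponent is at most lam²M - lam·d·M,
  -- which is minimal at lam = d/2 with value -d²M/4 = -l/4. The hypothesis l ≤ 4M gives lam ≤ 1,
  -- where the quadratic bound is valid.
  refine (freq_le_exp P (d / 2) (d / 2 * (M + Real.sqrt (l * M))) _ ?_).trans ?_
  · intro ω hω; gcongr
  · rw [Real.exp_le_exp, hs]
    have h1 : Real.exp (d / 2) - 1 ≤ d / 2 + (d / 2) ^ 2 := by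
      have := Real.abs_exp_sub_one_sub_id_le (x := d / 2) (by rw [abs_of_nonneg] <;> linarith)
      linarith [le_abs_self (Real.exp (d / 2) - 1 - d / 2)]
    have h2 : 0 ≤ Real.exp (d / 2) - 1 := by linarith [Real.add_one_le_exp (d / 2)]
    have h3 : l = d ^ 2 * M := by rw [hdd]; field_simp
    have h4 : (Real.exp (d / 2) - 1) * expectedCount P ≤ (d / 2 + (d / 2) ^ 2) * M :=
      mul_le_mul h1 h (expectedCount_nonneg P) (by positivity)
    rw [h3]
    nlinarith

/-- Chernoff bound, lower tail. -/
theorem freq_lower_tail [DecidableEq ι] {M l : ℝ} (hl : 0 ≤ l) (hM : 0 < M)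
    (h : M ≤ expectedCount P) :
    freq (fun ω => (occurrences P ω : ℝ) < M - Real.sqrt (l * M)) ≤ Real.exp (-l / 4) := by
  set d := Real.sqrt (l / M) with hd
  have hd0 : 0 ≤ d := Real.sqrt_nonneg _
  have hdd : d ^ 2 = l / M := Real.sq_sqrt (by positivity)
  have hs : Real.sqrt (l * M) = d * M := by
    rw [hd, show l * M = l / M * (M * M) by field_simp, Real.sqrt_mul (by positivity),
      Real.sqrt_mul_self hM.le]
  rw [hs]
  by_cases hd2 : d ≤ 2
  · refine (freq_le_exp P (-(d / 2)) (-(d / 2) * (M - d * M)) _ ?_).trans ?_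
    · intro ω hω
      have : 0 ≤ d / 2 := by positivity
      nlinarith
    · rw [Real.exp_le_exp]
      have h1 : Real.exp (-(d / 2)) - 1 ≤ -(d / 2) + (d / 2) ^ 2 := by
        have := Real.abs_exp_sub_one_sub_id_le (x := -(d / 2))
          (by rw [abs_neg, abs_of_nonneg] <;> linarith)
        have h2 := le_abs_self (Real.exp (-(d / 2)) - 1 - -(d / 2))
        nlinarith
      have h3 : l = d ^ 2 * M := by rw [hdd]; field_simp
      have h2 : Real.exp (-(d / 2)) - 1 ≤ 0 := by
        have : Real.exp (-(d / 2)) ≤ 1 := Real.exp_le_one_iff.2 (by linarith)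
        linarith
      have h4 : (Real.exp (-(d / 2)) - 1) * expectedCount P ≤ (-(d / 2) + (d / 2) ^ 2) * M := by
        calc _ ≤ (Real.exp (-(d / 2)) - 1) * M := mul_le_mul_of_nonpos_left h h2
          _ ≤ _ := by gcongr
      rw [h3]
      nlinarith
  -- For d > 2 the threshold is negative, so the event is empty; hence the lower tail needs no
  -- restriction on l.
  · have : freq (fun ω => (occurrences P ω : ℝ) < M - d * M) = 0 := by
      unfold freq
      rw [div_eq_zero_iff]; left
      rw [Nat.cast_eq_zero, card_eq_zero, filter_eq_empty_iff]
      intro ω _ hω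
      have : (0 : ℝ) ≤ occurrences P ω := by positivity
      nlinarith
    rw [this]; positivity

/-- An event of small expected count probably does not occur at all. -/
theorem freq_occurs_le [DecidableEq ι] {M : ℝ} (hM : 0 < M) (h : expectedCount P ≤ M)
    (hM1 : M ≤ 1) : freq (fun ω => occurrences P ω ≠ 0) ≤ 3 * M := by
  have h0 : 0 ≤ -Real.log M := by linarith [Real.log_nonpos hM.le hM1]
  -- Here e^lam = 1/M, so the bound is M·exp((1/M - 1)μ) ≤ e·M for a mean μ ≤ M.
  refine (freq_le_exp P (-Real.log M) (-Real.log M) _ ?_).trans ?_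
  · intro ω hω
    have : (1 : ℝ) ≤ occurrences P ω := by exact_mod_cast Nat.one_le_iff_ne_zero.2 hω
    nlinarith
  · rw [Real.exp_neg, Real.exp_log hM, sub_neg_eq_add, Real.exp_add, Real.exp_log hM]
    gcongr
    have h1 : (M⁻¹ - 1) * expectedCount P ≤ 1 := by
      have : 0 ≤ M⁻¹ - 1 := by rw [sub_nonneg]; exact (one_le_inv₀ hM).2 hM1
      calc _ ≤ (M⁻¹ - 1) * M := by gcongr
        _ ≤ 1 := by rw [sub_mul, inv_mul_cancel₀ hM.ne']; linarith
    calc _ ≤ Real.exp 1 := Real.exp_le_exp.2 h1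
      _ ≤ 3 := by linarith [Real.exp_one_lt_d9]

end FiniteProbability

/-! ### From one-round bounds to the random process -/

section Trajectory

variable {n k : ℕ} {γ α : ℝ} {op : Fin n → Fin k}

theorem nonempty_samples (hn : 2 ≤ n) : Nonempty (Samples n) := by
  refine ⟨fun v => ?_⟩
  have : Nonempty (Neighbor v) := by
    have : Nontrivial (Fin n) := Fin.nontrivial_iff_two_le.2 hn
    obtain ⟨u, hu⟩ := exists_ne v
    exact ⟨⟨u, hu⟩⟩
  exact Classical.arbitrary _

/-- Makes the configuration at time `t` a function of finitely many samples, all of them independent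
of the samples of the next round. -/
theorem run_congr {t : ℕ} {ω ω' : ℕ → Samples n} (h : ∀ u < t, ω u = ω' u) :
    run γ α op ω t = run γ α op ω' t := by
  induction t with
  | zero => rfl
  | succ t ih =>
    simp only [run]
    rw [ih fun u hu => h u (by omega), h t (by omega)]

/-- The probability that the configuration is in `P` at time `t` but not in `Q` at time `t'` is at
most `δ`. -/
def Leads (γ α : ℝ) (op : Fin n → Fin k) (P : (Fin n → NodeState k) → Prop) (t : ℕ)
    (Q : (Fin n → NodeState k) → Prop) (t' : ℕ) (δ : ℝ) : Prop :=
  (samplingMeasure n).real {ω | P (run γ α op ω t) ∧ ¬ Q (run γ α op ω t')} ≤ δ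

open Classical in
/-- A bound on the failure probability of one round, uniform over the configurations in `P`,
holds for the process. -/
theorem leads_step (hn : 2 ≤ n) {P Q : (Fin n → NodeState k) → Prop} {t : ℕ} {δ : ℝ}
    (h : ∀ s, P s → freq (fun smp : Samples n =>
      ¬ Q (step (IsTwoChoicesRound γ α n k (t + 1)) smp s)) ≤ δ) (hδ : 0 ≤ δ) :
    Leads γ α op P t Q (t + 1) δ := by
  have := nonempty_samples hn
  unfold Leads
  set μ := samplingMeasure n with hμ
  have : IsProbabilityMeasure μ := by rw [hμ, samplingMeasure]; infer_instance
  obtain ⟨ω₀⟩ : Nonempty (ℕ → Samples n) := inferInstance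
  -- A finite history is completed by an arbitrary tail, which the configuration at time `t` does
  -- not see.
  let ext : ((i : Finset.range t) → Samples n) → (ℕ → Samples n) :=
    fun x u => if hu : u ∈ Finset.range t then x ⟨u, hu⟩ else ω₀ u
  let Z : Set (((i : Finset.range t) → Samples n) × Samples n) :=
    {z | P (run γ α op (ext z.1) t) ∧
      ¬ Q (step (IsTwoChoicesRound γ α n k (t + 1)) z.2 (run γ α op (ext z.1) t))}
  let X : (ℕ → Samples n) → ((i : Finset.range t) → Samples n) := fun ω i => ω i
  let Y : (ℕ → Samples n) → Samples n := fun ω => ω t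
  have hX : Measurable X := by fun_prop
  have hY : Measurable Y := by fun_prop
  have hind : IndepFun X Y μ := by
    have h1 : iIndepFun (fun (i : ℕ) (ω : ℕ → Samples n) => ω i) μ :=
      iIndepFun_infinitePi (P := fun _ : ℕ => uniformOn (Set.univ : Set (Samples n)))
        (X := fun _ ω => ω) (fun _ => measurable_id)
    have h2 := h1.indepFun_finset (Finset.range t) {t} (by simp) (fun i => by fun_prop)
    exact h2.comp (φ := id)
      (ψ := fun y : ((i : ({t} : Finset ℕ)) → Samples n) => y ⟨t, by simp⟩)
      measurable_id (measurable_pi_apply _)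
  have hset : {ω | P (run γ α op ω t) ∧ ¬ Q (run γ α op ω (t + 1))}
      = (fun ω => (X ω, Y ω)) ⁻¹' Z := by
    ext ω
    have : run γ α op (ext (X ω)) t = run γ α op ω t := by
      refine run_congr fun u hu => ?_
      simp [ext, X, hu]
    simp only [Set.mem_ofPred_eq, Set.mem_preimage, Z, this, Y]
    rfl
  have hZ : MeasurableSet Z := (Set.toFinite Z).measurableSet
  have hmap := (indepFun_iff_map_prod_eq_prod_map_map hX.aemeasurable hY.aemeasurable).1 hind
  have : IsProbabilityMeasure (μ.map X) := Measure.isProbabilityMeasure_map hX.aemeasurable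
  have hmY : μ.map Y = uniformOn (Set.univ : Set (Samples n)) :=
    Measure.infinitePi_map_eval (fun _ : ℕ => uniformOn (Set.univ : Set (Samples n))) t
  -- Past and present samples have a product law. For a fixed past the inner probability is a
  -- one-round frequency, at most `δ` if the past leads to `P`, and zero otherwise.
  have key : μ ((fun ω => (X ω, Y ω)) ⁻¹' Z) ≤ ENNReal.ofReal δ := by
    rw [← Measure.map_apply (hX.prodMk hY) hZ, hmap, Measure.prod_apply hZ, hmY]
    calc _ ≤ ∫⁻ _, ENNReal.ofReal δ ∂(μ.map X) := by
          refine lintegral_mono fun x => ?_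
          by_cases hx : P (run γ α op (ext x) t)
          · have := h _ hx
            rw [← freq_eq_measureReal, measureReal_def] at this
            rw [ENNReal.le_ofReal_iff_toReal_le (measure_ne_top _ _) hδ]
            refine le_trans (le_of_eq ?_) this
            congr 2
            ext smp
            simp [Z, hx]
          · have : Prod.mk x ⁻¹' Z = ∅ := by
              ext smp; simp [Z, hx]
            simp [this]
      _ = _ := by simp
  rw [hset, measureReal_def]
  exact ENNReal.toReal_le_of_le_ofReal hδ key

/-- Because `Leads` bounds a joint probability and not a conditional one, a plain union bound
suffices and no conditioning is involved. -/
theorem Leads.trans (hn : 2 ≤ n) {P Q R : (Fin n → NodeState k) → Prop} {t t' t'' : ℕ}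
    {δ δ' : ℝ} (h : Leads γ α op P t Q t' δ) (h' : Leads γ α op Q t' R t'' δ') :
    Leads γ α op P t R t'' (δ + δ') := by
  have := nonempty_samples hn
  have : IsProbabilityMeasure (samplingMeasure n) := by rw [samplingMeasure]; infer_instance
  unfold Leads at *
  refine le_trans (measureReal_mono ?_ (measure_ne_top _ _))
    ((measureReal_union_le _ _).trans (add_le_add h h'))
  rintro ω ⟨h1, h2⟩
  by_cases h3 : Q (run γ α op ω t')
  · exact Or.inr ⟨h3, h2⟩
  · exact Or.inl ⟨h1, h3⟩

theorem Leads.mono (hn : 2 ≤ n) {P Q P' Q' : (Fin n → NodeState k) → Prop} {t t' : ℕ}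
    {δ δ' : ℝ} (h : Leads γ α op P t Q t' δ) (hP : ∀ s, P' s → P s) (hQ : ∀ s, Q s → Q' s)
    (hδ : δ ≤ δ') : Leads γ α op P' t Q' t' δ' := by
  have := nonempty_samples hn
  have : IsProbabilityMeasure (samplingMeasure n) := by rw [samplingMeasure]; infer_instance
  unfold Leads at *
  refine le_trans (measureReal_mono ?_ (measure_ne_top _ _)) (h.trans hδ)
  rintro ω ⟨h1, h2⟩
  exact ⟨hP _ h1, fun h3 => h2 (hQ _ h3)⟩

theorem Leads.refl {P : (Fin n → NodeState k) → Prop} {t : ℕ} : Leads γ α op P t P t 0 := by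
  unfold Leads; simp

end Trajectory

end Plurality

namespace Plurality

/-! ### Expected class sizes after one round -/

section Rounds

open Finset

theorem freq_congr {Ω : Type*} [Fintype Ω] {p q : Ω → Prop} (h : ∀ ω, p ω ↔ q ω) :
    freq p = freq q := le_antisymm (freq_mono fun ω => (h ω).1) (freq_mono fun ω => (h ω).2)

theorem freq_true {Ω : Type*} [Fintype Ω] [Nonempty Ω] : freq (fun _ : Ω => True) = 1 := by
  have : (Fintype.card Ω : ℝ) ≠ 0 := by exact_mod_cast Fintype.card_ne_zero
  simp [freq, this]

theorem freq_false {Ω : Type*} [Fintype Ω] : freq (fun _ : Ω => False) = 0 := by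
  simp [freq]

theorem freq_or_of_disjoint {Ω : Type*} [Fintype Ω] {p q : Ω → Prop} (h : ∀ ω, p ω → ¬ q ω) :
    freq (fun ω => p ω ∨ q ω) = freq p + freq q := by
  classical
  unfold freq
  rw [← add_div]
  congr 1
  have h1 : (univ.filter fun ω => p ω ∨ q ω) = univ.filter p ∪ univ.filter q := by
    ext ω; simp
  have h2 : Disjoint (univ.filter p) (univ.filter q) := by
    rw [disjoint_filter]; exact fun ω _ => h ω
  have h3 := card_union_of_disjoint h2
  rw [← h1] at h3
  exact_mod_cast (by convert h3)

theorem freq_not {Ω : Type*} [Fintype Ω] [Nonempty Ω] (p : Ω → Prop) :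
    freq (fun ω => ¬ p ω) = 1 - freq p := by
  have := freq_or_of_disjoint (p := p) (q := fun ω => ¬ p ω) (fun ω h h' => h' h)
  rw [freq_congr (q := fun _ => True) (fun ω => by simp [em]), freq_true] at this
  linarith

theorem freq_prod {Ω Ω' : Type*} [Fintype Ω] [Fintype Ω'] (p : Ω → Prop) (q : Ω' → Prop) :
    freq (fun x : Ω × Ω' => p x.1 ∧ q x.2) = freq p * freq q := by
  classical
  unfold freq
  have : (univ.filter fun x : Ω × Ω' => p x.1 ∧ q x.2) = univ.filter p ×ˢ univ.filter q := by
    ext x; simp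
  rw [Fintype.card_prod, div_mul_div_comm, ← Nat.cast_mul, ← Nat.cast_mul, ← card_product]
  have h := congrArg card this
  refine congrArg₂ _ (congrArg _ ?_) rfl
  convert h

theorem freq_exists_eq_sum {Ω ι : Type*} [Fintype Ω] [Fintype ι] (p : ι → Ω → Prop)
    (h : ∀ ω i j, p i ω → p j ω → i = j) :
    freq (fun ω => ∃ i, p i ω) = ∑ i, freq (p i) := by
  classical
  unfold freq
  rw [← sum_div]
  congr 1
  have h1 : (univ.filter fun ω => ∃ i, p i ω) = univ.biUnion fun i => univ.filter (p i) := by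
    ext ω; simp
  have h2 := card_biUnion (s := (univ : Finset ι)) (t := fun i => univ.filter (p i)) (by
    intro i _ j _ hij
    rw [Function.onFun, disjoint_filter]
    exact fun ω _ hi hj => hij (h ω i j hi hj))
  rw [← h1] at h2
  rw [← Nat.cast_sum]
  congr 1
  refine (Eq.trans ?_ h2).trans ?_ <;> congr!

variable {n k : ℕ}

theorem nonempty_neighbor (hn : 2 ≤ n) (v : Fin n) : Nonempty (Neighbor v) := by
  have : Nontrivial (Fin n) := Fin.nontrivial_iff_two_le.2 hn
  obtain ⟨u, hu⟩ := exists_ne v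
  exact ⟨⟨u, hu⟩⟩

theorem freq_neighbor_mem (hn : 2 ≤ n) (v : Fin n) (D : Finset (Fin n)) :
    freq (fun x : Neighbor v => x.1 ∈ D) = ((D.erase v).card : ℝ) / ((n : ℝ) - 1) := by
  classical
  unfold freq
  have h1 : Fintype.card (Neighbor v) = n - 1 := by
    rw [Fintype.card_subtype_compl]; simp
  rw [h1, Nat.cast_sub (by omega), Nat.cast_one]
  congr 2
  rw [← card_map (Function.Embedding.subtype _)]
  congr 1
  ext u
  simp [and_comm]

theorem freq_pair_mem (hn : 2 ≤ n) (v : Fin n) (D E : Finset (Fin n)) :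
    freq (fun x : Neighbor v × Neighbor v => x.1.1 ∈ D ∧ x.2.1 ∈ E)
      = ((D.erase v).card : ℝ) * ((E.erase v).card : ℝ) / ((n : ℝ) - 1) ^ 2 := by
  rw [freq_prod (fun x : Neighbor v => x.1 ∈ D) (fun x : Neighbor v => x.1 ∈ E),
    freq_neighbor_mem hn, freq_neighbor_mem hn, div_mul_div_comm, sq]

theorem freq_first_mem (hn : 2 ≤ n) (v : Fin n) (D : Finset (Fin n)) :
    freq (fun x : Neighbor v × Neighbor v => x.1.1 ∈ D)
      = ((D.erase v).card : ℝ) / ((n : ℝ) - 1) := by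
  have := nonempty_neighbor hn v
  have h := freq_prod (fun x : Neighbor v => x.1 ∈ D) (fun _ : Neighbor v => True)
  rw [freq_true, mul_one, freq_neighbor_mem hn] at h
  rw [← h]
  exact freq_congr fun x => by simp

/-- `v` ends a round in `A ⊆ T` if it was in `A`, or if it was outside `T` and its preferred sample
is in `A`. -/
def JoinsClass (A T : Finset (Fin n)) (v : Fin n) (x : Neighbor v × Neighbor v) : Prop :=
  v ∈ A ∨ (v ∉ T ∧ (x.1.1 ∈ A ∨ (x.1.1 ∉ T ∧ x.2.1 ∈ A)))

/-- Both samples of `v` lie in `A`. -/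
def BothIn (A : Finset (Fin n)) (v : Fin n) (x : Neighbor v × Neighbor v) : Prop :=
  x.1.1 ∈ A ∧ x.2.1 ∈ A

/-- `v` and both of its samples lie outside `T`. -/
def StaysOutside (T : Finset (Fin n)) (v : Fin n) (x : Neighbor v × Neighbor v) : Prop :=
  v ∉ T ∧ x.1.1 ∉ T ∧ x.2.1 ∉ T

/-- The factor by which every class of the top generation, of total size `G`, grows in expectation
in a propagation round. -/
noncomputable def growth (n : ℕ) (G : ℝ) : ℝ :=
  1 + (n - G) * (2 * (n - 1) - G) / ((n : ℝ) - 1) ^ 2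

/-- A node outside `T` enters `A` if its first sample hits `A`, or if that sample misses `T` and the
second one hits `A`. The probability is |A| times a coefficient that depends on |T| alone. Hence all
classes grow by the same factor, and ratios are preserved in expectation. -/
theorem expectedCount_joinsClass (hn : 2 ≤ n) {A T : Finset (Fin n)} (hAT : A ⊆ T) :
    expectedCount (JoinsClass A T) = A.card * growth n T.card := by
  classical
  have hn1 : (0 : ℝ) < (n : ℝ) - 1 := by
    have : (2 : ℝ) ≤ n := by exact_mod_cast hn
    linarith
  have h1 : ∀ v, freq (JoinsClass A T v) = (if v ∈ A then 1 else 0)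
      + (if v ∉ T then (A.card : ℝ) * (2 * (n - 1) - T.card) / ((n : ℝ) - 1) ^ 2 else 0) := by
    intro v
    have := nonempty_neighbor hn v
    by_cases hA : v ∈ A
    · have hT := hAT hA
      rw [freq_congr (q := fun _ => True) (by intro x; simp [JoinsClass, hA]), freq_true]
      simp [hA, hT]
    · by_cases hT : v ∈ T
      · rw [freq_congr (q := fun _ => False) (by intro x; simp [JoinsClass, hA, hT]), freq_false]
        simp [hA, hT]
      · rw [freq_congr (q := fun x => x.1.1 ∈ A ∨ (x.1.1 ∈ Tᶜ ∧ x.2.1 ∈ A))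
          (by intro x; simp [JoinsClass, hA, hT]),
          freq_or_of_disjoint (by
            intro x hx hx'
            exact (mem_compl.1 hx'.1) (hAT hx)),
          freq_first_mem hn, freq_pair_mem hn, erase_eq_of_notMem hA,
          card_erase_of_mem (by simpa using hT), card_compl, Fintype.card_fin]
        have h2 : T.card + 1 ≤ n := by
          have := card_le_card (subset_univ (insert v T))
          rwa [card_insert_of_notMem hT, card_univ, Fintype.card_fin] at this
        rw [Nat.cast_sub (by omega), Nat.cast_sub (by omega)]
        simp only [hA, hT, if_false, not_false_eq_true, if_true]
        field_simp
        push_cast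
        ring
  rw [expectedCount, sum_congr rfl fun v _ => h1 v, sum_add_distrib, ← sum_filter, ← sum_filter,
    sum_const, sum_const, nsmul_eq_mul, nsmul_eq_mul]
  have h2 : (univ.filter fun v => v ∈ A) = A := by ext; simp
  have h3 : (univ.filter fun v => v ∉ T) = Tᶜ := by ext; simp
  have h4 : T.card ≤ n := by simpa using card_le_card (subset_univ T)
  rw [h2, h3, card_compl, Fintype.card_fin, Nat.cast_sub h4, growth]
  field_simp

theorem expectedCount_staysOutside (hn : 2 ≤ n) (T : Finset (Fin n)) :
    expectedCount (StaysOutside T)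
      = ((n : ℝ) - T.card) * (((n : ℝ) - T.card - 1) / (n - 1)) ^ 2 := by
  classical
  have h1 : ∀ v, freq (StaysOutside T v)
      = if v ∉ T then (((n : ℝ) - T.card - 1) / (n - 1)) ^ 2 else 0 := by
    intro v
    by_cases hT : v ∈ T
    · rw [freq_congr (q := fun _ => False) (by intro x; simp [StaysOutside, hT]), freq_false]
      simp [hT]
    · rw [freq_congr (q := fun x => x.1.1 ∈ Tᶜ ∧ x.2.1 ∈ Tᶜ)
        (by intro x; simp [StaysOutside, hT]), freq_pair_mem hn,
        card_erase_of_mem (by simpa using hT), card_compl, Fintype.card_fin]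
      have h2 : T.card + 1 ≤ n := by
        have := card_le_card (subset_univ (insert v T))
        rwa [card_insert_of_notMem hT, card_univ, Fintype.card_fin] at this
      rw [Nat.cast_sub (by omega), Nat.cast_sub (by omega)]
      simp only [hT, not_false_eq_true, if_true, div_pow]
      push_cast
      ring
  rw [expectedCount, sum_congr rfl fun v _ => h1 v, ← sum_filter, sum_const, nsmul_eq_mul]
  have h3 : (univ.filter fun v => v ∉ T) = Tᶜ := by ext; simp
  have h4 : T.card ≤ n := by simpa using card_le_card (subset_univ T)
  rw [h3, card_compl, Fintype.card_fin, Nat.cast_sub h4]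

theorem expectedCount_not_staysOutside (hn : 2 ≤ n) (T : Finset (Fin n)) :
    expectedCount (fun v x => ¬ StaysOutside T v x)
      = n - ((n : ℝ) - T.card) * (((n : ℝ) - T.card - 1) / (n - 1)) ^ 2 := by
  rw [← expectedCount_staysOutside hn, expectedCount, expectedCount]
  have : ∀ v : Fin n, freq (fun x => ¬ StaysOutside T v x) = 1 - freq (StaysOutside T v) := by
    intro v
    have := nonempty_neighbor hn v
    exact freq_not _
  rw [sum_congr rfl fun v _ => this v, sum_sub_distrib]
  simp

/-- The main term is n·|A|²/(n - 1)². A member of `A` has one neighbor fewer in `A`, which replaces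
|A|² by (|A| - 1)² and explains the correction 1 - 2|A|. -/
theorem expectedCount_bothIn (hn : 2 ≤ n) (A : Finset (Fin n)) :
    expectedCount (BothIn A) = A.card * (((n : ℝ) - 2) * A.card + 1) / ((n : ℝ) - 1) ^ 2 := by
  classical
  have h1 : ∀ v, freq (BothIn A v) = (A.card : ℝ) ^ 2 / ((n : ℝ) - 1) ^ 2
      + if v ∈ A then (1 - 2 * (A.card : ℝ)) / ((n : ℝ) - 1) ^ 2 else 0 := by
    intro v
    rw [show freq (BothIn A v) = _ from freq_pair_mem hn v A A]
    by_cases hA : v ∈ A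
    · rw [card_erase_of_mem hA, Nat.cast_sub (card_pos.2 ⟨v, hA⟩)]
      simp only [hA, if_true]
      rw [← add_div]
      push_cast
      ring
    · rw [erase_eq_of_notMem hA]
      simp [hA, sq]
  rw [expectedCount, sum_congr rfl fun v _ => h1 v, sum_add_distrib, ← sum_filter, sum_const,
    sum_const, nsmul_eq_mul, nsmul_eq_mul]
  have h2 : (univ.filter fun v => v ∈ A) = A := by ext; simp
  rw [h2, card_univ, Fintype.card_fin]
  ring

theorem expectedCount_exists_bothIn (hn : 2 ≤ n) {ι : Type*} [Fintype ι]
    (A : ι → Finset (Fin n)) (hA : ∀ i j v, v ∈ A i → v ∈ A j → i = j) :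
    expectedCount (fun v x => ∃ i, BothIn (A i) v x)
      = ∑ i, ((A i).card : ℝ) * (((n : ℝ) - 2) * (A i).card + 1) / ((n : ℝ) - 1) ^ 2 := by
  simp only [expectedCount]
  rw [sum_congr rfl fun v _ => freq_exists_eq_sum _ fun x i j hi hj => hA i j _ hi.1 hj.1,
    sum_comm]
  exact sum_congr rfl fun i _ => expectedCount_bothIn hn (A i)

/-- The nodes of generation `i`. -/
def nodesOfGen (s : Fin n → NodeState k) (i : ℕ) : Finset (Fin n) :=
  univ.filter fun v => (s v).gen = i

/-- The nodes of generation `i` and opinion `j`. -/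
def nodesOf (s : Fin n → NodeState k) (i : ℕ) (j : Fin k) : Finset (Fin n) :=
  univ.filter fun v => (s v).gen = i ∧ (s v).col = j

theorem mem_nodesOfGen {s : Fin n → NodeState k} {i : ℕ} {v : Fin n} :
    v ∈ nodesOfGen s i ↔ (s v).gen = i := by simp [nodesOfGen]

theorem mem_nodesOf {s : Fin n → NodeState k} {i : ℕ} {j : Fin k} {v : Fin n} :
    v ∈ nodesOf s i j ↔ (s v).gen = i ∧ (s v).col = j := by simp [nodesOf]

theorem nodesOf_subset (s : Fin n → NodeState k) (i : ℕ) (j : Fin k) :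
    nodesOf s i j ⊆ nodesOfGen s i := fun v hv => by
  rw [mem_nodesOfGen]; exact (mem_nodesOf.1 hv).1

theorem card_nodesOfGen (s : Fin n → NodeState k) (i : ℕ) :
    (nodesOfGen s i).card = ∑ j, (nodesOf s i j).card := by
  classical
  rw [← card_biUnion]
  · congr 1
    ext v
    simp [mem_nodesOfGen, mem_nodesOf]
  · intro j _ j' _ hjj
    rw [Function.onFun, Finset.disjoint_left]
    intro v hv hv'
    exact hjj ((mem_nodesOf.1 hv).2.symm.trans (mem_nodesOf.1 hv').2)

/-! ### Combinatorial description of one round -/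

section Step

variable {tc : Prop} [Decidable tc] {smp : Samples n} {s : Fin n → NodeState k} {i : ℕ}

theorem step_gen_le (htc : ¬ tc) (hs : ∀ v, (s v).gen ≤ i) (v : Fin n) :
    (step tc smp s v).gen ≤ i := by
  simp only [step, htc, false_and, if_false]
  split_ifs <;> exact hs _

/-- No generation exceeds `i`, so the first sample is preferred whenever it has generation `i`, ties
included; this is the source of the asymmetric form of `JoinsClass`. -/
theorem mem_nodesOf_step (htc : ¬ tc) (hs : ∀ v, (s v).gen ≤ i) (j : Fin k) (v : Fin n) :
    v ∈ nodesOf (step tc smp s) i j ↔ JoinsClass (nodesOf s i j) (nodesOfGen s i) v (smp v) := by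
  have h0 := hs v
  have h1 := hs (smp v).1
  have h2 := hs (smp v).2
  simp only [JoinsClass, mem_nodesOf, mem_nodesOfGen, step, htc, false_and, if_false]
  by_cases hyx : (s (smp v).2).gen ≤ (s (smp v).1).gen
  · simp only [hyx, if_true]
    split_ifs with h
    · constructor
      · rintro ⟨ha, hb⟩
        exact Or.inr ⟨by omega, Or.inl ⟨ha, hb⟩⟩
      · rintro (⟨ha, hb⟩ | ⟨ha, (⟨hb, hc⟩ | ⟨hb, hc, hd⟩)⟩)
        · omega
        · exact ⟨hb, hc⟩
        · omega
    · constructor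
      · intro ha; exact Or.inl ha
      · rintro (ha | ⟨ha, (⟨hb, hc⟩ | ⟨hb, hc, hd⟩)⟩)
        · exact ha
        · omega
        · omega
  · simp only [hyx, if_false]
    split_ifs with h
    · constructor
      · rintro ⟨ha, hb⟩
        exact Or.inr ⟨by omega, Or.inr ⟨by omega, ha, hb⟩⟩
      · rintro (⟨ha, hb⟩ | ⟨ha, (⟨hb, hc⟩ | ⟨hb, hc, hd⟩)⟩)
        · omega
        · omega
        · exact ⟨hc, hd⟩
    · constructor
      · intro ha; exact Or.inl ha
      · rintro (ha | ⟨ha, (⟨hb, hc⟩ | ⟨hb, hc, hd⟩)⟩)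
        · exact ha
        · omega
        · omega

theorem mem_nodesOfGen_step (htc : ¬ tc) (hs : ∀ v, (s v).gen ≤ i) (v : Fin n) :
    v ∈ nodesOfGen (step tc smp s) i ↔ ¬ StaysOutside (nodesOfGen s i) v (smp v) := by
  have h0 := hs v
  have h1 := hs (smp v).1
  have h2 := hs (smp v).2
  simp only [StaysOutside, mem_nodesOfGen, step, htc, false_and, if_false]
  by_cases hyx : (s (smp v).2).gen ≤ (s (smp v).1).gen
  · simp only [hyx, if_true]
    split_ifs <;> omega
  · simp only [hyx, if_false]
    split_ifs <;> omega

theorem step_gen_le_succ (hs : ∀ v, (s v).gen ≤ i) (v : Fin n) :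
    (step tc smp s v).gen ≤ i + 1 := by
  have h0 := hs v
  have h1 := hs (smp v).1
  have h2 := hs (smp v).2
  simp only [step]
  split_ifs <;> (try dsimp only) <;> omega

/-- Generation `i + 1` is new, so it can be entered only by a two-choices step from two samples of
generation `i`; the condition on the node's own generation is then automatic. -/
theorem mem_nodesOf_step_succ (htc : tc) (hs : ∀ v, (s v).gen ≤ i) (j : Fin k) (v : Fin n) :
    v ∈ nodesOf (step tc smp s) (i + 1) j ↔ BothIn (nodesOf s i j) v (smp v) := by
  have h0 := hs v
  have h1 := hs (smp v).1
  have h2 := hs (smp v).2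
  simp only [BothIn, mem_nodesOf, step, htc, true_and]
  by_cases hyx : (s (smp v).2).gen ≤ (s (smp v).1).gen
  · simp only [hyx, if_true]
    split_ifs with h h'
    · dsimp only
      obtain ⟨ha, hb, hc⟩ := h
      rw [← hc, ← hb]
      simp
    · constructor
      · rintro ⟨ha, hb⟩; omega
      · rintro ⟨⟨ha, hb⟩, hc, hd⟩; omega
    · constructor
      · rintro ⟨ha, hb⟩; omega
      · rintro ⟨⟨ha, hb⟩, hc, hd⟩
        exact absurd ⟨by omega, by omega, hb.trans hd.symm⟩ h
  · simp only [hyx, if_false]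
    split_ifs with h h'
    · dsimp only
      obtain ⟨ha, hb, hc⟩ := h
      rw [← hc, ← hb]
      simp
    · constructor
      · rintro ⟨ha, hb⟩; omega
      · rintro ⟨⟨ha, hb⟩, hc, hd⟩; omega
    · constructor
      · rintro ⟨ha, hb⟩; omega
      · rintro ⟨⟨ha, hb⟩, hc, hd⟩; omega

theorem mem_nodesOfGen_step_succ (htc : tc) (hs : ∀ v, (s v).gen ≤ i) (v : Fin n) :
    v ∈ nodesOfGen (step tc smp s) (i + 1) ↔ ∃ j, BothIn (nodesOf s i j) v (smp v) := by
  simp only [← mem_nodesOf_step_succ htc hs, mem_nodesOf, mem_nodesOfGen]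
  simp

theorem step_col_eq {a : Fin k} (hs : ∀ v, (s v).col = a) (v : Fin n) :
    (step tc smp s v).col = a := by
  simp only [step]
  split_ifs <;> exact hs _

end Step

theorem card_eq_occurrences (P : ∀ v : Fin n, Neighbor v × Neighbor v → Prop) (smp : Samples n)
    (D : Finset (Fin n)) (h : ∀ v, v ∈ D ↔ P v (smp v)) : D.card = occurrences P smp := by
  classical
  unfold occurrences
  congr 1
  ext v
  simp [h]

end Rounds

end Plurality

namespace Plurality

/-! ### Concentration in a single round -/

section RoundBounds

open Finset

variable {n k : ℕ}

theorem sqrt_mul_le_sqrt_div_mul {l U M : ℝ} (hl : 0 ≤ l) (hU : 0 < U) (hUM : U ≤ M) :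
    Real.sqrt (l * M) ≤ Real.sqrt (l / U) * M := by
  have hM : 0 < M := hU.trans_le hUM
  have h1 : Real.sqrt (l / U) * M = Real.sqrt (l / U * (M * M)) := by
    rw [Real.sqrt_mul (by positivity), Real.sqrt_mul_self hM.le]
  rw [h1]
  apply Real.sqrt_le_sqrt
  rw [div_mul_eq_mul_div, le_div_iff₀ hU]
  have : l * M * U ≤ l * M * M := by gcongr
  linarith

/-- Origin of the factor 3 in all losses: relative errors y on both classes cost at most 3y in the
logarithm of their ratio. -/
theorem one_add_le_exp_mul_one_sub {y : ℝ} (h0 : 0 ≤ y) (h1 : y ≤ 1 / 3) :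
    1 + y ≤ Real.exp (3 * y) * (1 - y) := by
  have h2 := Real.add_one_le_exp (3 * y)
  calc 1 + y ≤ (3 * y + 1) * (1 - y) := by nlinarith
    _ ≤ _ := by gcongr; linarith

theorem sqrt_div_le_third {l U : ℝ} (hU : 0 < U) (h : 9 * l ≤ U) :
    Real.sqrt (l / U) ≤ 1 / 3 := by
  rw [Real.sqrt_le_left (by norm_num), div_le_iff₀ hU]
  linarith

/-- If the class of the dominant opinion does not fall short of, and a competing class does not
exceed, its expectation by more than the typical deviation, the ratio is nearly preserved. -/
theorem ratio_after_deviation {l U R E A' B' : ℝ} (hl : 0 ≤ l) (hU : 0 < U) (h9 : 9 * l ≤ U)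
    (hR1 : R ≤ 1) (hR0 : 0 ≤ R) (hUE : U ≤ R * E)
    (hA : E - Real.sqrt (l * E) ≤ A')
    (hB : B' ≤ R * E + Real.sqrt (l * (R * E))) :
    B' ≤ R * Real.exp (3 * Real.sqrt (l / U)) * A' := by
  set y := Real.sqrt (l / U) with hy
  have hy0 : 0 ≤ y := Real.sqrt_nonneg _
  have hy1 : y ≤ 1 / 3 := sqrt_div_le_third hU h9
  have hE : 0 < E := by
    by_contra h
    have : R * E ≤ 0 := mul_nonpos_of_nonneg_of_nonpos hR0 (not_lt.1 h)
    linarith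
  have hUE' : U ≤ E := hUE.trans (mul_le_of_le_one_left hE.le hR1)
  have h1 := sqrt_mul_le_sqrt_div_mul hl hU hUE
  have h2 := sqrt_mul_le_sqrt_div_mul hl hU hUE'
  rw [← hy] at h1 h2
  have h3 := one_add_le_exp_mul_one_sub hy0 hy1
  calc B' ≤ R * E * (1 + y) := by linarith
    _ ≤ R * E * (Real.exp (3 * y) * (1 - y)) := by gcongr
    _ = R * Real.exp (3 * y) * (E - y * E) := by ring
    _ ≤ _ := by gcongr; linarith

/-- The top generation is at most `i`; in generation `i`, opinion `a` dominates every other opinion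
by a factor of at least `1 / R`; generation `i` holds at least a fraction `Γ` of the nodes. -/
def Dominates (i : ℕ) (a : Fin k) (R Γ : ℝ) (s : Fin n → NodeState k) : Prop :=
  (∀ v, (s v).gen ≤ i) ∧
  (∀ b, b ≠ a → ((nodesOf s i b).card : ℝ) ≤ R * (nodesOf s i a).card) ∧
  Γ * n ≤ (nodesOfGen s i).card

/-- The top generation is `i`, is monochromatic of opinion `a`, and misses at most a fraction `h`
of the nodes. -/
def Unanimous (i : ℕ) (a : Fin k) (h : ℝ) (s : Fin n → NodeState k) : Prop :=
  (∀ v, (s v).gen ≤ i) ∧ (∀ v, (s v).gen = i → (s v).col = a) ∧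
  (n : ℝ) - (nodesOfGen s i).card ≤ h * n

theorem Dominates.mono {i : ℕ} {a : Fin k} {R Γ R' Γ' : ℝ} {s : Fin n → NodeState k}
    (h : Dominates i a R Γ s) (hR : R ≤ R') (hΓ : Γ' ≤ Γ) : Dominates i a R' Γ' s := by
  refine ⟨h.1, fun b hb => (h.2.1 b hb).trans (by gcongr), le_trans ?_ h.2.2⟩
  gcongr

theorem sum_card_nodesOf {i : ℕ} (a : Fin k) (s : Fin n → NodeState k) :
    ((nodesOfGen s i).card : ℝ)
      = (nodesOf s i a).card + ∑ b ∈ univ.erase a, ((nodesOf s i b).card : ℝ) := by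
  rw [card_nodesOfGen, Nat.cast_sum, ← add_sum_erase _ _ (mem_univ a)]

theorem Dominates.le_card {i : ℕ} {a : Fin k} {R Γ : ℝ} {s : Fin n → NodeState k}
    (h : Dominates i a R Γ s) (hR : 0 ≤ R) : Γ * n ≤ (nodesOf s i a).card * (1 + k * R) := by
  refine h.2.2.trans ?_
  rw [sum_card_nodesOf a]
  have h1 : ∑ b ∈ univ.erase a, ((nodesOf s i b).card : ℝ)
      ≤ ∑ b ∈ univ.erase a, R * ((nodesOf s i a).card : ℝ) :=
    sum_le_sum fun b hb => h.2.1 b (ne_of_mem_erase hb)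
  have h2 : ∑ b ∈ univ.erase a, R * ((nodesOf s i a).card : ℝ)
      ≤ k * (R * (nodesOf s i a).card) := by
    rw [sum_const, nsmul_eq_mul]
    have : ((univ.erase a).card : ℝ) ≤ k := by
      have := card_le_univ (univ.erase a)
      rw [Fintype.card_fin] at this
      exact_mod_cast this
    gcongr
  nlinarith

theorem card_nodesOfGen_le (s : Fin n → NodeState k) (i : ℕ) : (nodesOfGen s i).card ≤ n := by
  simpa using card_le_card (subset_univ (nodesOfGen s i))

theorem one_le_growth (hn : 2 ≤ n) {G : ℝ} (hG : G ≤ n) : 1 ≤ growth n G := by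
  have : (2 : ℝ) ≤ n := by exact_mod_cast hn
  unfold growth
  have : 0 ≤ ((n : ℝ) - G) * (2 * (n - 1) - G) / ((n : ℝ) - 1) ^ 2 := by
    apply div_nonneg (mul_nonneg (by linarith) (by linarith)) (by positivity)
  linarith

/-- A node stays outside only if both of its samples are outside as well, which gives the cube.
Sampling only neighbors helps, since (H - 1)/(n - 1) ≤ H/n for 1 ≤ H ≤ n; the case H = 0 is separate
because H - 1 is then negative. -/
theorem outside_mean_le (hn : 2 ≤ n) {T : Finset (Fin n)} {h : ℝ}
    (hT : (n : ℝ) - T.card ≤ h * n) :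
    ((n : ℝ) - T.card) * (((n : ℝ) - T.card - 1) / (n - 1)) ^ 2 ≤ h ^ 3 * n := by
  have hn2 : (2 : ℝ) ≤ n := by exact_mod_cast hn
  have hTn : T.card ≤ n := by simpa using card_le_card (subset_univ T)
  obtain ⟨H, hH⟩ := Nat.exists_eq_add_of_le hTn
  have hH' : (n : ℝ) - T.card = H := by
    have : (n : ℝ) = T.card + H := by exact_mod_cast hH
    linarith
  rw [hH'] at hT ⊢
  have hh : 0 ≤ h := by
    by_contra hh
    have : h * n < 0 := mul_neg_of_neg_of_pos (not_le.1 hh) (by linarith)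
    have : (0 : ℝ) ≤ H := by positivity
    linarith
  rcases Nat.eq_zero_or_pos H with h0 | h0
  · rw [h0]; simp; positivity
  · have h1 : (1 : ℝ) ≤ H := by exact_mod_cast h0
    have hHn : (H : ℝ) ≤ n := by exact_mod_cast (by omega : H ≤ n)
    have h2 : ((H : ℝ) - 1) / (n - 1) ≤ h := by
      rw [div_le_iff₀ (by linarith)]
      by_cases hh1 : h ≤ 1
      · nlinarith
      · nlinarith
    have h3 : 0 ≤ ((H : ℝ) - 1) / (n - 1) := div_nonneg (by linarith) (by linarith)
    calc (H : ℝ) * (((H : ℝ) - 1) / (n - 1)) ^ 2 ≤ (h * n) * h ^ 2 := by gcongr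
      _ = h ^ 3 * n := by ring

/-- Union bound over the three ways in which a round may deviate. -/
theorem freq_deviation_le {Ω : Type*} [Fintype Ω] {p q : Ω → Prop} {r : Fin k → Ω → Prop}
    {δ δ' : ℝ} (hp : freq p ≤ δ) (hq : freq q ≤ δ) (hr : ∀ b, freq (r b) ≤ δ')
    {bad : Ω → Prop} (h : ∀ ω, ¬ p ω → ¬ q ω → (∀ b, ¬ r b ω) → ¬ bad ω) :
    freq bad ≤ 2 * δ + k * δ' := by
  have h1 : freq bad ≤ freq (fun ω => (p ω ∨ q ω) ∨ ∃ b, r b ω) := by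
    refine freq_mono fun ω hω => ?_
    by_contra hc
    push Not at hc
    exact h ω hc.1.1 hc.1.2 hc.2 hω
  have h2 := freq_or_le (fun ω => p ω ∨ q ω) (fun ω => ∃ b, r b ω)
  have h3 := freq_or_le p q
  have h4 := freq_exists_le r δ' hr
  rw [Fintype.card_fin] at h4
  linarith

/-- Ratios survive because all classes share the factor `growth`. The generation itself reaches in
expectation at least the fraction 1 - (1 - Γ)³ = Γ(3 - 3Γ + Γ²) ≥ Γ(3 - 3γ + γ²), and 3 - 3γ + γ²
exceeds 2 - γ by (1 - γ)², which leaves room for the deviation. -/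
theorem propagation_round (hn : 2 ≤ n) {i : ℕ} {a : Fin k} {R Γ Γ' γ l U : ℝ}
    {s : Fin n → NodeState k} {tc : Prop} [Decidable tc] (htc : ¬ tc)
    (h : Dominates i a R Γ s) (hl : 0 ≤ l) (hU : 0 < U) (h9 : 9 * l ≤ U) (hR1 : R ≤ 1)
    (hR0 : 0 < R) (hUR : U * (1 + k * R) ≤ R * (Γ * n)) (hΓ0 : 0 < Γ) (hΓγ : Γ ≤ γ) (hγ1 : γ ≤ 1)
    (hslack : 2 - γ ≤ (3 - 3 * γ + γ ^ 2) * (1 - Real.sqrt (l / (Γ * n))))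
    (hΓ' : Γ' ≤ (2 - γ) * Γ) :
    freq (fun smp => ¬ Dominates i a (R * Real.exp (3 * Real.sqrt (l / U))) Γ' (step tc smp s))
      ≤ (k + 2) * Real.exp (-l / 4) := by
  have hn2 : (2 : ℝ) ≤ n := by exact_mod_cast hn
  set A := nodesOf s i a with hA
  set T := nodesOfGen s i with hT
  set m := growth n T.card with hm
  have hTn : (T.card : ℝ) ≤ n := by exact_mod_cast card_nodesOfGen_le s i
  have hm1 : 1 ≤ m := one_le_growth hn hTn
  have hkR : 0 < 1 + k * R := by positivity
  -- The scale for deviations is R times the dominant class and not the true size of a competitor,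
  -- so competitors may be arbitrarily small.
  have hUA : U ≤ R * A.card := by
    have h1 := h.le_card hR0.le
    have h2 : U * (1 + k * R) ≤ R * A.card * (1 + k * R) := by
      calc _ ≤ R * (Γ * n) := hUR
        _ ≤ R * (A.card * (1 + k * R)) := by gcongr
        _ = _ := by ring
    exact le_of_mul_le_mul_right h2 hkR
  have hA0 : 0 < (A.card : ℝ) := by
    by_contra h0
    have : R * A.card ≤ 0 := mul_nonpos_of_nonneg_of_nonpos hR0.le (not_lt.1 h0)
    linarith
  set E := A.card * m with hE
  have hE0 : 0 < E := by positivity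
  have hUE : U ≤ R * E := by
    calc U ≤ R * A.card := hUA
      _ ≤ R * (A.card * m) := by gcongr; exact le_mul_of_one_le_right hA0.le hm1
  set M := n * Γ * (3 - 3 * γ + γ ^ 2) with hM
  have hcoef : 1 ≤ 3 - 3 * γ + γ ^ 2 := by nlinarith
  have hM0 : 0 < M := by
    have : (0 : ℝ) < n := by linarith
    positivity
  have hne (v : Fin n) : Nonempty (Neighbor v × Neighbor v) := by
    have := nonempty_neighbor hn v
    infer_instance
  have p1 := freq_lower_tail (JoinsClass A T) (l := l) hl hE0
    (by rw [expectedCount_joinsClass hn (nodesOf_subset s i a)])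
  have p2 : freq (fun ω : Samples n => (occurrences (fun v x => ¬ StaysOutside T v x) ω : ℝ)
      < M - Real.sqrt (l * M)) ≤ Real.exp (-l / 4) := by
    refine freq_lower_tail (fun v x => ¬ StaysOutside T v x) (l := l) hl hM0 ?_
    rw [expectedCount_not_staysOutside hn]
    have h1 := outside_mean_le hn (T := T) (h := 1 - Γ) (by have := h.2.2; linarith)
    have h2 : 1 - (1 - Γ) ^ 3 = Γ * (3 - 3 * Γ + Γ ^ 2) := by ring
    have h3 : M ≤ n * (Γ * (3 - 3 * Γ + Γ ^ 2)) := by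
      rw [hM, mul_assoc]
      gcongr ?_ * (?_ * ?_)
      nlinarith
    rw [← h2] at h3
    linarith
  have p3 : ∀ b, freq (fun ω : Samples n => b ≠ a ∧ R * E + Real.sqrt (l * (R * E)) ≤
      occurrences (JoinsClass (nodesOf s i b) T) ω) ≤ Real.exp (-l / 4) := by
    intro b
    by_cases hb : b = a
    · rw [freq_congr (q := fun _ => False) (by simp [hb]), freq_false]; positivity
    · refine (freq_mono fun ω hω => hω.2).trans
        (freq_upper_tail (JoinsClass (nodesOf s i b) T) hl (by positivity) (by linarith) ?_)
      rw [expectedCount_joinsClass hn (nodesOf_subset s i b), hE, ← mul_assoc]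
      gcongr
      exact h.2.1 b hb
  refine (freq_deviation_le p1 p2 p3 ?_).trans (by ring_nf; rfl)
  intro ω h1 h2 h3
  rw [not_not]
  refine ⟨step_gen_le htc h.1, fun b hb => ?_, ?_⟩
  · rw [card_eq_occurrences _ ω _ (mem_nodesOf_step htc h.1 b),
      card_eq_occurrences _ ω _ (mem_nodesOf_step htc h.1 a)]
    have h4 := h3 b
    push Not at h4
    exact ratio_after_deviation hl hU h9 hR1 hR0.le hUE (not_lt.1 h1) (h4 hb).le
  · rw [card_eq_occurrences (fun v x => ¬ StaysOutside (nodesOfGen s i) v x) ω _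
      (mem_nodesOfGen_step htc h.1)]
    have hΓn : 0 < Γ * n := by
      have : (0 : ℝ) < n := by linarith
      positivity
    have h5 := sqrt_mul_le_sqrt_div_mul (M := M) hl hΓn (by rw [hM]; nlinarith)
    calc Γ' * n ≤ (2 - γ) * Γ * n := by gcongr
      _ = (2 - γ) * (Γ * n) := by ring
      _ ≤ (3 - 3 * γ + γ ^ 2) * (1 - Real.sqrt (l / (Γ * n))) * (Γ * n) := by gcongr
      _ = M - Real.sqrt (l / (Γ * n)) * M := by rw [hM]; ring
      _ ≤ _ := by linarith [not_lt.1 h2]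

/-- The fraction of nodes that is promoted in expectation, if all nodes have the top generation and
the dominant opinion is larger than all others by a factor of `1 / R`. -/
noncomputable def collision (k : ℕ) (R : ℝ) : ℝ := (1 + (k - 1) * R ^ 2) / (1 + (k - 1) * R) ^ 2

/-- The extremal case has all competitors equal to R·x a. With K = k - 1 and S the total of the
competitors, Cauchy–Schwarz reduces to equal competitors; the remaining difference, multiplied by K,
has the factor K·R·x a - S ≥ 0 and a nonnegative cofactor. -/
theorem collision_mul_sq_le {k : ℕ} (hk : 2 ≤ k) {R : ℝ} (hR0 : 0 ≤ R) (hR1 : R ≤ 1) {a : Fin k}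
    {x : Fin k → ℝ} (hx : ∀ j, 0 ≤ x j) (h : ∀ b, b ≠ a → x b ≤ R * x a) :
    collision k R * (∑ j, x j) ^ 2 ≤ ∑ j, x j ^ 2 := by
  have hk2 : (2 : ℝ) ≤ k := by exact_mod_cast hk
  set K : ℝ := k - 1 with hK
  have hK0 : 0 < K := by linarith
  have hcard : ((univ.erase a).card : ℝ) = K := by
    rw [card_erase_of_mem (mem_univ a), card_univ, Fintype.card_fin, Nat.cast_sub (by omega)]
    simp [hK]
  set S := ∑ j ∈ univ.erase a, x j with hS
  set Q := ∑ j ∈ univ.erase a, x j ^ 2 with hQ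
  have hS0 : 0 ≤ S := sum_nonneg fun j _ => hx j
  have hSR : S ≤ K * (R * x a) := by
    calc S ≤ ∑ j ∈ univ.erase a, R * x a := sum_le_sum fun b hb => h b (ne_of_mem_erase hb)
      _ = _ := by rw [sum_const, nsmul_eq_mul, hcard]
  have hCS : S ^ 2 ≤ K * Q := by
    have := sq_sum_le_card_mul_sum_sq (s := univ.erase a) (f := x)
    rwa [hcard] at this
  rw [collision, div_mul_eq_mul_div, div_le_iff₀ (by positivity), ← add_sum_erase _ _ (mem_univ a),
    ← add_sum_erase univ (fun j => x j ^ 2) (mem_univ a)]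
  change (1 + K * R ^ 2) * (x a + S) ^ 2 ≤ (x a ^ 2 + Q) * (1 + K * R) ^ 2
  have h1 : (1 + K * R ^ 2) * (x a + S) ^ 2 * K ≤ (K * x a ^ 2 + S ^ 2) * (1 + K * R) ^ 2 := by
    have hxa := hx a
    have e : (K * x a ^ 2 + S ^ 2) * (1 + K * R) ^ 2 - (1 + K * R ^ 2) * (x a + S) ^ 2 * K
        = (K * (R * x a) - S) * ((2 * K * x a - K * R * x a - S)
          + K * (R * (K * x a - S) + S * (1 - R))) := by ring
    have h2 : S ≤ K * x a := hSR.trans (by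
      gcongr; exact mul_le_of_le_one_left hxa hR1)
    have h3 : K * R * x a ≤ K * x a := by
      rw [mul_assoc]; gcongr; exact mul_le_of_le_one_left hxa hR1
    have : 0 ≤ (K * (R * x a) - S) * ((2 * K * x a - K * R * x a - S)
          + K * (R * (K * x a - S) + S * (1 - R))) := by
      apply mul_nonneg (by linarith)
      have h4 : 0 ≤ R * (K * x a - S) := mul_nonneg hR0 (by linarith)
      have h5 : 0 ≤ S * (1 - R) := mul_nonneg hS0 (by linarith)
      have h6 : 0 ≤ K * (R * (K * x a - S) + S * (1 - R)) := by positivity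
      linarith
    linarith
  have h2 : (K * x a ^ 2 + S ^ 2) * (1 + K * R) ^ 2 ≤ (K * x a ^ 2 + K * Q) * (1 + K * R) ^ 2 := by
    gcongr
  refine le_of_mul_le_mul_right (a := K) ?_ hK0
  linarith

/-- Together with `le_promoted_mean` this traps the mean number of promoted nodes between two
multiples of the squared class size; their quotient (n - 1)/(n - 2) is the price for sampling only
neighbors. -/
theorem promoted_mean_le (hn : 2 ≤ n) (B : ℕ) :
    (B : ℝ) * (((n : ℝ) - 2) * B + 1) / ((n : ℝ) - 1) ^ 2 ≤ B ^ 2 / (n - 1) := by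
  have hn2 : (2 : ℝ) ≤ n := by exact_mod_cast hn
  rcases Nat.eq_zero_or_pos B with h0 | h0
  · simp [h0]
  · have h1 : (1 : ℝ) ≤ B := by exact_mod_cast h0
    rw [div_le_div_iff₀ (by nlinarith) (by linarith)]
    have : (B : ℝ) * (((n : ℝ) - 2) * B + 1) ≤ B ^ 2 * (n - 1) := by nlinarith
    calc _ ≤ B ^ 2 * ((n : ℝ) - 1) * (n - 1) := by gcongr; linarith
      _ = _ := by ring

theorem le_promoted_mean (x : ℝ) (hx : 0 ≤ x) :
    ((n : ℝ) - 2) / (n - 1) ^ 2 * x ^ 2 ≤ x * (((n : ℝ) - 2) * x + 1) / ((n : ℝ) - 1) ^ 2 := by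
  rw [div_mul_eq_mul_div]
  refine div_le_div_of_nonneg_right ?_ (by positivity)
  linarith [show x * (((n : ℝ) - 2) * x + 1) = ((n : ℝ) - 2) * x ^ 2 + x by ring]

theorem expectedCount_promoted_ge (hn : 2 ≤ n) (hk : 2 ≤ k) {i : ℕ} {a : Fin k} {R Γ : ℝ}
    {s : Fin n → NodeState k} (h : Dominates i a R Γ s) (hR1 : R ≤ 1) (hR0 : 0 ≤ R) (hΓ : 0 ≤ Γ) :
    ((n : ℝ) - 2) / (n - 1) ^ 2 * (collision k R * (Γ * n) ^ 2)
      ≤ expectedCount (fun v x => ∃ j, BothIn (nodesOf s i j) v x) := by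
  have hn2 : (2 : ℝ) ≤ n := by exact_mod_cast hn
  have hk2 : (2 : ℝ) ≤ k := by exact_mod_cast hk
  rw [expectedCount_exists_bothIn hn _ fun j j' v hv hv' =>
    (mem_nodesOf.1 hv).2.symm.trans (mem_nodesOf.1 hv').2]
  have hc : 0 ≤ ((n : ℝ) - 2) / (n - 1) ^ 2 := div_nonneg (by linarith) (by positivity)
  have hcol : 0 ≤ collision k R := by
    unfold collision
    have : (0 : ℝ) ≤ k - 1 := by linarith
    positivity
  calc _ ≤ ((n : ℝ) - 2) / (n - 1) ^ 2 * (collision k R * (∑ j, ((nodesOf s i j).card : ℝ)) ^ 2) := by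
        gcongr
        have := h.2.2
        rwa [card_nodesOfGen, Nat.cast_sum] at this
    _ ≤ ((n : ℝ) - 2) / (n - 1) ^ 2 * ∑ j, ((nodesOf s i j).card : ℝ) ^ 2 := by
        gcongr
        exact collision_mul_sq_le hk hR0 hR1 (fun j => by positivity) h.2.1
    _ = ∑ j, ((n : ℝ) - 2) / (n - 1) ^ 2 * ((nodesOf s i j).card : ℝ) ^ 2 := by rw [mul_sum]
    _ ≤ _ := sum_le_sum fun j _ => le_promoted_mean _ (by positivity)

/-- Class sizes are squared, hence so is the ratio, up to the factor (n - 1)/(n - 2). The parameter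
`R₀` may exceed this value: for a large bias it is chosen larger, so that the tracked size R₀·E of a
competitor stays above `U`. -/
theorem two_choices_round (hn : 3 ≤ n) (hk : 2 ≤ k) {i : ℕ} {a : Fin k} {R R₀ Γ Γ' l U M : ℝ}
    {s : Fin n → NodeState k} {tc : Prop} [Decidable tc] (htc : tc)
    (h : Dominates i a R Γ s) (hl : 0 ≤ l) (hU : 0 < U) (h9 : 9 * l ≤ U) (hR1 : R ≤ 1)
    (hR0 : 0 < R) (hΓ : 0 ≤ Γ) (hRR : R ^ 2 * ((n - 1) / (n - 2)) ≤ R₀) (hR₀ : R₀ ≤ 1)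
    (hUR : U ≤ R₀ * (((n : ℝ) - 2) / (n - 1) ^ 2 * (Γ * n / (1 + k * R)) ^ 2))
    (hM : M = ((n : ℝ) - 2) / (n - 1) ^ 2 * (collision k R * (Γ * n) ^ 2)) (hM0 : 0 < M)
    (hΓ' : Γ' * n ≤ M - Real.sqrt (l * M)) :
    freq (fun smp =>
        ¬ Dominates (i + 1) a (R₀ * Real.exp (3 * Real.sqrt (l / U))) Γ' (step tc smp s))
      ≤ (k + 2) * Real.exp (-l / 4) := by
  have hn2 : (3 : ℝ) ≤ n := by exact_mod_cast hn
  have hn' : 2 ≤ n := by omega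
  set A := nodesOf s i a with hA
  have hkR : 0 < 1 + k * R := by positivity
  have hcn : 0 < ((n : ℝ) - 2) / (n - 1) ^ 2 := div_pos (by linarith) (by nlinarith)
  have hR₀0 : 0 < R₀ := lt_of_lt_of_le
    (mul_pos (by positivity) (div_pos (by linarith) (by linarith))) hRR
  set E := A.card * (((n : ℝ) - 2) * A.card + 1) / ((n : ℝ) - 1) ^ 2 with hE
  have hEA : ((n : ℝ) - 2) / (n - 1) ^ 2 * (A.card : ℝ) ^ 2 ≤ E :=
    le_promoted_mean _ (by positivity)
  have hUE : U ≤ R₀ * E := by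
    refine hUR.trans ?_
    gcongr
    refine le_trans ?_ hEA
    gcongr
    rw [div_le_iff₀ hkR]
    exact h.le_card hR0.le
  have hE0 : 0 < E := by
    by_contra h0
    have : R₀ * E ≤ 0 := mul_nonpos_of_nonneg_of_nonpos hR₀0.le (not_lt.1 h0)
    linarith
  have hne (v : Fin n) : Nonempty (Neighbor v × Neighbor v) := by
    have := nonempty_neighbor hn' v
    infer_instance
  have p1 := freq_lower_tail (BothIn A) (l := l) hl hE0 (by rw [expectedCount_bothIn hn'])
  have p2 := freq_lower_tail (fun v x => ∃ j, BothIn (nodesOf s i j) v x) (l := l) hl hM0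
    (by rw [hM]; exact expectedCount_promoted_ge hn' hk h hR1 hR0.le hΓ)
  have p3 : ∀ b, freq (fun ω : Samples n => b ≠ a ∧ R₀ * E + Real.sqrt (l * (R₀ * E)) ≤
      occurrences (BothIn (nodesOf s i b)) ω) ≤ Real.exp (-l / 4) := by
    intro b
    by_cases hb : b = a
    · rw [freq_congr (q := fun _ => False) (by simp [hb]), freq_false]; positivity
    · refine (freq_mono fun ω hω => hω.2).trans
        (freq_upper_tail (BothIn (nodesOf s i b)) hl (by positivity) (by linarith) ?_)
      rw [expectedCount_bothIn hn']
      refine (promoted_mean_le hn' _).trans ?_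
      calc ((nodesOf s i b).card : ℝ) ^ 2 / (n - 1) ≤ (R * A.card) ^ 2 / (n - 1) := by
            gcongr
            · linarith
            · exact h.2.1 b hb
        _ = R ^ 2 * ((n - 1) / (n - 2)) * (((n : ℝ) - 2) / (n - 1) ^ 2 * (A.card : ℝ) ^ 2) := by
            have h1 : (n : ℝ) - 1 ≠ 0 := by linarith
            have h2 : (n : ℝ) - 2 ≠ 0 := by linarith
            field_simp
        _ ≤ R₀ * E := by gcongr
  refine (freq_deviation_le p1 p2 p3 ?_).trans (by ring_nf; rfl)
  intro ω h1 h2 h3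
  rw [not_not]
  refine ⟨step_gen_le_succ h.1, fun b hb => ?_, ?_⟩
  · rw [card_eq_occurrences _ ω _ (mem_nodesOf_step_succ htc h.1 b),
      card_eq_occurrences _ ω _ (mem_nodesOf_step_succ htc h.1 a)]
    have h4 := h3 b
    push Not at h4
    exact ratio_after_deviation hl hU h9 hR₀ hR₀0.le hUE (not_lt.1 h1) (h4 hb).le
  · rw [card_eq_occurrences (fun v x => ∃ j, BothIn (nodesOf s i j) v x) ω _
      (mem_nodesOfGen_step_succ htc h.1)]
    linarith [not_lt.1 h2]

/-- A two-choices round in which the other opinions die out in the top generation. -/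
theorem extinction_round (hn : 3 ≤ n) (hk : 2 ≤ k) {i : ℕ} {a : Fin k} {R Γ h' l M D : ℝ}
    {s : Fin n → NodeState k} {tc : Prop} [Decidable tc] (htc : tc)
    (h : Dominates i a R Γ s) (hl : 0 ≤ l) (hR1 : R ≤ 1) (hR0 : 0 ≤ R) (hΓ : 0 ≤ Γ)
    (hM : M = ((n : ℝ) - 2) / (n - 1) ^ 2 * (collision k R * (Γ * n) ^ 2)) (hM0 : 0 < M)
    (hh : (1 - h') * n ≤ M - Real.sqrt (l * M)) (hD : (R * n) ^ 2 / (n - 1) ≤ D) (hD0 : 0 < D)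
    (hD1 : D ≤ 1) :
    freq (fun smp => ¬ Unanimous (i + 1) a h' (step tc smp s))
      ≤ 2 * Real.exp (-l / 4) + k * (3 * D) := by
  have hn2 : (3 : ℝ) ≤ n := by exact_mod_cast hn
  have hn' : 2 ≤ n := by omega
  have hne (v : Fin n) : Nonempty (Neighbor v × Neighbor v) := by
    have := nonempty_neighbor hn' v
    infer_instance
  have p2 := freq_lower_tail (fun v x => ∃ j, BothIn (nodesOf s i j) v x) (l := l) hl hM0
    (by rw [hM]; exact expectedCount_promoted_ge hn' hk h hR1 hR0 hΓ)
  have p3 : ∀ b, freq (fun ω : Samples n => b ≠ a ∧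
      occurrences (BothIn (nodesOf s i b)) ω ≠ 0) ≤ 3 * D := by
    intro b
    by_cases hb : b = a
    · rw [freq_congr (q := fun _ => False) (by simp [hb]), freq_false]; positivity
    · refine (freq_mono fun ω hω => hω.2).trans
        (freq_occurs_le (BothIn (nodesOf s i b)) hD0 ?_ hD1)
      rw [expectedCount_bothIn hn']
      refine (promoted_mean_le hn' _).trans (le_trans ?_ hD)
      have h1 : ((nodesOf s i a).card : ℝ) ≤ n := by
        exact_mod_cast (card_le_card (nodesOf_subset s i a)).trans (card_nodesOfGen_le s i)
      gcongr
      · linarith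
      · exact (h.2.1 b hb).trans (by gcongr)
  -- Apart from the competitors only the promoted total has to be controlled, so the same event
  -- fills two slots of the union bound.
  refine freq_deviation_le p2 p2 p3 ?_
  intro ω _ h2 h3
  rw [not_not]
  refine ⟨step_gen_le_succ h.1, fun v hv => ?_, ?_⟩
  · by_contra hc
    have h4 := h3 (step tc ω s v).col
    push Not at h4
    have h5 := h4 hc
    rw [← card_eq_occurrences _ ω _ (mem_nodesOf_step_succ htc h.1 _), card_eq_zero] at h5
    have : v ∈ nodesOf (step tc ω s) (i + 1) (step tc ω s v).col := mem_nodesOf.2 ⟨hv, rfl⟩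
    rw [h5] at this
    simp at this
  · rw [card_eq_occurrences (fun v x => ∃ j, BothIn (nodesOf s i j) v x) ω _
      (mem_nodesOfGen_step_succ htc h.1)]
    linarith [not_lt.1 h2]

theorem Unanimous.step_col {i : ℕ} {a : Fin k} {h : ℝ} {s : Fin n → NodeState k} {tc : Prop}
    [Decidable tc] (htc : ¬ tc) (hs : Unanimous i a h s) (smp : Samples n) (v : Fin n)
    (hv : (step tc smp s v).gen = i) : (step tc smp s v).col = a := by
  have h1 := (mem_nodesOf_step htc hs.1 (step tc smp s v).col v (smp := smp)).1
    (mem_nodesOf.2 ⟨hv, rfl⟩)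
  have h2 : ∀ u, u ∈ nodesOf s i (step tc smp s v).col → (step tc smp s v).col = a := by
    intro u hu
    rw [mem_nodesOf] at hu
    rw [← hu.2]
    exact hs.2.1 u hu.1
  rcases h1 with h1 | ⟨_, h1 | ⟨_, h1⟩⟩ <;> exact h2 _ h1

theorem spreading_round (hn : 2 ≤ n) {i : ℕ} {a : Fin k} {h h' l M : ℝ}
    {s : Fin n → NodeState k} {tc : Prop} [Decidable tc] (htc : ¬ tc)
    (hs : Unanimous i a h s) (hl : 0 ≤ l) (hM0 : 0 < M) (hlM : l ≤ 4 * M) (hM : h ^ 3 * n ≤ M)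
    (hh : M + Real.sqrt (l * M) ≤ h' * n) :
    freq (fun smp => ¬ Unanimous i a h' (step tc smp s)) ≤ Real.exp (-l / 4) := by
  have hne (v : Fin n) : Nonempty (Neighbor v × Neighbor v) := by
    have := nonempty_neighbor hn v
    infer_instance
  refine (freq_mono fun ω hω => ?_).trans (freq_upper_tail (StaysOutside (nodesOfGen s i)) hl hM0 hlM
    (by rw [expectedCount_staysOutside hn]; exact (outside_mean_le hn hs.2.2).trans hM))
  by_contra hc
  refine hω ⟨step_gen_le htc hs.1, hs.step_col htc ω, ?_⟩
  have h1 : ((nodesOfGen (step tc ω s) i)ᶜ.card : ℝ)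
      = occurrences (StaysOutside (nodesOfGen s i)) ω := by
    rw [card_eq_occurrences (StaysOutside (nodesOfGen s i)) ω]
    intro v
    rw [mem_compl, mem_nodesOfGen_step htc hs.1, not_not]
  rw [card_compl, Fintype.card_fin, Nat.cast_sub (card_nodesOfGen_le _ _)] at h1
  linarith [not_le.1 hc]

theorem final_round (hn : 2 ≤ n) {i : ℕ} {a : Fin k} {h M : ℝ}
    {s : Fin n → NodeState k} {tc : Prop} [Decidable tc] (htc : ¬ tc)
    (hs : Unanimous i a h s) (hM0 : 0 < M) (hM1 : M ≤ 1) (hM : h ^ 3 * n ≤ M) :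
    freq (fun smp => ¬ ∀ v, (step tc smp s v).col = a) ≤ 3 * M := by
  have hne (v : Fin n) : Nonempty (Neighbor v × Neighbor v) := by
    have := nonempty_neighbor hn v
    infer_instance
  refine (freq_mono fun ω hω => ?_).trans (freq_occurs_le (StaysOutside (nodesOfGen s i)) hM0
    (by rw [expectedCount_staysOutside hn]; exact (outside_mean_le hn hs.2.2).trans hM) hM1)
  intro hc
  refine hω fun v => hs.step_col htc ω v ?_
  rw [← card_eq_occurrences (StaysOutside (nodesOfGen s i)) ω (nodesOfGen (step tc ω s) i)ᶜ
    (fun v => by rw [mem_compl, mem_nodesOfGen_step htc hs.1, not_not]), card_eq_zero,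
    compl_eq_empty_iff] at hc
  exact mem_nodesOfGen.1 (hc ▸ mem_univ v)

end RoundBounds

end Plurality

namespace Plurality

/-! ### Loss of bias during a life cycle -/

section Phases

open Finset

variable {n k : ℕ}

/-- The regime of parameters in which all typical deviations are small. Here `l` measures the
deviations, `U` is a lower bound for the class sizes that are tracked, `κ` is a cap on the logarithm
of the bias that is tracked, and `p ^ 2 = 1 / (2 - γ)`. -/
structure Regime (γ p l U κ : ℝ) (n k : ℕ) : Prop where
  γ_pos : 0 < γ
  γ_lt : γ < 1
  p_pos : 0 < p
  p_sq : p ^ 2 * (2 - γ) = 1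
  two_le_k : 2 ≤ k
  four_le_n : 4 ≤ n
  l_nonneg : 0 ≤ l
  U_pos : 0 < U
  l_le : 72 * l ≤ U
  k_sq_le : 8 * U * k ^ 2 ≤ p * γ ^ 2 * n
  exp_le : 8 * U * Real.exp κ ≤ p * γ ^ 2 * n
  k_le_exp : (k : ℝ) ≤ Real.exp κ
  slack : 2 - γ ≤ (3 - 3 * γ + γ ^ 2) * (1 - Real.sqrt (l / U))
  rounding : p ≤ (1 - 1 / ((n : ℝ) - 1) ^ 2) * (1 - Real.sqrt (l / U))

theorem Regime.p_lt_one {γ p l U κ : ℝ} (reg : Regime γ p l U κ n k) : p < 1 := by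
  have h1 := reg.p_sq
  have h2 := reg.γ_lt
  have h3 := reg.p_pos
  by_contra h
  have h4 : 1 ≤ p ^ 2 := one_le_pow₀ (not_lt.1 h)
  nlinarith

theorem exp_two_le : Real.exp 2 ≤ 8 := by
  have h := Real.exp_one_lt_d9
  have : Real.exp 2 = Real.exp 1 * Real.exp 1 := by rw [← Real.exp_add]; norm_num
  rw [this]
  nlinarith [Real.exp_pos 1]

theorem sqrt_exp_two_mul {x : ℝ} : Real.sqrt (Real.exp 2 * x) = Real.exp 1 * Real.sqrt x := by
  rw [Real.sqrt_mul (Real.exp_pos _).le, show (2 : ℝ) = 1 + 1 by norm_num, Real.exp_add,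
    Real.sqrt_mul_self (Real.exp_pos _).le]

/-- The loss in the logarithm of the bias in round `u` of a propagation phase. -/
noncomputable def roundLoss (γ p l U : ℝ) (n k : ℕ) (Γ₀ σ : ℝ) (u : ℕ) : ℝ :=
  3 * Real.exp 1 * Real.sqrt (2 * l * k / n) * (1 / Real.sqrt γ + p ^ u / Real.sqrt Γ₀)
    + 3 * Real.sqrt (l / U) * σ

theorem roundLoss_nonneg {γ p l U Γ₀ σ : ℝ} (hp : 0 ≤ p) (hσ : 0 ≤ σ) (u : ℕ) :
    0 ≤ roundLoss γ p l U n k Γ₀ σ u := by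
  unfold roundLoss; positivity

/-- A round costs 3√(l/V) for a lower bound V on R times the dominant class. If ρ ≤ 2, then V can be
of order Γn/k, and since Γ grows by 2 - γ = p⁻² until it reaches γ, the loss in round u is governed
by p^u/√Γ₀ + 1/√γ. If ρ > 2, then V = U is good enough, because its loss may be multiplied by σ ≥ ρ
> 1. `roundLoss` covers both cases at once. -/
theorem propagation_phase {γ p l U κ : ℝ} (reg : Regime γ p l U κ n k) {α : ℝ}
    {op : Fin n → Fin k} {a : Fin k} {Γ₀ σ σ' : ℝ} {i t S : ℕ}
    (hΓk : p * γ ^ 2 / k ≤ Γ₀) (hΓγ : Γ₀ ≤ γ) (hUσ : U * (Real.exp σ + k) ≤ Γ₀ * n)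
    (hσσ : σ' ≤ σ) (hσ0 : 0 ≤ σ)
    (hS : ∑ u ∈ range S, roundLoss γ p l U n k Γ₀ σ u ≤ σ')
    (hnt : ∀ s < S, ¬ IsTwoChoicesRound γ α n k (t + s + 1)) :
    Leads γ α op (Dominates i a (Real.exp (-σ')) Γ₀) t
      (Dominates i a (Real.exp (-(σ' - ∑ u ∈ range S, roundLoss γ p l U n k Γ₀ σ u)))
        (min γ ((2 - γ) ^ S * Γ₀))) (t + S) (S * ((k + 2) * Real.exp (-l / 4))) := by
  have hp0 := reg.p_pos
  have hp1 := reg.p_lt_one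
  have hγ0 := reg.γ_pos
  have hγ1 := reg.γ_lt
  have hU0 := reg.U_pos
  have hl0 := reg.l_nonneg
  have hn4 : (4 : ℝ) ≤ n := by exact_mod_cast reg.four_le_n
  have hn0 : (0 : ℝ) < n := by linarith
  have hk2 : (2 : ℝ) ≤ k := by exact_mod_cast reg.two_le_k
  have hn2 : 2 ≤ n := by have := reg.four_le_n; omega
  have hΓ0 : 0 < Γ₀ := lt_of_lt_of_le (by positivity) hΓk
  induction S with
  | zero =>
    have h0 : min γ ((2 - γ) ^ 0 * Γ₀) = Γ₀ := by simp [hΓγ]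
    rw [h0]
    simpa using Leads.refl
  | succ S ih =>
    rw [sum_range_succ] at hS
    have hL0 := roundLoss_nonneg (n := n) (k := k) (γ := γ) (p := p) (l := l) (U := U) (Γ₀ := Γ₀)
      hp0.le hσ0
    set L := ∑ u ∈ range S, roundLoss γ p l U n k Γ₀ σ u with hL
    have hLnn : 0 ≤ L := sum_nonneg fun u _ => hL0 u
    have hLS := hL0 S
    have ih' := ih (by linarith) fun s hs => hnt s (by omega)
    set ρ := σ' - L with hρ
    have hρ0 : 0 ≤ ρ := by linarith
    have hρσ : ρ ≤ σ := by linarith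
    set Γ := min γ ((2 - γ) ^ S * Γ₀) with hΓ
    have hq1 : 1 ≤ (2 - γ) ^ S := one_le_pow₀ (by linarith)
    have hq0 : 0 < (2 - γ) ^ S := by linarith
    have hΓ₀Γ : Γ₀ ≤ Γ := le_min hΓγ (le_mul_of_one_le_left hΓ0.le hq1)
    have hΓpos : 0 < Γ := hΓ0.trans_le hΓ₀Γ
    have hΓn : 8 * U * k ≤ Γ₀ * n := by
      have h1 : p * γ ^ 2 ≤ Γ₀ * k := by rwa [div_le_iff₀ (by linarith)] at hΓk
      have h2 : 8 * U * k * k ≤ Γ₀ * n * k := by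
        calc 8 * U * k * k = 8 * U * k ^ 2 := by ring
          _ ≤ p * γ ^ 2 * n := reg.k_sq_le
          _ ≤ Γ₀ * k * n := by gcongr
          _ = _ := by ring
      exact le_of_mul_le_mul_right h2 (by linarith)
    have hΓn' : 8 * U * k ≤ Γ * n := hΓn.trans (by gcongr)
    have hslack : 2 - γ ≤ (3 - 3 * γ + γ ^ 2) * (1 - Real.sqrt (l / (Γ * n))) := by
      refine reg.slack.trans ?_
      have : 0 ≤ 3 - 3 * γ + γ ^ 2 := by nlinarith
      gcongr
      nlinarith
    have hΓ' : min γ ((2 - γ) ^ (S + 1) * Γ₀) ≤ (2 - γ) * Γ := by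
      rcases le_total γ ((2 - γ) ^ S * Γ₀) with h | h
      · rw [hΓ, min_eq_left h]
        exact (min_le_left _ _).trans (by nlinarith)
      · rw [hΓ, min_eq_right h]
        refine (min_le_right _ _).trans (le_of_eq (by ring))
    obtain ⟨V, hV0, hV9, hVR, hVL⟩ : ∃ V : ℝ, 0 < V ∧ 9 * l ≤ V ∧
        V * (1 + k * Real.exp (-ρ)) ≤ Real.exp (-ρ) * (Γ * n) ∧
        3 * Real.sqrt (l / V) ≤ roundLoss γ p l U n k Γ₀ σ S := by
      have hR1 : Real.exp (-ρ) ≤ 1 := Real.exp_le_one_iff.2 (by linarith)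
      by_cases h2 : ρ ≤ 2
      · have he : Real.exp 2 * Real.exp (-2) = 1 := by rw [← Real.exp_add]; simp
        refine ⟨Real.exp (-2) * (Γ * n / (2 * k)), by positivity, ?_, ?_, ?_⟩
        · have h3 : 4 * U ≤ Γ * n / (2 * k) := by
            rw [le_div_iff₀ (by positivity)]; linarith
          have h4 : 1 / 8 ≤ Real.exp (-2) := by
            have := exp_two_le
            nlinarith [Real.exp_pos (-2)]
          have h5 := reg.l_le
          calc 9 * l ≤ 1 / 8 * (4 * U) := by linarith
            _ ≤ _ := by gcongr
        · have h3 : Real.exp (-2) ≤ Real.exp (-ρ) := Real.exp_le_exp.2 (by linarith)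
          have h4 : 1 + k * Real.exp (-ρ) ≤ 2 * k := by nlinarith
          calc Real.exp (-2) * (Γ * n / (2 * k)) * (1 + k * Real.exp (-ρ))
              ≤ Real.exp (-ρ) * (Γ * n / (2 * k)) * (2 * k) := by gcongr
            _ = _ := by field_simp
        · have h3 : l / (Real.exp (-2) * (Γ * n / (2 * k)))
              = Real.exp 2 * (2 * l * k / n * (1 / Γ)) := by
            have : Real.exp (-2) = (Real.exp 2)⁻¹ := by rw [Real.exp_neg]
            rw [this]
            field_simp
          rw [h3, sqrt_exp_two_mul, Real.sqrt_mul (by positivity)]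
          have h4 : Real.sqrt (1 / Γ) ≤ 1 / Real.sqrt γ + p ^ S / Real.sqrt Γ₀ := by
            rcases le_total γ ((2 - γ) ^ S * Γ₀) with h | h
            · rw [hΓ, min_eq_left h, Real.sqrt_div zero_le_one, Real.sqrt_one]
              have : 0 ≤ p ^ S / Real.sqrt Γ₀ := by positivity
              linarith
            · rw [hΓ, min_eq_right h]
              have h5 : 1 / ((2 - γ) ^ S * Γ₀) = (p ^ S) ^ 2 * (1 / Γ₀) := by
                have h6 : (p ^ S) ^ 2 * (2 - γ) ^ S = 1 := by
                  rw [← pow_mul, mul_comm S 2, pow_mul, ← mul_pow, reg.p_sq, one_pow]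
                rw [div_eq_iff (by positivity)]
                calc (1 : ℝ) = (p ^ S) ^ 2 * (2 - γ) ^ S := h6.symm
                  _ = _ := by field_simp
              rw [h5, Real.sqrt_mul (by positivity), Real.sqrt_sq (by positivity),
                Real.sqrt_div zero_le_one, Real.sqrt_one, mul_one_div]
              have : 0 ≤ 1 / Real.sqrt γ := by positivity
              linarith
          unfold roundLoss
          have h5 : 0 ≤ 3 * Real.sqrt (l / U) * σ := by positivity
          calc 3 * (Real.exp 1 * (Real.sqrt (2 * l * k / n) * Real.sqrt (1 / Γ)))
              = 3 * Real.exp 1 * Real.sqrt (2 * l * k / n) * Real.sqrt (1 / Γ) := by ring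
            _ ≤ 3 * Real.exp 1 * Real.sqrt (2 * l * k / n)
                * (1 / Real.sqrt γ + p ^ S / Real.sqrt Γ₀) := by gcongr
            _ ≤ _ := by linarith
      · refine ⟨U, hU0, by linarith [reg.l_le], ?_, ?_⟩
        · have h3 : Real.exp ρ * Real.exp (-ρ) = 1 := by rw [← Real.exp_add]; simp
          have h4 : Real.exp ρ ≤ Real.exp σ := Real.exp_le_exp.2 hρσ
          calc U * (1 + k * Real.exp (-ρ)) = Real.exp (-ρ) * (U * (Real.exp ρ + k)) := by
                rw [← h3]; ring
            _ ≤ Real.exp (-ρ) * (U * (Real.exp σ + k)) := by gcongr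
            _ ≤ Real.exp (-ρ) * (Γ₀ * n) := by gcongr
            _ ≤ _ := by gcongr
        · unfold roundLoss
          have h5 : 0 ≤ 3 * Real.exp 1 * Real.sqrt (2 * l * k / n)
              * (1 / Real.sqrt γ + p ^ S / Real.sqrt Γ₀) := by positivity
          have h6 : 3 * Real.sqrt (l / U) * 1 ≤ 3 * Real.sqrt (l / U) * σ := by
            gcongr; linarith
          linarith
    classical
    have hstep : Leads γ α op (Dominates i a (Real.exp (-ρ)) Γ) (t + S)
        (Dominates i a (Real.exp (-(σ' - (L + roundLoss γ p l U n k Γ₀ σ S))))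
          (min γ ((2 - γ) ^ (S + 1) * Γ₀))) (t + S + 1) ((k + 2) * Real.exp (-l / 4)) := by
      refine leads_step hn2 (fun s hs => ?_) (by positivity)
      have hR1 : Real.exp (-ρ) ≤ 1 := Real.exp_le_one_iff.2 (by linarith)
      refine (freq_mono fun smp hsmp => ?_).trans
        (propagation_round hn2 (hnt S (by omega)) hs hl0 hV0 hV9 hR1 (Real.exp_pos _) hVR hΓpos
          (min_le_left _ _) hγ1.le hslack hΓ')
      intro hd
      refine hsmp (hd.mono ?_ le_rfl)
      rw [← Real.exp_add, Real.exp_le_exp]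
      linarith
    have := ih'.trans hn2 hstep
    rw [sum_range_succ, ← hL]
    refine this.mono hn2 (fun _ h => h) (fun _ h => h) (le_of_eq ?_)
    push_cast
    ring

theorem collision_le_one {k : ℕ} (hk : 1 ≤ k) {R : ℝ} (hR : 0 ≤ R) : collision k R ≤ 1 := by
  have hk1 : (1 : ℝ) ≤ k := by exact_mod_cast hk
  have h0 : 0 ≤ (k : ℝ) - 1 := by linarith
  unfold collision
  rw [div_le_one (by positivity)]
  rcases Nat.lt_or_ge k 2 with h | h
  · have : k = 1 := by omega
    subst this
    norm_num
  · have h1 : 1 ≤ (k : ℝ) - 1 := by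
      have : (2 : ℝ) ≤ k := by exact_mod_cast h
      linarith
    have h2 : ((k : ℝ) - 1) * R ^ 2 ≤ ((k : ℝ) - 1) * (((k : ℝ) - 1) * R ^ 2) := by
      gcongr
      exact le_mul_of_one_le_left (by positivity) h1
    have h3 : 0 ≤ ((k : ℝ) - 1) * R := by positivity
    nlinarith

theorem one_div_le_collision {k : ℕ} (hk : 1 ≤ k) {R : ℝ} (hR : 0 ≤ R) :
    1 / (k : ℝ) ≤ collision k R := by
  have hk1 : (1 : ℝ) ≤ k := by exact_mod_cast hk
  have h0 : 0 ≤ (k : ℝ) - 1 := by linarith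
  unfold collision
  rw [div_le_div_iff₀ (by linarith) (by positivity)]
  nlinarith [mul_nonneg h0 (sq_nonneg (1 - R))]

theorem collision_ge_of_le {k : ℕ} (hk : 1 ≤ k) {R ξ : ℝ} (hR : 0 ≤ R) (h : k * R ≤ ξ) :
    1 / (1 + ξ) ^ 2 ≤ collision k R := by
  have hk1 : (1 : ℝ) ≤ k := by exact_mod_cast hk
  have h0 : 0 ≤ (k : ℝ) - 1 := by linarith
  unfold collision
  have h1 : ((k : ℝ) - 1) * R ≤ ξ := by nlinarith
  have h2 : 0 ≤ ((k : ℝ) - 1) * R := by positivity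
  gcongr
  nlinarith [mul_nonneg h0 (sq_nonneg R)]

/-- Ensures that the tracked classes have size at least U, in the propagation rounds and in the
two-choices round respectively. If k·R ≤ 1, `collision` is at least 1/4 and the cap on σ suffices.
If k·R ≥ 1, the relation e^σ·R² ≤ 1 combines with the bound on k². -/
theorem Regime.size_bounds {γ p l U κ : ℝ} (reg : Regime γ p l U κ n k) {R σ : ℝ}
    (hR0 : 0 < R) (hσ : Real.exp σ * R ^ 2 ≤ 1) (hσκ : σ ≤ κ) :
    U * (Real.exp σ + k) ≤ p * γ ^ 2 * collision k R * n ∧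
    2 * U * Real.exp σ * (1 + k * R) ^ 2 ≤ γ ^ 2 * n := by
  have hp0 := reg.p_pos
  have hp1 := reg.p_lt_one
  have hγ0 := reg.γ_pos
  have hU0 := reg.U_pos
  have hk2 : (2 : ℝ) ≤ k := by exact_mod_cast reg.two_le_k
  have hk1 : 1 ≤ k := by have := reg.two_le_k; omega
  have hes : Real.exp σ ≤ Real.exp κ := Real.exp_le_exp.2 hσκ
  have h3 := reg.exp_le
  have h4 := reg.k_le_exp
  have h5 := reg.k_sq_le
  have hpn : p * γ ^ 2 * n ≤ γ ^ 2 * n := by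
    rw [mul_assoc]; exact mul_le_of_le_one_left (by positivity) hp1.le
  rcases le_total ((k : ℝ) * R) 1 with h | h
  · have h1 := collision_ge_of_le hk1 hR0.le h
    constructor
    · calc U * (Real.exp σ + k) ≤ U * (Real.exp κ + Real.exp κ) := by gcongr
        _ = 8 * U * Real.exp κ * (1 / (1 + 1) ^ 2) := by ring
        _ ≤ p * γ ^ 2 * n * (1 / (1 + 1) ^ 2) := by gcongr
        _ ≤ p * γ ^ 2 * n * collision k R := by gcongr
        _ = _ := by ring
    · calc 2 * U * Real.exp σ * (1 + k * R) ^ 2 ≤ 2 * U * Real.exp κ * (1 + 1) ^ 2 := by gcongr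
        _ = 8 * U * Real.exp κ := by ring
        _ ≤ _ := h3.trans hpn
  · constructor
    · have h6 : (Real.exp σ + k) * R ^ 2 ≤ 2 * (1 + (k - 1) * R ^ 2) := by
        have : (k : ℝ) * R ^ 2 ≤ 2 * ((k - 1) * R ^ 2) := by nlinarith [sq_nonneg R]
        linarith
      have h7 : (1 + ((k : ℝ) - 1) * R) ^ 2 ≤ (2 * k * R) ^ 2 := by
        have : 0 ≤ 1 + ((k : ℝ) - 1) * R := by
          have : 0 ≤ ((k : ℝ) - 1) * R := mul_nonneg (by linarith) hR0.le
          linarith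
        gcongr
        linarith
      have hpos : 0 < (1 + ((k : ℝ) - 1) * R) ^ 2 := by
        have : 0 ≤ ((k : ℝ) - 1) * R := mul_nonneg (by linarith) hR0.le
        positivity
      have hnum : 0 ≤ 1 + ((k : ℝ) - 1) * R ^ 2 := by
        have : 0 ≤ ((k : ℝ) - 1) * R ^ 2 := mul_nonneg (by linarith) (by positivity)
        linarith
      unfold collision
      rw [mul_div_assoc', div_mul_eq_mul_div, le_div_iff₀ hpos]
      calc U * (Real.exp σ + k) * (1 + (k - 1) * R) ^ 2
          ≤ U * (Real.exp σ + k) * (2 * k * R) ^ 2 := by gcongr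
        _ = 4 * U * k ^ 2 * ((Real.exp σ + k) * R ^ 2) := by ring
        _ ≤ 4 * U * k ^ 2 * (2 * (1 + (k - 1) * R ^ 2)) := by gcongr
        _ = 8 * U * k ^ 2 * (1 + (k - 1) * R ^ 2) := by ring
        _ ≤ p * γ ^ 2 * n * (1 + (k - 1) * R ^ 2) := by gcongr
        _ = _ := by ring
    · calc 2 * U * Real.exp σ * (1 + k * R) ^ 2 ≤ 2 * U * Real.exp σ * (k * R + k * R) ^ 2 := by
            gcongr
        _ = 8 * U * k ^ 2 * (Real.exp σ * R ^ 2) := by ring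
        _ ≤ 8 * U * k ^ 2 * 1 := by gcongr
        _ ≤ _ := by linarith

/-- Since n(n - 2)/(n - 1)² = 1 - 1/(n - 1)², the mean is almost collision·γ²·n; one factor p pays
both for this correction and for the deviation. -/
theorem Regime.promoted_bounds {γ p l U κ : ℝ} (reg : Regime γ p l U κ n k) {R : ℝ}
    (hR0 : 0 < R) {M : ℝ}
    (hM : M = ((n : ℝ) - 2) / (n - 1) ^ 2 * (collision k R * (γ * n) ^ 2)) :
    0 < M ∧ p * γ ^ 2 * collision k R * n ≤ M - Real.sqrt (l * M) := by
  have hp0 := reg.p_pos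
  have hp1 := reg.p_lt_one
  have hγ0 := reg.γ_pos
  have hU0 := reg.U_pos
  have hk2 : (2 : ℝ) ≤ k := by exact_mod_cast reg.two_le_k
  have hk1 : 1 ≤ k := by have := reg.two_le_k; omega
  have hn4 : (4 : ℝ) ≤ n := by exact_mod_cast reg.four_le_n
  have hc := one_div_le_collision hk1 hR0.le
  have hc0 : 0 < collision k R := lt_of_lt_of_le (by positivity) hc
  have hn1 : (0 : ℝ) < (n - 1) ^ 2 := by nlinarith
  have hcn : 1 / (2 * n) ≤ ((n : ℝ) - 2) / (n - 1) ^ 2 := by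
    rw [div_le_div_iff₀ (by linarith) hn1]; nlinarith
  have hcn0 : 0 ≤ ((n : ℝ) - 2) / (n - 1) ^ 2 := le_trans (by positivity) hcn
  have hUM : U ≤ M := by
    rw [hM]
    calc U ≤ 1 / (2 * n) * (1 / k * (γ * n) ^ 2) := by
          have h5 := reg.k_sq_le
          have h6 : p * γ ^ 2 * n ≤ γ ^ 2 * n := by
            rw [mul_assoc]; exact mul_le_of_le_one_left (by positivity) hp1.le
          have h7 : 1 / (2 * (n : ℝ)) * (1 / k * (γ * n) ^ 2) = γ ^ 2 * n / (2 * k) := by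
            field_simp
          rw [h7, le_div_iff₀ (by linarith)]
          have h8 : U * (2 * k) ≤ 8 * U * k ^ 2 := by
            have : U * (2 * k) * 1 ≤ U * (2 * k) * (4 * k) := by gcongr; linarith
            linarith
          linarith
      _ ≤ _ := by gcongr
  refine ⟨hU0.trans_le hUM, ?_⟩
  have h1 := sqrt_mul_le_sqrt_div_mul reg.l_nonneg hU0 hUM
  have h2 : p * γ ^ 2 * collision k R * n ≤ M * (1 - Real.sqrt (l / U)) := by
    have h3 : M = (1 - 1 / ((n : ℝ) - 1) ^ 2) * (collision k R * γ ^ 2 * n) := by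
      have h4 : (n : ℝ) - 1 ≠ 0 := by linarith
      rw [hM]; field_simp; ring
    rw [h3]
    calc p * γ ^ 2 * collision k R * n = p * (collision k R * γ ^ 2 * n) := by ring
      _ ≤ (1 - 1 / ((n : ℝ) - 1) ^ 2) * (1 - Real.sqrt (l / U)) * (collision k R * γ ^ 2 * n) := by
          gcongr
          exact reg.rounding
      _ = _ := by ring
  linarith

/-- A lower bound `V` for the expected class sizes in a two-choices round, and the loss in the
logarithm of the bias that it entails. -/
theorem Regime.two_choices_scale {γ p l U κ : ℝ} (reg : Regime γ p l U κ n k) {R σ : ℝ}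
    (hR0 : 0 < R) (hR1 : R ≤ 1) (hσ0 : 0 ≤ σ)
    (hs2 : 2 * U * Real.exp σ * (1 + k * R) ^ 2 ≤ γ ^ 2 * n) :
    ∃ V : ℝ, 0 < V ∧ 9 * l ≤ V ∧
      V ≤ Real.exp (-(σ - 2 / n)) *
        (((n : ℝ) - 2) / (n - 1) ^ 2 * (γ * n / (1 + k * R)) ^ 2) ∧
      3 * Real.sqrt (l / V) ≤ 3 * Real.exp 1 * (Real.sqrt (8 * l / n) * k / γ)
        + 3 * Real.sqrt (l / U) * σ := by
  have hp0 := reg.p_pos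
  have hp1 := reg.p_lt_one
  have hγ0 := reg.γ_pos
  have hU0 := reg.U_pos
  have hl0 := reg.l_nonneg
  have hn4 : (4 : ℝ) ≤ n := by exact_mod_cast reg.four_le_n
  have hn0 : (0 : ℝ) < n := by linarith
  have hk2 : (2 : ℝ) ≤ k := by exact_mod_cast reg.two_le_k
  have hnn : (0 : ℝ) ≤ 2 / n := by positivity
  have hcn : 1 / (2 * n) ≤ ((n : ℝ) - 2) / (n - 1) ^ 2 := by
    rw [div_le_div_iff₀ (by linarith) (by nlinarith)]; nlinarith
  have hcn0 : 0 ≤ ((n : ℝ) - 2) / (n - 1) ^ 2 := le_trans (by positivity) hcn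
  have hc₂0 : 0 ≤ 3 * Real.sqrt (l / U) := by positivity
  have he₁0 : 0 ≤ 3 * Real.exp 1 * (Real.sqrt (8 * l / n) * k / γ) := by positivity
  -- As in a propagation phase: for a small bias the classes are of order n/k² and the loss is
  -- additive; otherwise the scale U is used and the loss is charged to σ > 1.
  by_cases h2 : σ - 2 / n ≤ 2
  · refine ⟨Real.exp (-2) * (γ ^ 2 * n / (8 * k ^ 2)), by positivity, ?_, ?_, ?_⟩
    · have h3 : U ≤ γ ^ 2 * n / (8 * k ^ 2) := by
        rw [le_div_iff₀ (by positivity)]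
        have h6 : p * γ ^ 2 * n ≤ γ ^ 2 * n := by
          rw [mul_assoc]; exact mul_le_of_le_one_left (by positivity) hp1.le
        linarith [reg.k_sq_le]
      have h4 : 1 / 8 ≤ Real.exp (-2) := by
        have he : Real.exp 2 * Real.exp (-2) = 1 := by rw [← Real.exp_add]; simp
        have := exp_two_le
        nlinarith [Real.exp_pos (-2)]
      calc 9 * l ≤ 1 / 8 * U := by linarith [reg.l_le]
        _ ≤ _ := by gcongr
    · have h3 : Real.exp (-2) ≤ Real.exp (-(σ - 2 / n)) := Real.exp_le_exp.2 (by linarith)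
      have h4 : 1 + k * R ≤ 2 * k := by nlinarith
      have h5 : γ ^ 2 * n / (8 * k ^ 2) = 1 / (2 * n) * (γ * n / (2 * k)) ^ 2 := by
        field_simp; norm_num
      rw [h5]
      gcongr
    · have h3 : l / (Real.exp (-2) * (γ ^ 2 * n / (8 * k ^ 2)))
          = Real.exp 2 * (8 * l / n * (k / γ) ^ 2) := by
        have : Real.exp (-2) = (Real.exp 2)⁻¹ := by rw [Real.exp_neg]
        rw [this]
        field_simp
      rw [h3, sqrt_exp_two_mul, Real.sqrt_mul (by positivity), Real.sqrt_sq (by positivity)]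
      have : 3 * (Real.exp 1 * (Real.sqrt (8 * l / n) * (k / γ)))
          = 3 * Real.exp 1 * (Real.sqrt (8 * l / n) * k / γ) := by ring
      have hcσ : 0 ≤ 3 * Real.sqrt (l / U) * σ := by positivity
      linarith
  · refine ⟨U, hU0, by linarith [reg.l_le], ?_, ?_⟩
    · have h3 : Real.exp (-σ) ≤ Real.exp (-(σ - 2 / n)) := Real.exp_le_exp.2 (by linarith)
      have h4 : U ≤ Real.exp (-σ) * (1 / (2 * n) * (γ * n / (1 + k * R)) ^ 2) := by
        have h5 : Real.exp (-σ) * (1 / (2 * n) * (γ * n / (1 + k * R)) ^ 2)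
            = γ ^ 2 * n / (2 * Real.exp σ * (1 + k * R) ^ 2) := by
          rw [Real.exp_neg]; field_simp
        rw [h5, le_div_iff₀ (by positivity)]
        linarith
      refine h4.trans ?_
      gcongr
    · have h6 : 3 * Real.sqrt (l / U) * 1 ≤ 3 * Real.sqrt (l / U) * σ := by
        gcongr; linarith
      linarith

/-- The loss in the logarithm of the bias during the life cycle of a generation, apart from the part
that is proportional to the logarithm of the bias; `S` is the number of propagation rounds. -/
noncomputable def cycleLoss (γ p l : ℝ) (n k S : ℕ) : ℝ :=
  2 / n + 3 * Real.exp 1 * (Real.sqrt (8 * l / n) * k / γ)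
    + 3 * Real.exp 1 * Real.sqrt (2 * l * k / n)
      * (S / Real.sqrt γ + Real.sqrt (k / (p * γ ^ 2)) / (1 - p))

/-- The part due to the small initial size of the generation is a geometric series, so its factor √k
is paid once and not in each of the S rounds. -/
theorem sum_roundLoss_le {γ p l U κ : ℝ} (reg : Regime γ p l U κ n k) {Γ₀ σ : ℝ}
    (hΓk : p * γ ^ 2 / k ≤ Γ₀) (S : ℕ) :
    ∑ u ∈ range S, roundLoss γ p l U n k Γ₀ σ u
      ≤ 3 * Real.exp 1 * Real.sqrt (2 * l * k / n)
        * (S / Real.sqrt γ + Real.sqrt (k / (p * γ ^ 2)) / (1 - p))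
        + 3 * Real.sqrt (l / U) * S * σ := by
  have hp0 := reg.p_pos
  have hp1 := reg.p_lt_one
  have hγ0 := reg.γ_pos
  have hk2 : (2 : ℝ) ≤ k := by exact_mod_cast reg.two_le_k
  have hΓ0 : 0 < Γ₀ := lt_of_lt_of_le (by positivity) hΓk
  unfold roundLoss
  rw [sum_add_distrib, ← mul_sum, sum_add_distrib, sum_const, sum_const, card_range, nsmul_eq_mul,
    nsmul_eq_mul, ← sum_div]
  have h1 : ∑ u ∈ range S, p ^ u ≤ 1 / (1 - p) := by
    have h := mul_neg_geom_sum p S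
    rw [le_div_iff₀ (by linarith)]
    have : 0 < p ^ S := by positivity
    linarith
  have h2 : 1 / Real.sqrt Γ₀ ≤ Real.sqrt (k / (p * γ ^ 2)) := by
    rw [← Real.sqrt_one, ← Real.sqrt_div zero_le_one]
    apply Real.sqrt_le_sqrt
    rw [div_le_div_iff₀ hΓ0 (by positivity)]
    rw [div_le_iff₀ (by linarith)] at hΓk
    linarith
  have h3 : (∑ u ∈ range S, p ^ u) / Real.sqrt Γ₀
      ≤ Real.sqrt (k / (p * γ ^ 2)) / (1 - p) := by
    rw [div_eq_mul_one_div]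
    have h4 : 0 ≤ 1 - p := by linarith
    calc _ ≤ 1 / (1 - p) * Real.sqrt (k / (p * γ ^ 2)) := by gcongr
      _ = _ := by ring
  have h5 : (S : ℝ) * (1 / Real.sqrt γ) = S / Real.sqrt γ := by ring
  rw [h5]
  have h6 : (S : ℝ) * (3 * Real.sqrt (l / U) * σ) = 3 * Real.sqrt (l / U) * S * σ := by ring
  rw [h6]
  gcongr

theorem two_choices_phase {γ p l U κ : ℝ} (reg : Regime γ p l U κ n k) {α : ℝ}
    {op : Fin n → Fin k} {a : Fin k} {ρ σ : ℝ} {i t : ℕ} (hρ0 : 0 ≤ ρ) (hσρ : σ ≤ 2 * ρ)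
    (hσκ : σ ≤ κ) (hτ : 2 / (n : ℝ) ≤ σ) (htc : IsTwoChoicesRound γ α n k (t + 1)) :
    Leads γ α op (Dominates i a (Real.exp (-ρ)) γ) t
      (Dominates (i + 1) a (Real.exp (-(σ - 2 / n -
        (3 * Real.exp 1 * (Real.sqrt (8 * l / n) * k / γ) + 3 * Real.sqrt (l / U) * σ))))
        (p * γ ^ 2 * collision k (Real.exp (-ρ)))) (t + 1) ((k + 2) * Real.exp (-l / 4)) := by
  have hγ0 := reg.γ_pos
  have hl0 := reg.l_nonneg
  have hn4 : (4 : ℝ) ≤ n := by exact_mod_cast reg.four_le_n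
  have hn0 : (0 : ℝ) < n := by linarith
  have hn2 : 2 ≤ n := by have := reg.four_le_n; omega
  have hR0 : 0 < Real.exp (-ρ) := Real.exp_pos _
  have hR1 : Real.exp (-ρ) ≤ 1 := Real.exp_le_one_iff.2 (by linarith)
  have hσ0 : 0 ≤ σ := le_trans (by positivity) hτ
  have hσR : Real.exp σ * Real.exp (-ρ) ^ 2 ≤ 1 := by
    rw [← Real.exp_nat_mul, ← Real.exp_add, Real.exp_le_one_iff]
    push_cast
    linarith
  have hs2 := (reg.size_bounds hR0 hσR hσκ).2
  generalize hR : Real.exp (-ρ) = R at *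
  -- Source of the term 2/n in `cycleLoss`.
  have hnd : ((n : ℝ) - 1) / (n - 2) ≤ Real.exp (2 / n) := by
    refine le_trans ?_ (Real.add_one_le_exp _)
    rw [div_le_iff₀ (by linarith)]
    have : (2 / (n : ℝ) + 1) * (n - 2) = n - 4 / n := by field_simp; ring
    rw [this]
    have : 4 / (n : ℝ) ≤ 1 := by rw [div_le_one hn0]; exact hn4
    linarith
  obtain ⟨V, hV0, hV9, hVR, hVL⟩ := reg.two_choices_scale hR0 hR1 hσ0 hs2
  classical
  refine leads_step hn2 (fun s hs => ?_) (by positivity)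
  obtain ⟨M, hM⟩ : ∃ M : ℝ, M = ((n : ℝ) - 2) / (n - 1) ^ 2 * (collision k R * (γ * n) ^ 2) :=
    ⟨_, rfl⟩
  obtain ⟨hM0, hM1⟩ := reg.promoted_bounds hR0 hM
  have hR₀ : R ^ 2 * (((n : ℝ) - 1) / (n - 2)) ≤ Real.exp (-(σ - 2 / n)) := by
    calc R ^ 2 * (((n : ℝ) - 1) / (n - 2)) ≤ R ^ 2 * Real.exp (2 / n) := by gcongr
      _ = Real.exp (-(2 * ρ) + 2 / n) := by
          rw [← hR, ← Real.exp_nat_mul, ← Real.exp_add]; congr 1; push_cast; ring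
      _ ≤ _ := Real.exp_le_exp.2 (by linarith)
  have hround := two_choices_round (by have := reg.four_le_n; omega) reg.two_le_k htc hs hl0 hV0
    hV9 hR1 hR0 hγ0.le hR₀ (Real.exp_le_one_iff.2 (by linarith)) hVR hM hM0 hM1
  refine (freq_mono fun smp hsmp => ?_).trans hround
  intro hd
  refine hsmp (hd.mono ?_ le_rfl)
  rw [← Real.exp_add, Real.exp_le_exp]
  linarith

/-- The life cycle of a generation: a two-choices round and `S` propagation rounds square the bias
up to small losses, and the new generation ends up with a fraction `γ` of the nodes. -/
theorem generation_phase {γ p l U κ : ℝ} (reg : Regime γ p l U κ n k) {α : ℝ}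
    {op : Fin n → Fin k} {a : Fin k} {ρ : ℝ} {i t S : ℕ} (hρ0 : 0 ≤ ρ) (hκ0 : 0 ≤ κ)
    (hloss : 3 * Real.sqrt (l / U) * (S + 1) * min (2 * ρ) κ + cycleLoss γ p l n k S
      ≤ min (2 * ρ) κ)
    (hsize : γ ≤ (2 - γ) ^ S * (p * γ ^ 2 * collision k (Real.exp (-ρ))))
    (htc : IsTwoChoicesRound γ α n k (t + 1))
    (hnt : ∀ s < S, ¬ IsTwoChoicesRound γ α n k (t + 1 + s + 1)) :
    Leads γ α op (Dominates i a (Real.exp (-ρ)) γ) t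
      (Dominates (i + 1) a (Real.exp (-(min (2 * ρ) κ * (1 - 3 * Real.sqrt (l / U) * (S + 1))
        - cycleLoss γ p l n k S))) γ) (t + 1 + S)
      ((S + 1) * ((k + 2) * Real.exp (-l / 4))) := by
  have hp0 := reg.p_pos
  have hp1 := reg.p_lt_one
  have hγ0 := reg.γ_pos
  have hγ1 := reg.γ_lt
  have hU0 := reg.U_pos
  have hl0 := reg.l_nonneg
  have hn4 : (4 : ℝ) ≤ n := by exact_mod_cast reg.four_le_n
  have hn0 : (0 : ℝ) < n := by linarith
  have hk2 : (2 : ℝ) ≤ k := by exact_mod_cast reg.two_le_k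
  have hk1 : 1 ≤ k := by have := reg.two_le_k; omega
  have hn2 : 2 ≤ n := by have := reg.four_le_n; omega
  set R := Real.exp (-ρ) with hR
  have hR0 : 0 < R := Real.exp_pos _
  have hR1 : R ≤ 1 := Real.exp_le_one_iff.2 (by linarith)
  set σ := min (2 * ρ) κ with hσ
  have hσ0 : 0 ≤ σ := le_min (by linarith) hκ0
  set Γ₀ := p * γ ^ 2 * collision k R with hΓ₀
  have hΓk : p * γ ^ 2 / k ≤ Γ₀ := by
    rw [div_eq_mul_one_div, hΓ₀]
    have := one_div_le_collision hk1 hR0.le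
    gcongr
  have hΓγ : Γ₀ ≤ γ := by
    have h1 := collision_le_one hk1 hR0.le
    have h2 : 0 ≤ collision k R := le_trans (by positivity) (one_div_le_collision hk1 hR0.le)
    calc Γ₀ ≤ 1 * γ ^ 2 * 1 := by rw [hΓ₀]; gcongr
      _ ≤ γ := by nlinarith
  have hσR : Real.exp σ * R ^ 2 ≤ 1 := by
    rw [hR, ← Real.exp_nat_mul, ← Real.exp_add, Real.exp_le_one_iff]
    have := min_le_left (2 * ρ) κ
    push_cast
    linarith
  have hs1 := (reg.size_bounds hR0 hσR (min_le_right _ _)).1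
  have hsum := sum_roundLoss_le reg (σ := σ) hΓk S
  set L := ∑ u ∈ range S, roundLoss γ p l U n k Γ₀ σ u with hL
  have hL0 : 0 ≤ L := sum_nonneg fun u _ => roundLoss_nonneg hp0.le hσ0 u
  set c₂ := 3 * Real.sqrt (l / U) with hc₂
  have hc₂0 : 0 ≤ c₂ := by positivity
  set e₁ := 3 * Real.exp 1 * (Real.sqrt (8 * l / n) * k / γ) with he₁
  have he₁0 : 0 ≤ e₁ := by positivity
  have hcl : cycleLoss γ p l n k S = 2 / n + e₁ + 3 * Real.exp 1 * Real.sqrt (2 * l * k / n)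
        * (S / Real.sqrt γ + Real.sqrt (k / (p * γ ^ 2)) / (1 - p)) := rfl
  have hnn : (0 : ℝ) ≤ 2 / n := by positivity
  have hcσ : 0 ≤ c₂ * σ := by positivity
  have hmul : c₂ * (S + 1) * σ = c₂ * S * σ + c₂ * σ := by ring
  set σ' := σ - 2 / n - (e₁ + c₂ * σ) with hσ'
  have hLσ : L ≤ σ' := by
    rw [hcl, hmul] at hloss
    linarith
  have hphase := propagation_phase reg (α := α) (op := op) (a := a) (i := i + 1) (t := t + 1)
    (S := S) hΓk hΓγ hs1 (show σ' ≤ σ by linarith) hσ0 hLσ hnt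
  have hmin : min γ ((2 - γ) ^ S * Γ₀) = γ := min_eq_left hsize
  rw [hmin] at hphase
  have hstep := two_choices_phase reg (α := α) (op := op) (a := a) (i := i) hρ0
    (min_le_left (2 * ρ) κ) (min_le_right (2 * ρ) κ) (show 2 / (n : ℝ) ≤ σ by linarith) htc
  refine (hstep.trans hn2 hphase).mono hn2 (fun _ h => h) (fun s h => h.mono ?_ le_rfl)
    (le_of_eq (by ring))
  rw [Real.exp_le_exp, hcl]
  linarith [show σ * (1 - c₂ * (S + 1)) = σ - c₂ * (S + 1) * σ by ring]

end Phases

end Plurality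

namespace Plurality

/-! ### Predefined life cycles and the induction over generations -/

section Schedule

open Finset

variable {n k : ℕ} {γ α : ℝ}

theorem collision_pos {k : ℕ} (hk : 1 ≤ k) {R : ℝ} (hR : 0 ≤ R) : 0 < collision k R :=
  lt_of_lt_of_le (by have : (0 : ℝ) < k := by exact_mod_cast hk
                     positivity) (one_div_le_collision hk hR)

/-- Growing from γ²·collision to γ at rate 2 - γ takes -log(γ·collision)/log(2 - γ) rounds, with
`collision` taken at the ideal bias; the life cycle adds two rounds to this. -/
theorem lifeCycle_succ (hγ0 : 0 < γ) (hk : 1 ≤ k) (hα : 1 ≤ α) (m : ℕ) :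
    lifeCycle γ α k (m + 1)
      = -Real.log (γ * collision k (α ^ 2 ^ m)⁻¹) / Real.log (2 - γ) + 2 := by
  have hk1 : (1 : ℝ) ≤ k := by exact_mod_cast hk
  have hβ : 0 < α ^ 2 ^ m := by positivity
  have h0 : 0 < collision k (α ^ 2 ^ m)⁻¹ := collision_pos hk (by positivity)
  have h1 : 0 < α ^ 2 ^ m + k - 1 := by linarith
  have h2 : 0 < α ^ 2 ^ (m + 1) + k - 1 := by
    have : 0 < α ^ 2 ^ (m + 1) := by positivity
    linarith
  have h3 : α ^ 2 ^ (m + 1) = (α ^ 2 ^ m) ^ 2 := by rw [pow_succ 2 m, pow_mul]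
  have h4 : collision k (α ^ 2 ^ m)⁻¹ = (α ^ 2 ^ (m + 1) + k - 1) / (α ^ 2 ^ m + k - 1) ^ 2 := by
    unfold collision
    rw [h3]
    have h5 : 1 + ((k : ℝ) - 1) * (α ^ 2 ^ m)⁻¹ = (α ^ 2 ^ m + k - 1) / α ^ 2 ^ m := by
      field_simp; ring
    have h6 : 1 + ((k : ℝ) - 1) * (α ^ 2 ^ m)⁻¹ ^ 2
        = ((α ^ 2 ^ m) ^ 2 + k - 1) / (α ^ 2 ^ m) ^ 2 := by
      field_simp; ring
    rw [h5, h6]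
    field_simp
  rw [Real.log_mul hγ0.ne' h0.ne', h4, Real.log_div h2.ne' (by positivity), Real.log_pow]
  unfold lifeCycle
  simp only [Nat.add_sub_cancel]
  push_cast
  ring

theorem two_le_lifeCycle (hγ0 : 0 < γ) (hγ1 : γ < 1) (hk : 1 ≤ k) (hα : 1 ≤ α) (m : ℕ) :
    2 ≤ lifeCycle γ α k (m + 1) := by
  rw [lifeCycle_succ hγ0 hk hα]
  have h0 : 0 < collision k (α ^ 2 ^ m)⁻¹ := collision_pos hk (by positivity)
  have h1 := collision_le_one hk (R := (α ^ 2 ^ m)⁻¹) (by positivity)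
  have h2 : Real.log (γ * collision k (α ^ 2 ^ m)⁻¹) ≤ 0 :=
    Real.log_nonpos (by positivity) (by nlinarith)
  have h3 : 0 < Real.log (2 - γ) := Real.log_pos (by linarith)
  have : 0 ≤ -Real.log (γ * collision k (α ^ 2 ^ m)⁻¹) / Real.log (2 - γ) :=
    div_nonneg (by linarith) h3.le
  linarith

theorem birthTime_one : birthTime γ α k 1 = 1 := by simp [birthTime]

theorem birthTime_succ (m : ℕ) : birthTime γ α k (m + 1 + 1)
    = birthTime γ α k (m + 1) + ⌈lifeCycle γ α k (m + 1)⌉₊ := by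
  unfold birthTime
  rw [sum_Ico_succ_top (by omega)]
  ring

theorem birthTime_mono {i j : ℕ} (hij : i ≤ j) : birthTime γ α k i ≤ birthTime γ α k j := by
  unfold birthTime
  gcongr

theorem not_isTwoChoicesRound_between {m t : ℕ} (h1 : birthTime γ α k (m + 1) < t)
    (h2 : t < birthTime γ α k (m + 1 + 1)) : ¬ IsTwoChoicesRound γ α n k t := by
  rintro ⟨j, _, _, rfl⟩
  rcases Nat.lt_or_ge j (m + 1 + 1) with h | h
  · exact absurd (birthTime_mono (γ := γ) (α := α) (k := k) (by omega : j ≤ m + 1)) (by omega)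
  · exact absurd (birthTime_mono (γ := γ) (α := α) (k := k) h) (by omega)

theorem not_isTwoChoicesRound_after {t : ℕ}
    (h1 : birthTime γ α k (numGenerations α n) < t) : ¬ IsTwoChoicesRound γ α n k t := by
  rintro ⟨j, _, hj, rfl⟩
  exact absurd (birthTime_mono (γ := γ) (α := α) (k := k) hj) (by omega)

/-- The numerator of `collision` increases with R, and (1 + (k - 1)R)/R decreases. So an error in
the bias affects `collision` by at most its square. -/
theorem mul_collision_le {k : ℕ} (hk : 1 ≤ k) {R R' : ℝ} (hR : 0 < R) (hRR : R ≤ R') :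
    (R / R') ^ 2 * collision k R ≤ collision k R' := by
  have hk1 : (0 : ℝ) ≤ (k : ℝ) - 1 := by
    have : (1 : ℝ) ≤ k := by exact_mod_cast hk
    linarith
  have hR' : 0 < R' := hR.trans_le hRR
  unfold collision
  have h1 : R * (1 + ((k : ℝ) - 1) * R') ≤ R' * (1 + (k - 1) * R) := by nlinarith
  have h2 : 1 + ((k : ℝ) - 1) * R ^ 2 ≤ 1 + (k - 1) * R' ^ 2 := by gcongr
  rw [div_pow, div_mul_div_comm, div_le_div_iff₀ (by positivity) (by positivity)]
  calc R ^ 2 * (1 + ((k : ℝ) - 1) * R ^ 2) * (1 + (k - 1) * R') ^ 2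
      = (1 + ((k : ℝ) - 1) * R ^ 2) * (R * (1 + (k - 1) * R')) ^ 2 := by ring
    _ ≤ (1 + (k - 1) * R' ^ 2) * (R' * (1 + (k - 1) * R)) ^ 2 := by gcongr
    _ = _ := by ring

/-- The life cycle is long enough for a new generation to grow to a fraction `γ`, provided that the
bias is not much smaller than it would be without random deviations. -/
theorem fraction_reached {p : ℝ} (hγ0 : 0 < γ) (hγ1 : γ < 1) (hp0 : 0 < p)
    (hp : p ^ 2 * (2 - γ) = 1) (hk : 1 ≤ k) (hα : 1 ≤ α) {m S : ℕ} {R : ℝ} (hR : 0 ≤ R)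
    (hS : S + 1 = ⌈lifeCycle γ α k (m + 1)⌉₊)
    (hcol : p * collision k (α ^ 2 ^ m)⁻¹ ≤ collision k R) :
    γ ≤ (2 - γ) ^ S * (p * γ ^ 2 * collision k R) := by
  set c := collision k (α ^ 2 ^ m)⁻¹ with hc
  have hc0 : 0 < c := collision_pos hk (by positivity)
  have hR0 : 0 < collision k R := collision_pos hk hR
  have hq : 1 < 2 - γ := by linarith
  have hlq : 0 < Real.log (2 - γ) := Real.log_pos hq
  have h1 : lifeCycle γ α k (m + 1) ≤ S + 1 := by
    have := Nat.le_ceil (lifeCycle γ α k (m + 1))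
    rw [← hS] at this
    exact_mod_cast this
  rw [lifeCycle_succ hγ0 hk hα] at h1
  have h2 : -Real.log (γ * c) ≤ (S - 1) * Real.log (2 - γ) := by
    rw [← div_le_iff₀ hlq]; linarith
  have h3 : (γ * c)⁻¹ * (2 - γ) ≤ (2 - γ) ^ S := by
    rw [← Real.log_le_log_iff (by positivity) (by positivity), Real.log_mul (by positivity)
      (by linarith), Real.log_inv, Real.log_pow]
    linarith
  -- Of the two extra rounds of the life cycle, one is the two-choices round itself. The other
  -- yields a spare factor 2 - γ = p⁻², which pays for the factor p lost at promotion and the factor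
  -- p lost in `collision`.
  calc γ = (γ * c)⁻¹ * (2 - γ) * (p * γ ^ 2 * (p * c)) := by
        have : (γ * c)⁻¹ * (2 - γ) * (p * γ ^ 2 * (p * c)) = (p ^ 2 * (2 - γ)) * γ := by
          field_simp
        rw [this, hp, one_mul]
    _ ≤ (2 - γ) ^ S * (p * γ ^ 2 * collision k R) := by gcongr

/-- The logarithm of the bias that is guaranteed at the end of the life cycle of generation `m`. -/
noncomputable def logBias (κ lam ν e : ℝ) (m : ℕ) : ℝ :=
  min (2 ^ m * lam * (1 - m * ν) - (2 ^ m - 1) * e) (κ - 1)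

/-- The conditions under which all generations before the last one behave as intended. `K` is such
that a bias of `k ^ (K / 2)` suffices for the dominant opinion to prevail at once. -/
structure Schedule (γ p l U κ α η ν e K : ℝ) (n k M : ℕ) : Prop where
  regime : Regime γ p l U κ n k
  one_lt : 1 < α
  ν_nonneg : 0 ≤ ν
  e_nonneg : 0 ≤ e
  factor : ∀ m < M, 3 * Real.sqrt (l / U) * ⌈lifeCycle γ α k (m + 1)⌉₊ ≤ ν
  loss : ∀ m < M, cycleLoss γ p l n k (⌈lifeCycle γ α k (m + 1)⌉₊ - 1) ≤ e
  total : M * ν * Real.log α + e ≤ η * Real.log α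
  η_le : η ≤ 1 / 4
  ν_le : ν ≤ 1 / 4
  e_le : e ≤ 1 / 2
  cap_loss : κ * ν + e ≤ 1
  cap_large : 4 ≤ κ
  bias_close : p * Real.exp (2 * η * K * Real.log k) ≤ 1
  bias_large : p * (1 + k * Real.exp (-(K / 2 * Real.log k))) ^ 2 ≤ 1
  cap_suffices : p * (1 + k * Real.exp (1 - κ)) ^ 2 ≤ 1

variable {p l U κ η ν e K : ℝ} {M : ℕ}

/-- Additive losses are doubled along with the bias, so they amount to less than 2^m·e. Relative to
2^m·log α, all losses together are at most η by `total`. -/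
theorem Schedule.le_logBias (sch : Schedule γ p l U κ α η ν e K n k M) {m : ℕ} (hm : m ≤ M) :
    min (2 ^ m * Real.log α * (1 - η)) (κ - 1) ≤ logBias κ (Real.log α) ν e m := by
  have hlam : 0 < Real.log α := Real.log_pos sch.one_lt
  have h1 := sch.total
  have h2 : (m : ℝ) ≤ M := by exact_mod_cast hm
  have h3 := sch.ν_nonneg
  have h4 := sch.e_nonneg
  unfold logBias
  apply min_le_min_right
  have h5 : (m : ℝ) * ν * Real.log α + e ≤ η * Real.log α := by
    refine le_trans ?_ h1
    gcongr
  have h6 : (0 : ℝ) < 2 ^ m := by positivity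
  have h7 : 2 ^ m * ((m : ℝ) * ν * Real.log α + e) ≤ 2 ^ m * (η * Real.log α) := by gcongr
  linarith

theorem logBias_le {lam : ℝ} (hlam : 0 ≤ lam) (hν : 0 ≤ ν) (he : 0 ≤ e) (m : ℕ) :
    logBias κ lam ν e m ≤ 2 ^ m * lam := by
  refine (min_le_left _ _).trans ?_
  have h1 : (1 : ℝ) ≤ 2 ^ m := one_le_pow₀ (by norm_num)
  have h2 : 0 ≤ ((2 : ℝ) ^ m - 1) * e := mul_nonneg (by linarith) he
  have h3 : 0 ≤ (2 : ℝ) ^ m * lam * (m * ν) := by positivity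
  linarith

/-- Let w be the ideal log-bias. If the cap is reached or w ≥ K·log k, the true bias is so large
that its `collision` is at least p, while the ideal one is at most 1. If w ≤ K·log k, the true
log-bias falls short by at most η·w ≤ η·K·log k, which `mul_collision_le` and `bias_close` turn into
a factor of at least p. -/
theorem Schedule.collision_le (sch : Schedule γ p l U κ α η ν e K n k M) {m : ℕ} (hm : m ≤ M) :
    p * collision k (α ^ 2 ^ m)⁻¹
      ≤ collision k (Real.exp (-(logBias κ (Real.log α) ν e m))) := by
  have reg := sch.regime
  have hk1 : 1 ≤ k := by have := reg.two_le_k; omega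
  have hk0 : (0 : ℝ) < k := by exact_mod_cast hk1
  have hp0 := reg.p_pos
  have hα0 : 0 < α := by linarith [sch.one_lt]
  have hlam : 0 < Real.log α := Real.log_pos sch.one_lt
  have hle := sch.le_logBias hm
  have hlw := logBias_le (κ := κ) hlam.le sch.ν_nonneg sch.e_nonneg m
  set ρ := logBias κ (Real.log α) ν e m with hρ
  set w := 2 ^ m * Real.log α with hw
  have hw0 : 0 < w := by positivity
  have hβ : (α ^ 2 ^ m)⁻¹ = Real.exp (-w) := by
    rw [Real.exp_neg, hw]
    congr 1
    rw [← Real.exp_log (show 0 < α ^ 2 ^ m by positivity), Real.log_pow]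
    push_cast
    rfl
  have hlarge : ∀ ξ, k * Real.exp (-ρ) ≤ ξ → p * (1 + ξ) ^ 2 ≤ 1 →
      p * collision k (α ^ 2 ^ m)⁻¹ ≤ collision k (Real.exp (-ρ)) := by
    intro ξ h1 h2
    have h3 := collision_ge_of_le hk1 (Real.exp_pos (-ρ)).le h1
    have h4 := collision_le_one hk1 (R := (α ^ 2 ^ m)⁻¹) (by positivity)
    have hξ : 0 < ξ := lt_of_lt_of_le (by positivity) h1
    refine le_trans ?_ h3
    rw [le_div_iff₀ (by positivity)]
    have : 0 < collision k (α ^ 2 ^ m)⁻¹ := collision_pos hk1 (by positivity)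
    calc p * collision k (α ^ 2 ^ m)⁻¹ * (1 + ξ) ^ 2 ≤ p * 1 * (1 + ξ) ^ 2 := by gcongr
      _ ≤ 1 := by linarith
  rcases le_total (κ - 1) (w * (1 - η)) with h | h
  · rw [min_eq_right h] at hle
    refine hlarge (k * Real.exp (1 - κ)) ?_ sch.cap_suffices
    gcongr
    linarith
  · rw [min_eq_left h] at hle
    have hη := sch.η_le
    rcases le_total w (K * Real.log k) with hwK | hwK
    · rw [hβ]
      refine le_trans ?_ (mul_collision_le hk1 (Real.exp_pos (-w))
        (Real.exp_le_exp.2 (by linarith : -w ≤ -ρ)))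
      have : 0 < collision k (Real.exp (-w)) := collision_pos hk1 (Real.exp_pos _).le
      gcongr
      rw [← Real.exp_sub, ← Real.exp_nat_mul]
      have hη0 : 0 ≤ η := by
        have h1 := sch.total
        have h2 : 0 ≤ M * ν * Real.log α + e := by
          have := sch.ν_nonneg
          have := sch.e_nonneg
          positivity
        by_contra h3
        have : η * Real.log α < 0 := mul_neg_of_neg_of_pos (not_le.1 h3) hlam
        linarith
      have h1 : η * w ≤ η * (K * Real.log k) := by gcongr
      have h2 := sch.bias_close
      have h3 : p ≤ Real.exp (-(2 * η * K * Real.log k)) := by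
        rw [Real.exp_neg, ← one_div, le_div_iff₀ (Real.exp_pos _)]
        exact h2
      refine h3.trans (Real.exp_le_exp.2 ?_)
      push_cast
      linarith
    · refine hlarge _ ?_ sch.bias_large
      gcongr
      nlinarith

/-- `birthTime` numbers the round that creates generation m + 1, and this round acts on the
configuration one time step earlier; hence the subtraction of 1. Each cycle maps ρ to at least
min(2ρ, κ)(1 - ν) - e, a recursion for which `logBias` is an explicit lower bound. -/
theorem Schedule.generations (sch : Schedule γ p l U κ α η ν e K n k M)
    (hM : M + 1 = numGenerations α n) (op : Fin n → Fin k) (a : Fin k) (m : ℕ) (hm : m ≤ M) :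
    Leads γ α op (Dominates 0 a (Real.exp (-Real.log α)) γ) 0
      (Dominates m a (Real.exp (-(logBias κ (Real.log α) ν e m))) γ)
      (birthTime γ α k (m + 1) - 1)
      ((birthTime γ α k (m + 1) - 1 : ℕ) * ((k + 2) * Real.exp (-l / 4))) := by
  have reg := sch.regime
  have hlam : 0 < Real.log α := Real.log_pos sch.one_lt
  have hn2 : 2 ≤ n := by have := reg.four_le_n; omega
  have hk1 : 1 ≤ k := by have := reg.two_le_k; omega
  induction m with
  | zero =>
    rw [birthTime_one]
    refine Leads.refl.mono hn2 (fun s h => h) (fun s h => h.mono ?_ le_rfl) (by simp)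
    · rw [Real.exp_le_exp]
      have := logBias_le (κ := κ) hlam.le sch.ν_nonneg sch.e_nonneg 0
      simpa using this
  | succ m ih =>
    have ih' := ih (by omega)
    have hX2 := two_le_lifeCycle reg.γ_pos reg.γ_lt hk1 sch.one_lt.le m
    have hXpos : 0 < ⌈lifeCycle γ α k (m + 1)⌉₊ := Nat.ceil_pos.2 (by linarith)
    obtain ⟨S, hS⟩ : ∃ S, S + 1 = ⌈lifeCycle γ α k (m + 1)⌉₊ :=
      ⟨⌈lifeCycle γ α k (m + 1)⌉₊ - 1, by omega⟩
    have hB := birthTime_succ (γ := γ) (α := α) (k := k) m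
    rw [← hS] at hB
    have hB1 : 1 ≤ birthTime γ α k (m + 1) := by unfold birthTime; omega
    have hfac := sch.factor m (by omega)
    have hlos := sch.loss m (by omega)
    rw [← hS] at hfac hlos
    simp only [Nat.add_sub_cancel] at hlos
    push_cast at hfac
    have hle := sch.le_logBias (by omega : m ≤ M)
    set ρ := logBias κ (Real.log α) ν e m with hρ
    have hη := sch.η_le
    have hκ := sch.cap_large
    have hν := sch.ν_le
    have hν0 := sch.ν_nonneg
    have he := sch.e_le
    have he0 := sch.e_nonneg
    have htot := sch.total
    have hcap := sch.cap_loss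
    have heη : e ≤ Real.log α / 4 := by
      have h1 : 0 ≤ M * ν * Real.log α := by positivity
      have h2 : η * Real.log α ≤ 1 / 4 * Real.log α := by gcongr
      linarith
    -- Keeps σ at least 4/3 of the additive loss e; with ν ≤ 1/4, the losses of a cycle then do not
    -- exceed σ, as `generation_phase` requires.
    have hρlow : min (Real.log α / 2) 3 ≤ ρ := by
      refine le_trans (min_le_min ?_ (by linarith)) hle
      have h1 : (1 : ℝ) ≤ 2 ^ m := one_le_pow₀ (by norm_num)
      have h2 : Real.log α / 2 ≤ Real.log α * (1 - η) := by nlinarith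
      have h3 : 1 * Real.log α * (1 - η) ≤ 2 ^ m * Real.log α * (1 - η) := by
        gcongr; linarith
      linarith
    have hρ0 : 0 ≤ ρ := le_trans (le_min (by positivity) (by norm_num)) hρlow
    set σ := min (2 * ρ) κ with hσ
    have hσlow : 4 / 3 * e ≤ σ := by
      refine le_min ?_ (by linarith)
      have : 2 / 3 * e ≤ min (Real.log α / 2) 3 := le_min (by linarith) (by linarith)
      linarith
    have hσ0 : 0 ≤ σ := by linarith
    have hfacσ : 3 * Real.sqrt (l / U) * (S + 1) * σ ≤ ν * σ := by gcongr
    have hνσ : ν * σ ≤ 1 / 4 * σ := by gcongr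
    have hcol := sch.collision_le (by omega : m ≤ M)
    have hsize := fraction_reached reg.γ_pos reg.γ_lt reg.p_pos reg.p_sq hk1 sch.one_lt.le
      (Real.exp_pos _).le hS hcol
    have hphase := generation_phase reg (α := α) (op := op) (a := a) (i := m)
      (t := birthTime γ α k (m + 1) - 1) (S := S) hρ0 (by linarith)
      (by linarith) hsize ⟨m + 1, by omega, by omega, by omega⟩
      (fun s hs => not_isTwoChoicesRound_between (m := m) (by omega) (by omega))
    have htime : birthTime γ α k (m + 1) - 1 + 1 + S = birthTime γ α k (m + 1 + 1) - 1 := by omega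
    rw [htime] at hphase
    refine (ih'.trans hn2 hphase).mono hn2 (fun s h => h) (fun s h => h.mono ?_ le_rfl) ?_
    · rw [Real.exp_le_exp, neg_le_neg_iff, ← hσ]
      have h0 : σ * (1 - ν) - e
          ≤ σ * (1 - 3 * Real.sqrt (l / U) * (S + 1)) - cycleLoss γ p l n k S := by
        linarith [show σ * (1 - 3 * Real.sqrt (l / U) * (S + 1))
          = σ - 3 * Real.sqrt (l / U) * (S + 1) * σ by ring]
      refine le_trans ?_ h0
      rcases le_total (2 * ρ) κ with h | h
      · have hσe : σ = 2 * ρ := min_eq_left h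
        rcases le_total (2 ^ m * Real.log α * (1 - m * ν) - (2 ^ m - 1) * e) (κ - 1) with h' | h'
        · refine (min_le_left _ _).trans ?_
          have hρe : ρ = 2 ^ m * Real.log α * (1 - m * ν) - (2 ^ m - 1) * e := min_eq_left h'
          have hρw := logBias_le (κ := κ) hlam.le sch.ν_nonneg sch.e_nonneg m
          rw [← hρ] at hρw
          -- Estimating the loss ν·ρ by the ideal bias lets the relative errors add up to (m + 1)·ν.
          have h1 : ν * ρ ≤ ν * (2 ^ m * Real.log α) := by gcongr
          rw [hσe]
          push_cast
          rw [pow_succ]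
          have h2 : 2 * ρ * (1 - ν) = 2 * ρ - 2 * (ν * ρ) := by ring
          rw [h2]
          nth_rewrite 1 [hρe]
          linarith
        · refine (min_le_right _ _).trans ?_
          have hρe : ρ = κ - 1 := min_eq_right h'
          rw [hσe, hρe]
          have : (κ - 1) * ν ≤ (κ - 1) * (1 / 4) := by gcongr; linarith
          linarith
      · have hσe : σ = κ := min_eq_right h
        refine (min_le_right _ _).trans ?_
        rw [hσe]
        linarith
    · have h1 : ((birthTime γ α k (m + 1 + 1) - 1 : ℕ) : ℝ)
          = (birthTime γ α k (m + 1) - 1 : ℕ) + (S + 1) := by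
        rw [← htime]; push_cast; ring
      rw [h1]
      linarith

theorem dominates_run_zero {op : Fin n → Fin k} {a : Fin k} (hα : α = bias op a) (h1 : 1 < α)
    (hγ1 : γ ≤ 1) (ω : ℕ → Samples n) :
    Dominates 0 a (Real.exp (-Real.log α)) γ (run γ α op ω 0) := by
  have hcard : ∀ j, (nodesOf (run γ α op ω 0) 0 j).card = support op j := by
    intro j
    simp [nodesOf, support, run]
  refine ⟨fun v => le_rfl, fun b hb => ?_, ?_⟩
  · rw [hcard, hcard, Real.exp_neg, Real.exp_log (by linarith)]
    have hs : support op b ≤ (univ.erase a).sup (support op) :=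
      le_sup (f := support op) (mem_erase.2 ⟨hb, mem_univ b⟩)
    set D := (univ.erase a).sup (support op) with hD
    -- If no other opinion were held, the division by zero would give bias 0, against 1 < α.
    have hD0 : (D : ℝ) ≠ 0 := by
      intro h0
      rw [hα, bias, ← hD, h0, div_zero] at h1
      linarith
    have hα' : α * D = support op a := by
      rw [hα, bias, ← hD]; field_simp
    rw [← hα', inv_mul_cancel_left₀ (by linarith)]
    exact_mod_cast hs
  · have : nodesOfGen (run γ α op ω 0) 0 = univ := by
      ext v; simp [mem_nodesOfGen, run]
    rw [this, card_univ, Fintype.card_fin]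
    exact mul_le_of_le_one_left (by positivity) hγ1

/-- The number of generations is such that M squarings bring the ideal bias to n. For α > n the
double logarithm is negative and the ceiling truncates it to M = 0, which does no harm. -/
theorem pow_numGenerations {M : ℕ} (hM : M + 1 = numGenerations α n) (hα : 1 < α)
    (hn : 2 ≤ n) : Real.log n ≤ 2 ^ M * Real.log α := by
  have hlam : 0 < Real.log α := Real.log_pos hα
  have hn' : 0 < Real.log n := Real.log_pos (by exact_mod_cast (by omega : 1 < n))
  have h1 : M = ⌈Real.logb 2 (Real.logb α n)⌉₊ := by
    unfold numGenerations at hM; omega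
  have h2 : Real.logb 2 (Real.logb α n) ≤ M := by rw [h1]; exact Nat.le_ceil _
  have h3 : 0 < Real.logb α n := by unfold Real.logb; positivity
  rw [Real.logb_le_iff_le_rpow (by norm_num) h3, Real.rpow_natCast] at h2
  unfold Real.logb at h2
  rwa [div_le_iff₀ hlam] at h2

end Schedule

end Plurality

namespace Plurality

/-! ### The last generation and convergence -/

section Ending

open Finset

variable {n k : ℕ} {γ α : ℝ}

/-- The missing fraction falls to h³ in expectation, but only h² is claimed: the spare factor h ≤ h₀
< 1 leaves room for the deviation. The floor 1/√n keeps the expectations large enough for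
concentration; from there one more round suffices, because h³n = 1/√n. -/
theorem spreading_phase (hn : 2 ≤ n) {op : Fin n → Fin k} {a : Fin k} {i t : ℕ} {h₀ l : ℝ}
    (hl : 0 ≤ l) (hh0 : 1 / Real.sqrt n ≤ h₀) (hh1 : h₀ < 1)
    (hl1 : l ≤ (1 - h₀) ^ 2 * Real.sqrt n) (hl2 : l ≤ 4 * (h₀ * Real.sqrt n)) (S : ℕ)
    (hnt : ∀ s < S, ¬ IsTwoChoicesRound γ α n k (t + s + 1)) :
    Leads γ α op (Unanimous i a h₀) t (Unanimous i a (max (h₀ ^ 2 ^ S) (1 / Real.sqrt n))) (t + S)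
      (S * Real.exp (-l / 4)) := by
  have hn0 : (0 : ℝ) < n := by exact_mod_cast (by omega : 0 < n)
  have hr0 : 0 < Real.sqrt n := Real.sqrt_pos.2 hn0
  have hrr : Real.sqrt n * Real.sqrt n = n := Real.mul_self_sqrt hn0.le
  have hh00 : 0 < h₀ := lt_of_lt_of_le (by positivity) hh0
  induction S with
  | zero =>
    have : max (h₀ ^ 2 ^ 0) (1 / Real.sqrt n) = h₀ := by simpa using hh0
    rw [this]
    simpa using Leads.refl
  | succ S ih =>
    have ih' := ih fun s hs => hnt s (by omega)
    set h := max (h₀ ^ 2 ^ S) (1 / Real.sqrt n) with hh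
    set h' := max (h₀ ^ 2 ^ (S + 1)) (1 / Real.sqrt n) with hh'
    have hle : h ≤ h₀ := max_le (pow_le_of_le_one hh00.le hh1.le (by positivity)) hh0
    have hpos : 0 < h := lt_of_lt_of_le (by positivity) (le_max_right _ _)
    have hsq : h ^ 2 ≤ h' := by
      rcases le_total (h₀ ^ 2 ^ S) (1 / Real.sqrt n) with h1 | h1
      · have h2 : h = 1 / Real.sqrt n := max_eq_right h1
        refine le_trans ?_ (le_max_right _ _)
        rw [h2]
        have : 1 / Real.sqrt n ≤ 1 := by linarith
        exact pow_le_of_le_one (by positivity) this (by norm_num)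
      · have h2 : h = h₀ ^ 2 ^ S := max_eq_left h1
        refine le_trans (le_of_eq ?_) (le_max_left _ _)
        rw [h2, pow_succ 2 S, pow_mul]
    have hr' : Real.sqrt n ≤ h' * n := by
      have h1 : 1 / Real.sqrt n ≤ h' := le_max_right _ _
      calc Real.sqrt n = 1 / Real.sqrt n * n := by
            field_simp; rw [sq]; exact hrr
        _ ≤ _ := by gcongr
    have hh'0 : 0 < h' := lt_of_lt_of_le (by positivity) (le_max_right _ _)
    classical
    have hstep : Leads γ α op (Unanimous i a h) (t + S) (Unanimous i a h') (t + S + 1)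
        (Real.exp (-l / 4)) := by
      refine leads_step hn (fun s hs => ?_) (by positivity)
      refine spreading_round hn (hnt S (by omega)) hs hl (M := h₀ * (h' * n)) (by positivity) ?_ ?_ ?_
      · calc l ≤ 4 * (h₀ * Real.sqrt n) := hl2
          _ ≤ _ := by gcongr
      · calc h ^ 3 * n = h * (h ^ 2 * n) := by ring
          _ ≤ h₀ * (h' * n) := by gcongr
      · have h1 : Real.sqrt (l * (h₀ * (h' * n))) ≤ (1 - h₀) * (h' * n) := by
          rw [Real.sqrt_le_left (mul_nonneg (by linarith) (by positivity))]
          calc l * (h₀ * (h' * n)) ≤ ((1 - h₀) ^ 2 * (h' * n)) * (1 * (h' * n)) := by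
                gcongr
                exact hl1.trans (by gcongr)
            _ = _ := by ring
        linarith
    refine (ih'.trans hn hstep).mono hn (fun s h => h) (fun s h => h) (le_of_eq ?_)
    push_cast
    ring

theorem run_col_of_le {op : Fin n → Fin k} {a : Fin k} {ω : ℕ → Samples n} {t t' : ℕ}
    (h : ∀ v, (run γ α op ω t v).col = a) (htt : t ≤ t') (v : Fin n) :
    (run γ α op ω t' v).col = a := by
  induction t', htt using Nat.le_induction generalizing v with
  | base => exact h v
  | succ t' _ ih =>
    classical
    simp only [run]
    exact step_col_eq ih v

variable {p l U κ η ν e K : ℝ} {M : ℕ}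

/-- The rounds from the birth of the last generation on. -/
theorem Schedule.ending (sch : Schedule γ p l U κ α η ν e K n k M)
    (hM : M + 1 = numGenerations α n) (op : Fin n → Fin k) (a : Fin k) (S : ℕ)
    (hn : 256 ≤ n) (hκ : 3 / 4 * Real.log n ≤ κ)
    (hk : (k : ℝ) * Real.exp (1 - 3 / 4 * Real.log n) ≤ 1)
    (hl1 : l ≤ (p * γ ^ 2 / 4) ^ 2 * Real.sqrt n)
    (hS : (1 - p * γ ^ 2 / 4) ^ 2 ^ S ≤ 1 / Real.sqrt n) :
    Leads γ α op (Dominates M a (Real.exp (-(logBias κ (Real.log α) ν e M))) γ)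
      (birthTime γ α k (M + 1) - 1)
      (fun s => ∀ v, (s v).col = a) (birthTime γ α k (M + 1) + S + 1)
      ((S + 2) * Real.exp (-l / 4) + (48 * k + 3) / Real.sqrt n) := by
  have reg := sch.regime
  have hk1 : 1 ≤ k := by have := reg.two_le_k; omega
  have hn2 : 2 ≤ n := by omega
  have hγ0 := reg.γ_pos
  have hγ1 := reg.γ_lt
  have hp0 := reg.p_pos
  have hp1 := reg.p_lt_one
  have hn256 : (256 : ℝ) ≤ n := by exact_mod_cast hn
  have hn0 : (0 : ℝ) < n := by linarith
  have hr0 : 0 < Real.sqrt n := Real.sqrt_pos.2 hn0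
  have hrr : Real.sqrt n * Real.sqrt n = n := Real.mul_self_sqrt hn0.le
  have hr16 : 16 ≤ Real.sqrt n := by
    apply Real.le_sqrt_of_sq_le; norm_num; exact hn
  have hB1 : 1 ≤ birthTime γ α k (M + 1) := by unfold birthTime; omega
  have hρ : 3 / 4 * Real.log n - 1 ≤ logBias κ (Real.log α) ν e M := by
    refine le_trans (le_min ?_ (by linarith)) (sch.le_logBias le_rfl)
    have h1 := pow_numGenerations hM sch.one_lt hn2
    have h2 := sch.η_le
    have h3 : 0 ≤ Real.log n := Real.log_nonneg (by linarith)
    have h4 : 3 / 4 * Real.log n ≤ (1 - η) * (2 ^ M * Real.log α) := by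
      apply mul_le_mul (by linarith) h1 h3 (by linarith)
    linarith
  set ρ := logBias κ (Real.log α) ν e M with hρdef
  -- Since k·R ≤ 1, `collision` is at least 1/4, so the last generation is born with at least a
  -- fraction c.
  set c := p * γ ^ 2 / 4 with hc
  have hc0 : 0 < c := by positivity
  have hc1 : c ≤ 1 / 4 := by
    have : p * γ ^ 2 ≤ 1 * 1 ^ 2 := by gcongr
    rw [hc]; linarith
  have hR0 : 0 < Real.exp (-ρ) := Real.exp_pos _
  have hkR : k * Real.exp (-ρ) ≤ 1 := by
    refine le_trans ?_ hk
    gcongr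
    linarith
  have hR1 : Real.exp (-ρ) ≤ 1 := by
    have : (1 : ℝ) ≤ k := by exact_mod_cast hk1
    nlinarith
  classical
  have h1 : Leads γ α op (Dominates M a (Real.exp (-ρ)) γ) (birthTime γ α k (M + 1) - 1)
      (Unanimous (M + 1) a (1 - c)) (birthTime γ α k (M + 1) - 1 + 1)
      (2 * Real.exp (-l / 4) + k * (3 * (16 / Real.sqrt n))) := by
    refine leads_step hn2 (fun s hs => ?_) (by positivity)
    obtain ⟨W, hW⟩ : ∃ W : ℝ, W = ((n : ℝ) - 2) / (n - 1) ^ 2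
      * (collision k (Real.exp (-ρ)) * (γ * n) ^ 2) := ⟨_, rfl⟩
    obtain ⟨hW0, hW1⟩ := reg.promoted_bounds hR0 hW
    refine extinction_round (by omega) reg.two_le_k ⟨M + 1, by omega, by omega, by omega⟩ hs
      reg.l_nonneg hR1 hR0.le hγ0.le hW hW0 (le_trans ?_ hW1) ?_ (by positivity) ?_
    · have h2 := collision_ge_of_le hk1 hR0.le hkR
      calc (1 - (1 - c)) * n = p * γ ^ 2 * (1 / (1 + 1) ^ 2) * n := by rw [hc]; ring
        _ ≤ _ := by gcongr
    -- R is at most e·n^{-3/4}, so a competing opinion has at most e²√n/(n - 1) promoted nodes in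
    -- expectation. Over all k opinions this makes extinction fail with probability O(k/√n), the
    -- dominant term of the final error.
    · have h3 : Real.exp (-ρ) * n ≤ Real.exp 1 * Real.exp (1 / 4 * Real.log n) := by
        calc Real.exp (-ρ) * n = Real.exp (-ρ + Real.log n) := by
              rw [Real.exp_add, Real.exp_log hn0]
          _ ≤ Real.exp (1 + 1 / 4 * Real.log n) := Real.exp_le_exp.2 (by linarith)
          _ = _ := Real.exp_add _ _
      have h4 : (Real.exp 1 * Real.exp (1 / 4 * Real.log n)) ^ 2
          = Real.exp 2 * Real.sqrt n := by
        rw [mul_pow, ← Real.exp_nat_mul, ← Real.exp_nat_mul, Real.sqrt_eq_rpow,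
          Real.rpow_def_of_pos hn0]
        congr 2 <;> push_cast <;> ring
      rw [div_le_iff₀ (by linarith)]
      calc (Real.exp (-ρ) * n) ^ 2 ≤ (Real.exp 1 * Real.exp (1 / 4 * Real.log n)) ^ 2 := by gcongr
        _ = Real.exp 2 * Real.sqrt n := h4
        _ ≤ 8 * Real.sqrt n := by gcongr; exact exp_two_le
        _ = 16 / Real.sqrt n * (n / 2) := by
            rw [div_mul_eq_mul_div, eq_div_iff hr0.ne']; linarith
        _ ≤ _ := by gcongr; linarith
    · rw [div_le_one hr0]; exact hr16
  have hB : birthTime γ α k (M + 1) - 1 + 1 = birthTime γ α k (M + 1) := by omega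
  rw [hB] at h1
  have h2 := spreading_phase (γ := γ) (α := α) (op := op) (a := a) (i := M + 1)
    (t := birthTime γ α k (M + 1)) (h₀ := 1 - c) hn2 reg.l_nonneg
    (by rw [div_le_iff₀ hr0]; nlinarith) (by linarith)
    (by rw [sub_sub_cancel]; exact hl1)
    (by
      refine hl1.trans ?_
      rw [← mul_assoc]
      gcongr
      nlinarith) S
    (fun s hs => not_isTwoChoicesRound_after (by rw [← hM]; omega))
  rw [max_eq_right hS] at h2
  have h3 : Leads γ α op (Unanimous (M + 1) a (1 / Real.sqrt n)) (birthTime γ α k (M + 1) + S)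
      (fun s => ∀ v, (s v).col = a) (birthTime γ α k (M + 1) + S + 1) (3 * (1 / Real.sqrt n)) := by
    refine leads_step hn2 (fun s hs => ?_) (by positivity)
    refine final_round hn2 (not_isTwoChoicesRound_after (by rw [← hM]; omega)) hs (by positivity)
      (by rw [div_le_one hr0]; linarith) (le_of_eq ?_)
    calc (1 / Real.sqrt n) ^ 3 * n = (1 / Real.sqrt n) ^ 3 * (Real.sqrt n * Real.sqrt n) := by
          rw [hrr]
      _ = _ := by field_simp
  refine ((h1.trans hn2 h2).trans hn2 h3).mono hn2 (fun s h => h) (fun s h => h) (le_of_eq ?_)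
  ring

/-- Under the conditions of a schedule, all nodes soon hold the initially dominant opinion. -/
theorem Schedule.converges (sch : Schedule γ p l U κ α η ν e K n k M)
    (hM : M + 1 = numGenerations α n) {op : Fin n → Fin k} {a : Fin k} (hα : α = bias op a) (S : ℕ)
    (hn : 256 ≤ n) (hκ : 3 / 4 * Real.log n ≤ κ)
    (hk : (k : ℝ) * Real.exp (1 - 3 / 4 * Real.log n) ≤ 1)
    (hl1 : l ≤ (p * γ ^ 2 / 4) ^ 2 * Real.sqrt n)
    (hS : (1 - p * γ ^ 2 / 4) ^ 2 ^ S ≤ 1 / Real.sqrt n)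
    {T : ℝ} (hT : (birthTime γ α k (M + 1) + S + 1 : ℕ) ≤ T) :
    1 - ((birthTime γ α k (M + 1) + S + 1 : ℕ) * ((k + 2) * Real.exp (-l / 4))
        + (48 * k + 3) / Real.sqrt n)
      ≤ (samplingMeasure n).real {ω | ConvergedBy γ α op a T ω} := by
  have reg := sch.regime
  have hn2 : 2 ≤ n := by omega
  have h1 := (sch.generations hM op a M le_rfl).trans hn2
    (sch.ending hM op a S hn hκ hk hl1 hS)
  have := nonempty_samples hn2
  have : IsProbabilityMeasure (samplingMeasure n) := by rw [samplingMeasure]; infer_instance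
  unfold Leads at h1
  set δ := ((birthTime γ α k (M + 1) - 1 : ℕ) : ℝ) * ((k + 2) * Real.exp (-l / 4))
    + ((S + 2) * Real.exp (-l / 4) + (48 * k + 3) / Real.sqrt n) with hδ
  have h2 : (Set.univ : Set (ℕ → Samples n)) ⊆ {ω | ConvergedBy γ α op a T ω} ∪
      {ω | Dominates 0 a (Real.exp (-Real.log α)) γ (run γ α op ω 0) ∧
        ¬ ∀ v, (run γ α op ω (birthTime γ α k (M + 1) + S + 1) v).col = a} := by
    intro ω _
    by_cases h : ∀ v, (run γ α op ω (birthTime γ α k (M + 1) + S + 1) v).col = a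
    · left
      intro t ht v
      exact run_col_of_le h (by exact_mod_cast hT.trans ht) v
    · right
      exact ⟨dominates_run_zero hα sch.one_lt reg.γ_lt.le ω, h⟩
  have h3 := (measureReal_mono h2 (measure_ne_top (samplingMeasure n) _)).trans
    (measureReal_union_le _ _)
  rw [probReal_univ] at h3
  have hB1 : 1 ≤ birthTime γ α k (M + 1) := by unfold birthTime; omega
  have h4 : δ ≤ (birthTime γ α k (M + 1) + S + 1 : ℕ) * ((k + 2) * Real.exp (-l / 4))
        + (48 * k + 3) / Real.sqrt n := by
    have h5 : ((birthTime γ α k (M + 1) - 1 : ℕ) : ℝ) = birthTime γ α k (M + 1) - 1 := by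
      rw [Nat.cast_sub hB1, Nat.cast_one]
    rw [hδ, h5]
    have hE := Real.exp_pos (-l / 4)
    have h6 : ((S : ℝ) + 2) * Real.exp (-l / 4) ≤ (S + 2) * ((k + 2) * Real.exp (-l / 4)) := by
      gcongr
      exact le_mul_of_one_le_left hE.le (by
        have : (0 : ℝ) ≤ k := by positivity
        linarith)
    push_cast
    linarith
  linarith

end Ending

end Plurality

namespace Plurality

/-! ### Counting rounds and bounding losses -/

section Estimates

open Finset

variable {n k : ℕ} {γ α : ℝ}

/-- Common form of most largeness conditions on n; exponent a = 0 covers constants. -/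
theorem eventually_log_pow_le (C : ℝ) (a : ℕ) {s : ℝ} (hs : 0 < s) :
    ∀ᶠ n : ℕ in Filter.atTop, C * Real.log n ^ a ≤ (n : ℝ) ^ s := by
  have h1 := isLittleO_log_rpow_rpow_atTop (a : ℝ) hs
  have h2 := h1.bound (c := 1 / (|C| + 1)) (by positivity)
  have h3 := tendsto_natCast_atTop_atTop (R := ℝ) |>.eventually h2
  filter_upwards [h3, Filter.eventually_ge_atTop 1] with n hn hn1
  have hn1' : (1 : ℝ) ≤ n := by exact_mod_cast hn1
  have hlog : 0 ≤ Real.log n := Real.log_nonneg hn1'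
  rw [Real.rpow_natCast, Real.norm_of_nonneg (by positivity), Real.norm_of_nonneg (by positivity),
    one_div_mul_eq_div, le_div_iff₀ (by positivity)] at hn
  have h4 : 0 ≤ Real.log n ^ a := by positivity
  have h5 : C * Real.log n ^ a ≤ |C| * Real.log n ^ a := by gcongr; exact le_abs_self C
  linarith

theorem log_two_pos' : (0 : ℝ) < Real.log 2 := Real.log_pos (by norm_num)

/-- A life cycle is long only as long as the ideal bias `α ^ 2 ^ m` is smaller than `k`. -/
theorem neg_log_collision_le (hk : 2 ≤ k) (hα : 1 < α) (m : ℕ) :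
    -Real.log (collision k (α ^ 2 ^ m)⁻¹) ≤ 2 * Real.log 2
      + 2 * Real.log k * min 1 (max 0 (Real.logb 2 (Real.logb α k) - m)) := by
  have hk1 : 1 ≤ k := by omega
  have hk2 : (2 : ℝ) ≤ k := by exact_mod_cast hk
  have hk0 : (0 : ℝ) < k := by linarith
  have hα0 : 0 < α := by linarith
  have hlam : 0 < Real.log α := Real.log_pos hα
  have hlk : 0 < Real.log k := Real.log_pos (by linarith)
  set L := Real.logb 2 (Real.logb α k) with hL
  set w := 2 ^ m * Real.log α with hw
  have hw0 : 0 < w := by positivity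
  have hβ : (α ^ 2 ^ m)⁻¹ = Real.exp (-w) := by
    rw [Real.exp_neg, hw]
    congr 1
    rw [← Real.exp_log (show 0 < α ^ 2 ^ m by positivity), Real.log_pow]
    push_cast
    rfl
  have hmin : 0 ≤ min 1 (max 0 (L - m)) := le_min zero_le_one (le_max_left _ _)
  -- With x = L - m the ideal log-bias is log k·2^{-x}, and 1 - 2^{-x} ≤ x·log 2 ≤ x for x ≥ 0
  -- bounds its distance to log k.
  have hwL : w = Real.log k * Real.exp (-((L - m) * Real.log 2)) := by
    have h1 : 0 < Real.logb α k := by unfold Real.logb; positivity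
    have h2 : Real.exp (L * Real.log 2) = Real.logb α k := by
      rw [hL, Real.logb, div_mul_cancel₀ _ log_two_pos'.ne', Real.exp_log h1]
    have h3 : Real.exp ((m : ℝ) * Real.log 2) = 2 ^ m := by
      rw [Real.exp_nat_mul, Real.exp_log (by norm_num)]
    rw [show -((L - m) * Real.log 2) = m * Real.log 2 - L * Real.log 2 by ring, Real.exp_sub, h2,
      h3, Real.logb, hw]
    field_simp
  have h1 := collision_ge_of_le hk1 (Real.exp_pos (-w)).le le_rfl
  have hx : 0 < 1 + k * Real.exp (-w) := by positivity
  have h2 : -Real.log (collision k (α ^ 2 ^ m)⁻¹) ≤ 2 * Real.log (1 + k * Real.exp (-w)) := by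
    rw [hβ]
    have h3 := Real.log_le_log (by positivity) h1
    rw [one_div, Real.log_inv, Real.log_pow] at h3
    push_cast at h3
    linarith
  refine h2.trans ?_
  have hkw : k * Real.exp (-w) = Real.exp (Real.log k - w) := by
    rw [sub_eq_add_neg, Real.exp_add, Real.exp_log hk0]
  rcases le_total (Real.log k) w with h | h
  · have h3 : k * Real.exp (-w) ≤ 1 := by
      rw [hkw]; exact Real.exp_le_one_iff.2 (by linarith)
    have h4 : Real.log (1 + k * Real.exp (-w)) ≤ Real.log 2 := Real.log_le_log hx (by linarith)
    have h5 : 0 ≤ 2 * Real.log k * min 1 (max 0 (L - m)) := by positivity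
    linarith
  · have h3 : 1 ≤ k * Real.exp (-w) := by
      rw [hkw]; exact Real.one_le_exp (by linarith)
    have h4 : Real.log (1 + k * Real.exp (-w)) ≤ Real.log 2 + (Real.log k - w) := by
      have : Real.log (1 + k * Real.exp (-w)) ≤ Real.log (2 * (k * Real.exp (-w))) :=
        Real.log_le_log hx (by linarith)
      rw [Real.log_mul (by norm_num) (by positivity)] at this
      have hexp : Real.log (k * Real.exp (-w)) = Real.log k - w := by rw [hkw, Real.log_exp]
      linarith
    have h5 : Real.log k - w ≤ Real.log k * min 1 (max 0 (L - m)) := by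
      rw [mul_min_of_nonneg _ _ hlk.le]
      refine le_min (by linarith) ?_
      have h6 := Real.add_one_le_exp (-((L - m) * Real.log 2))
      have h7 : Real.log k - w ≤ Real.log k * ((L - m) * Real.log 2) := by
        rw [hwL]; nlinarith
      have h9 : 0 ≤ L - m := by
        by_contra hc
        have : Real.log k * ((L - m) * Real.log 2) < 0 :=
          mul_neg_of_pos_of_neg hlk (mul_neg_of_neg_of_pos (not_le.1 hc) log_two_pos')
        linarith
      refine h7.trans ?_
      gcongr
      have := Real.log_two_lt_d9
      calc (L - m) * Real.log 2 ≤ (L - m) * 1 := by gcongr; linarith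
        _ ≤ _ := by rw [mul_one]; exact le_max_right _ _
    linarith

/-- Summing the truncated linear terms avoids rounding L up: an extra 1 would cost log k further
rounds, which the claimed time does not contain when L is small. The induction runs on the sharper
bound min(M, max(0, L)). -/
theorem sum_min_one_le (L : ℝ) (M : ℕ) :
    ∑ m ∈ range M, min 1 (max 0 (L - m)) ≤ max 0 L := by
  have : ∑ m ∈ range M, min 1 (max 0 (L - m)) ≤ min (M : ℝ) (max 0 L) := by
    induction M with
    | zero => simp
    | succ M ih =>
      rw [sum_range_succ]
      push_cast
      refine le_min ?_ ?_
      · linarith [min_le_left (M : ℝ) (max 0 L), min_le_left 1 (max 0 (L - M))]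
      · rcases le_total (L - M) 0 with h | h
        · rw [max_eq_left h, min_eq_right zero_le_one]
          linarith [min_le_right (M : ℝ) (max 0 L)]
        · rw [max_eq_right h]
          linarith [min_le_left (M : ℝ) (max 0 L), min_le_right 1 (L - M), le_max_right 0 L]
  exact this.trans (min_le_right _ _)

theorem exists_ceil_lifeCycle_le (hγ0 : 0 < γ) (hγ1 : γ < 1) : ∃ C : ℝ, 1 ≤ C ∧
    ∀ (k : ℕ) (α : ℝ) (m : ℕ), 2 ≤ k → 1 < α → (⌈lifeCycle γ α k (m + 1)⌉₊ : ℝ)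
      ≤ C * (1 + Real.log k * min 1 (max 0 (Real.logb 2 (Real.logb α k) - m))) := by
  have hq : 0 < Real.log (2 - γ) := Real.log_pos (by linarith)
  have hγl : 0 ≤ -Real.log γ := by linarith [Real.log_nonpos hγ0.le hγ1.le]
  have h2 := log_two_pos'
  refine ⟨(-Real.log γ + 2 * Real.log 2) / Real.log (2 - γ) + 3 + 2 / Real.log (2 - γ), ?_, ?_⟩
  · have : 0 ≤ (-Real.log γ + 2 * Real.log 2) / Real.log (2 - γ) := by positivity
    have : 0 ≤ 2 / Real.log (2 - γ) := by positivity
    linarith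
  · intro k α m hk hα
    have hk1 : 1 ≤ k := by omega
    have hc := neg_log_collision_le hk hα m
    have hX := lifeCycle_succ hγ0 hk1 hα.le m
    have hX2 := two_le_lifeCycle hγ0 hγ1 hk1 hα.le m
    have hceil := (Nat.ceil_lt_add_one (by linarith : 0 ≤ lifeCycle γ α k (m + 1))).le
    set μ := min 1 (max 0 (Real.logb 2 (Real.logb α k) - m)) with hμ
    have hμ0 : 0 ≤ μ := le_min zero_le_one (le_max_left _ _)
    have hlk : 0 ≤ Real.log k := Real.log_nonneg (by exact_mod_cast hk1)
    have hcp : 0 < collision k (α ^ 2 ^ m)⁻¹ := collision_pos hk1 (by positivity)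
    rw [Real.log_mul hγ0.ne' hcp.ne'] at hX
    have h3 : -(Real.log γ + Real.log (collision k (α ^ 2 ^ m)⁻¹)) / Real.log (2 - γ)
        ≤ (-Real.log γ + 2 * Real.log 2 + 2 * Real.log k * μ) / Real.log (2 - γ) := by
      gcongr
      linarith
    have h4 : (-Real.log γ + 2 * Real.log 2 + 2 * Real.log k * μ) / Real.log (2 - γ)
        = (-Real.log γ + 2 * Real.log 2) / Real.log (2 - γ)
          + 2 / Real.log (2 - γ) * (Real.log k * μ) := by ring
    have h5 : 0 ≤ Real.log k * μ := by positivity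
    have h6 : 0 ≤ (-Real.log γ + 2 * Real.log 2) / Real.log (2 - γ) := by positivity
    have h7 : 0 ≤ 2 / Real.log (2 - γ) := by positivity
    have h8 : 0 ≤ (-Real.log γ + 2 * Real.log 2) / Real.log (2 - γ) * (Real.log k * μ) := by
      positivity
    linarith [show ((-Real.log γ + 2 * Real.log 2) / Real.log (2 - γ) + 3 + 2 / Real.log (2 - γ))
      * (1 + Real.log k * μ) = (-Real.log γ + 2 * Real.log 2) / Real.log (2 - γ) + 3
        + 2 / Real.log (2 - γ) + (-Real.log γ + 2 * Real.log 2) / Real.log (2 - γ)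
          * (Real.log k * μ) + 3 * (Real.log k * μ) + 2 / Real.log (2 - γ) * (Real.log k * μ)
      by ring]

theorem birthTime_le {C : ℝ} (hC : 0 ≤ C) (hk : 1 ≤ k) (M : ℕ)
    (h : ∀ m : ℕ, (⌈lifeCycle γ α k (m + 1)⌉₊ : ℝ)
      ≤ C * (1 + Real.log k * min 1 (max 0 (Real.logb 2 (Real.logb α k) - m)))) :
    (birthTime γ α k (M + 1) : ℝ)
      ≤ 1 + C * (M + Real.log k * max 0 (Real.logb 2 (Real.logb α k))) := by
  have hlk : 0 ≤ Real.log k := Real.log_nonneg (by exact_mod_cast hk)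
  unfold birthTime
  rw [sum_Ico_eq_sum_range]
  push_cast
  have h1 : ∑ m ∈ range (M + 1 - 1), (⌈lifeCycle γ α k (1 + m)⌉₊ : ℝ)
      ≤ ∑ m ∈ range M, C * (1 + Real.log k * min 1 (max 0 (Real.logb 2 (Real.logb α k) - m))) := by
    rw [Nat.add_sub_cancel]
    refine sum_le_sum fun m _ => ?_
    rw [add_comm 1 m]
    exact h m
  rw [← mul_sum, sum_add_distrib, ← mul_sum, sum_const, card_range, nsmul_eq_mul, mul_one,
    Nat.add_sub_cancel] at h1
  have h2 := sum_min_one_le (Real.logb 2 (Real.logb α k)) M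
  have h3 : C * (M + Real.log k * ∑ m ∈ range M, min 1 (max 0 (Real.logb 2 (Real.logb α k) - m)))
      ≤ C * (M + Real.log k * max 0 (Real.logb 2 (Real.logb α k))) := by gcongr
  linarith

theorem one_le_logb_two {x : ℝ} (hx : 2 ≤ x) : 1 ≤ Real.logb 2 x := by
  rw [Real.le_logb_iff_rpow_le (by norm_num) (by linarith)]
  simpa using hx

/-- log_α n = log_α k · log_k n, and log_k n ≤ log₂ n because k ≥ 2. -/
theorem logb_logb_le (hk : 2 ≤ k) (hn : 2 ≤ n) (hα : 1 < α) :
    Real.logb 2 (Real.logb α n)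
      ≤ max 0 (Real.logb 2 (Real.logb α k)) + Real.logb 2 (Real.logb 2 n) := by
  have hk2 : (2 : ℝ) ≤ k := by exact_mod_cast hk
  have hn2 : (2 : ℝ) ≤ n := by exact_mod_cast hn
  have hlam : 0 < Real.log α := Real.log_pos hα
  have hlk : 0 < Real.log k := Real.log_pos (by linarith)
  have hln : 0 < Real.log n := Real.log_pos (by linarith)
  have hl2 := log_two_pos'
  have h1 : Real.logb α n ≤ Real.logb α k * Real.logb 2 n := by
    unfold Real.logb
    rw [div_mul_div_comm, div_le_div_iff₀ hlam (by positivity)]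
    have : Real.log 2 ≤ Real.log k := Real.log_le_log (by norm_num) hk2
    calc Real.log n * (Real.log α * Real.log 2) ≤ Real.log n * (Real.log α * Real.log k) := by
          gcongr
      _ = _ := by ring
  have h2 : 0 < Real.logb α k := by unfold Real.logb; positivity
  have h3 : 0 < Real.logb α n := by unfold Real.logb; positivity
  have h4 : 0 < Real.logb 2 n := by unfold Real.logb; positivity
  calc Real.logb 2 (Real.logb α n) ≤ Real.logb 2 (Real.logb α k * Real.logb 2 n) :=
        Real.logb_le_logb_of_le (by norm_num) h3 h1
    _ = Real.logb 2 (Real.logb α k) + Real.logb 2 (Real.logb 2 n) :=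
        Real.logb_mul h2.ne' h4.ne'
    _ ≤ _ := by gcongr; exact le_max_right _ _

theorem natCeil_le_of_le {x y : ℝ} (hy : 0 ≤ y) (h : x ≤ y) : (⌈x⌉₊ : ℝ) ≤ y + 1 := by
  have h1 : ⌈x⌉₊ ≤ ⌈y⌉₊ := Nat.ceil_le_ceil h
  have h2 := (Nat.ceil_lt_add_one hy).le
  have h3 : (⌈x⌉₊ : ℝ) ≤ ⌈y⌉₊ := by exact_mod_cast h1
  linarith

/-- The number of rounds in which a fraction `h` decays below `1 / √n` by repeated squaring. -/
theorem exists_squaring_rounds {h : ℝ} (h0 : 0 < h) (h1 : h < 1) : ∃ C : ℝ, 0 ≤ C ∧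
    ∀ n : ℕ, 4 ≤ n → ∃ S : ℕ, (S : ℝ) ≤ Real.logb 2 (Real.logb 2 n) + C ∧
      h ^ 2 ^ S ≤ 1 / Real.sqrt n := by
  have hlh : 0 < -Real.log h := by linarith [Real.log_neg h0 h1]
  have hl2 := log_two_pos'
  refine ⟨|Real.logb 2 (-Real.log h)| + 1, by positivity, fun n hn => ?_⟩
  have hn4 : (4 : ℝ) ≤ n := by exact_mod_cast hn
  have hn0 : (0 : ℝ) < n := by linarith
  have hln : 0 < Real.log n := Real.log_pos (by linarith)
  have hb : 1 ≤ Real.logb 2 n := one_le_logb_two (by linarith)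
  set x := Real.logb 2 (Real.log n / 2 / (-Real.log h)) with hx
  refine ⟨⌈x⌉₊, ?_, ?_⟩
  · have h3 : x ≤ Real.logb 2 (Real.logb 2 n) + |Real.logb 2 (-Real.log h)| := by
      rw [hx, Real.logb_div (by positivity) hlh.ne']
      have h4 : Real.logb 2 (Real.log n / 2) ≤ Real.logb 2 (Real.logb 2 n) := by
        apply Real.logb_le_logb_of_le (by norm_num) (by positivity)
        unfold Real.logb
        gcongr
        linarith [Real.log_two_lt_d9]
      linarith [neg_abs_le (Real.logb 2 (-Real.log h))]
    have h5 : 0 ≤ Real.logb 2 (Real.logb 2 n) + |Real.logb 2 (-Real.log h)| := by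
      have : 0 ≤ Real.logb 2 (Real.logb 2 n) := Real.logb_nonneg (by norm_num) hb
      positivity
    linarith [natCeil_le_of_le h5 h3]
  · have h3 : x ≤ ⌈x⌉₊ := Nat.le_ceil x
    rw [hx, Real.logb_le_iff_le_rpow (by norm_num) (by positivity), Real.rpow_natCast,
      div_le_iff₀ hlh, ← hx] at h3
    have hr : 0 < Real.sqrt n := Real.sqrt_pos.2 hn0
    rw [← Real.log_le_log_iff (by positivity) (by positivity), Real.log_pow, one_div,
      Real.log_inv, Real.log_sqrt hn0.le]
    push_cast
    linarith

/-- The number S of rounds is O(log k), hence O(√k); with the √k in √(l·k/n) this gives a factor k.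
All other terms are of that order as well. -/
theorem exists_cycleLoss_le {p C : ℝ} (hγ0 : 0 < γ) (hp0 : 0 < p) (hp1 : p < 1) (hC : 0 ≤ C) :
    ∃ D : ℝ, 0 < D ∧ ∀ n k S : ℕ, 3 ≤ n → 2 ≤ k → (S : ℝ) ≤ C * (1 + Real.log k) →
      cycleLoss γ p (16 * Real.log n) n k S ≤ D * (k * Real.sqrt (Real.log n / n)) := by
  have he := Real.exp_pos 1
  have hp' : 0 < 1 - p := by linarith
  have hsγ : 0 < Real.sqrt γ := Real.sqrt_pos.2 hγ0
  set P := Real.sqrt (p * γ ^ 2) with hP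
  have hP0 : 0 < P := Real.sqrt_pos.2 (by positivity)
  refine ⟨2 + 3 * Real.exp 1 * (12 / γ)
    + 3 * Real.exp 1 * 6 * (C * 3 / Real.sqrt γ + 1 / P / (1 - p)), by positivity, ?_⟩
  intro n k S hn hk hS
  have hn3 : (3 : ℝ) ≤ n := by exact_mod_cast hn
  have hn0 : (0 : ℝ) < n := by linarith
  have hk2 : (2 : ℝ) ≤ k := by exact_mod_cast hk
  have hk0 : (0 : ℝ) < k := by linarith
  have hlog1 : 1 ≤ Real.log n := by
    rw [Real.le_log_iff_exp_le hn0]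
    linarith [Real.exp_one_lt_d9]
  set y := Real.sqrt (Real.log n / n) with hy
  have hy0 : 0 ≤ y := Real.sqrt_nonneg _
  have hny : 1 / (n : ℝ) ≤ y := by
    apply Real.le_sqrt_of_sq_le
    rw [div_pow, one_pow, div_le_div_iff₀ (by positivity) hn0]
    nlinarith
  have h1 : Real.sqrt (8 * (16 * Real.log n) / n) ≤ 12 * y := by
    rw [show 8 * (16 * Real.log n) / n = 128 * (Real.log n / n) by ring,
      Real.sqrt_mul (by norm_num), ← hy]
    gcongr
    rw [Real.sqrt_le_left (by norm_num)]; norm_num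
  set r := Real.sqrt k with hr
  have hrr : r * r = k := Real.mul_self_sqrt hk0.le
  have hr1 : 1 ≤ r := by
    apply Real.le_sqrt_of_sq_le; linarith
  have h2 : Real.sqrt (2 * (16 * Real.log n) * k / n) ≤ 6 * y * r := by
    rw [show 2 * (16 * Real.log n) * k / n = 32 * (Real.log n / n) * k by ring,
      Real.sqrt_mul (by positivity), Real.sqrt_mul (by norm_num), ← hy, ← hr]
    gcongr
    rw [Real.sqrt_le_left (by norm_num)]; norm_num
  have h3 : Real.sqrt (k / (p * γ ^ 2)) = r / P := by
    rw [Real.sqrt_div hk0.le]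
  have h4 : (S : ℝ) ≤ C * 3 * r := by
    have h5 : Real.log k = 2 * Real.log r := by
      rw [← hrr, Real.log_mul (by positivity) (by positivity)]; ring
    have h6 : Real.log r ≤ r - 1 := Real.log_le_sub_one_of_pos (by linarith)
    calc (S : ℝ) ≤ C * (1 + Real.log k) := hS
      _ ≤ C * (3 * r) := by gcongr; linarith
      _ = _ := by ring
  unfold cycleLoss
  rw [h3]
  have t1 : 2 / (n : ℝ) ≤ 2 * (k * y) := by
    have : 1 * y ≤ k * y := by gcongr; linarith
    rw [show 2 / (n : ℝ) = 2 * (1 / n) by ring]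
    linarith
  have t2 : Real.sqrt (8 * (16 * Real.log n) / n) * k / γ ≤ 12 / γ * (k * y) := by
    calc _ ≤ 12 * y * k / γ := by gcongr
      _ = _ := by ring
  have t3 : Real.sqrt (2 * (16 * Real.log n) * k / n)
      * (S / Real.sqrt γ + r / P / (1 - p))
      ≤ 6 * (C * 3 / Real.sqrt γ + 1 / P / (1 - p)) * (k * y) := by
    calc _ ≤ 6 * y * r * (C * 3 * r / Real.sqrt γ + r / P / (1 - p)) := by gcongr
      _ = 6 * (C * 3 / Real.sqrt γ + 1 / P / (1 - p)) * (r * r * y) := by ring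
      _ = _ := by rw [hrr]
  calc _ = 2 / (n : ℝ) + 3 * Real.exp 1 * (Real.sqrt (8 * (16 * Real.log n) / n) * k / γ)
        + 3 * Real.exp 1 * (Real.sqrt (2 * (16 * Real.log n) * k / n)
          * (S / Real.sqrt γ + r / P / (1 - p))) := by ring
    _ ≤ 2 * (k * y) + 3 * Real.exp 1 * (12 / γ * (k * y))
        + 3 * Real.exp 1 * (6 * (C * 3 / Real.sqrt γ + 1 / P / (1 - p)) * (k * y)) := by gcongr
    _ = _ := by ring

end Estimates

end Plurality

namespace Plurality

/-! ### Choice of parameters for large n -/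

section Asymptotics

open Finset

variable {n k : ℕ} {γ α ε θ p : ℝ}

theorem sqrt_div_le_of_mul_le {l U z : ℝ} (hU : 0 < U) (hz : 0 < z) (h : l * (1 / z ^ 2) ≤ U) :
    Real.sqrt (l / U) ≤ z := by
  rw [Real.sqrt_le_left hz.le, div_le_iff₀ hU]
  rw [mul_one_div, div_le_iff₀ (by positivity)] at h
  linarith

/-- As 1 - 2ε = 8θ, both n^θ·k² and n^θ·e^κ are at most n^{1-θ}; the remaining factor n^θ outweighs
the constant 8/(pγ²). -/
theorem regime_of_large (hγ0 : 0 < γ) (hγ1 : γ < 1) (hp0 : 0 < p) (hp : p ^ 2 * (2 - γ) = 1)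
    (hθ : θ = (1 - 2 * ε) / 8) (hε0 : 0 < ε) (hε : ε < 1 / 2) (hk : 2 ≤ k)
    (hkn : (k : ℝ) ≤ (n : ℝ) ^ ε) (hn : 4 ≤ n) (h1 : 72 * (16 * Real.log n) ≤ (n : ℝ) ^ θ)
    (h2 : 8 / (p * γ ^ 2) ≤ (n : ℝ) ^ θ)
    (h3 : Real.sqrt (16 * Real.log n / (n : ℝ) ^ θ) ≤ (1 - γ) ^ 2 / 3)
    (h4 : Real.sqrt (16 * Real.log n / (n : ℝ) ^ θ) ≤ (1 - p) / 2)
    (h5 : 2 / (1 - p) + 1 ≤ (n : ℝ)) :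
    Regime γ p (16 * Real.log n) ((n : ℝ) ^ θ) ((1 - 2 * θ) * Real.log n) n k := by
  have hn4 : (4 : ℝ) ≤ n := by exact_mod_cast hn
  have hn0 : (0 : ℝ) < n := by linarith
  have hn1 : (1 : ℝ) ≤ n := by linarith
  have hp1 : p < 1 := by
    by_contra h
    have : 1 ≤ p ^ 2 := one_le_pow₀ (not_lt.1 h)
    nlinarith
  have hexp : Real.exp ((1 - 2 * θ) * Real.log n) = (n : ℝ) ^ (1 - 2 * θ) := by
    rw [Real.rpow_def_of_pos hn0, mul_comm]
  have hU0 : 0 < (n : ℝ) ^ θ := Real.rpow_pos_of_pos hn0 _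
  have hθ0 : 0 < θ := by rw [hθ]; linarith
  have hθ1 : θ ≤ 1 / 8 := by rw [hθ]; linarith
  have hpγ : 0 < p * γ ^ 2 := by positivity
  rw [div_le_iff₀ hpγ] at h2
  have hmain : ∀ s : ℝ, s ≤ 1 - 2 * θ → 8 * (n : ℝ) ^ θ * (n : ℝ) ^ s ≤ p * γ ^ 2 * n := by
    intro s hs
    calc 8 * (n : ℝ) ^ θ * (n : ℝ) ^ s ≤ ((n : ℝ) ^ θ * (p * γ ^ 2)) * (n : ℝ) ^ θ * (n : ℝ) ^ s := by
          gcongr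
      _ = p * γ ^ 2 * ((n : ℝ) ^ (θ + θ + s)) := by
          rw [Real.rpow_add hn0, Real.rpow_add hn0]; ring
      _ ≤ p * γ ^ 2 * (n : ℝ) ^ (1 : ℝ) := by
          gcongr
          linarith
      _ = _ := by rw [Real.rpow_one]
  refine ⟨hγ0, hγ1, hp0, hp, hk, hn, by have := Real.log_nonneg hn1; positivity, hU0, h1, ?_, ?_,
    ?_, ?_, ?_⟩
  · refine le_trans ?_ (hmain (ε + ε) (by rw [hθ]; linarith))
    rw [Real.rpow_add hn0, ← sq]
    gcongr
  · rw [hexp]; exact hmain _ le_rfl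
  · rw [hexp]
    refine hkn.trans (Real.rpow_le_rpow_of_exponent_le hn1 (by rw [hθ]; linarith))
  · have : 0 ≤ 3 - 3 * γ + γ ^ 2 := by nlinarith
    have h6 : (3 - 3 * γ + γ ^ 2) * Real.sqrt (16 * Real.log n / (n : ℝ) ^ θ)
        ≤ 3 * ((1 - γ) ^ 2 / 3) := by
      gcongr
      nlinarith
    nlinarith
  -- Two relative losses of at most (1 - p)/2 each leave a factor of at least p.
  · have hp' : 0 < 1 - p := by linarith
    have h6 : 1 / ((n : ℝ) - 1) ^ 2 ≤ (1 - p) / 2 := by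
      have h7 : 2 / (1 - p) ≤ (n : ℝ) - 1 := by linarith
      rw [div_le_iff₀ hp'] at h7
      rw [div_le_div_iff₀ (by nlinarith) (by norm_num)]
      nlinarith
    have h8 : 0 ≤ 1 / ((n : ℝ) - 1) ^ 2 := by positivity
    have h9 := Real.sqrt_nonneg (16 * Real.log n / (n : ℝ) ^ θ)
    nlinarith [mul_nonneg h8 h9]

theorem half_le_log_of_one_add_lt {δ : ℝ} (h0 : 0 ≤ δ) (h1 : δ ≤ 1) (h : 1 + δ < α) :
    δ / 2 ≤ Real.log α := by
  have h2 : Real.log (1 + δ) ≤ Real.log α := Real.log_le_log (by linarith) h.le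
  have h3 := Real.one_sub_inv_le_log_of_pos (show 0 < 1 + δ by linarith)
  have h4 : δ / 2 ≤ 1 - (1 + δ)⁻¹ := by
    have : 1 - (1 + δ)⁻¹ = δ / (1 + δ) := by field_simp; ring
    rw [this]
    gcongr
    linarith
  linarith

/-- The constant `K` of a schedule, and the accuracy `ζ` with which the bias has to be known. -/
theorem exists_bias_thresholds (hp0 : 0 < p) (hp1 : p < 1) : ∃ ξ K ζ : ℝ, 0 < ξ ∧ 0 < ζ ∧
    ζ ≤ 1 / 8 ∧ p * (1 + ξ) ^ 2 ≤ 1 ∧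
    (∀ k : ℕ, 2 ≤ k → k * Real.exp (-(K / 2 * Real.log k)) ≤ ξ) ∧
    (∀ x : ℝ, x ≤ ζ → p * Real.exp (2 * x * K) ≤ 1) := by
  have hs0 : 0 < Real.sqrt p := Real.sqrt_pos.2 hp0
  have hs1 : Real.sqrt p < 1 := by
    rw [Real.sqrt_lt' one_pos]; simpa using hp1
  have hξ : 0 < 1 / Real.sqrt p - 1 := by
    rw [sub_pos, lt_div_iff₀ hs0]; linarith
  set ξ := 1 / Real.sqrt p - 1 with hξdef
  have hl2 := log_two_pos'
  have hlp : 0 < -Real.log p := by linarith [Real.log_neg hp0 hp1]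
  set K := 2 * (1 + |Real.log ξ| / Real.log 2) with hK
  have hK0 : 0 < K := by positivity
  refine ⟨ξ, K, min (1 / 8) (-Real.log p / (2 * K)), hξ, by positivity, min_le_left _ _, ?_,
    ?_, ?_⟩
  · have : 1 + ξ = 1 / Real.sqrt p := by rw [hξdef]; ring
    rw [this, div_pow, Real.sq_sqrt hp0.le]
    apply le_of_eq
    field_simp
  · intro k hk
    have hk2 : (2 : ℝ) ≤ k := by exact_mod_cast hk
    have hk0 : (0 : ℝ) < k := by linarith
    have hlk : Real.log 2 ≤ Real.log k := Real.log_le_log (by norm_num) hk2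
    have h1 : k * Real.exp (-(K / 2 * Real.log k)) = Real.exp ((1 - K / 2) * Real.log k) := by
      nth_rewrite 1 [← Real.exp_log hk0]
      rw [← Real.exp_add]
      congr 1
      ring
    rw [h1, ← Real.exp_log hξ, Real.exp_le_exp]
    have h2 : 1 - K / 2 = -(|Real.log ξ| / Real.log 2) := by rw [hK]; ring
    rw [h2]
    have h3 : |Real.log ξ| / Real.log 2 * Real.log 2 ≤ |Real.log ξ| / Real.log 2 * Real.log k := by
      gcongr
    rw [div_mul_cancel₀ _ hl2.ne'] at h3
    linarith [neg_abs_le (Real.log ξ)]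
  · intro x hx
    have h1 : x ≤ -Real.log p / (2 * K) := hx.trans (min_le_right _ _)
    rw [le_div_iff₀ (by positivity)] at h1
    have h2 : Real.exp (2 * x * K) ≤ 1 / p := by
      rw [← Real.le_log_iff_exp_le (by positivity), one_div, Real.log_inv]
      linarith
    rw [le_div_iff₀ hp0] at h2
    linarith

theorem logb_two_le {x : ℝ} (hx : 1 ≤ x) : Real.logb 2 x ≤ 2 * Real.log x := by
  have h1 := Real.log_nonneg hx
  have h2 := Real.log_two_gt_d9
  unfold Real.logb
  rw [div_le_iff₀ log_two_pos']
  nlinarith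

theorem log_le_logb_two {x : ℝ} (hx : 1 ≤ x) : Real.log x ≤ Real.logb 2 x := by
  have h1 := Real.log_nonneg hx
  have h2 := Real.log_two_lt_d9
  unfold Real.logb
  rw [le_div_iff₀ log_two_pos']
  nlinarith

-- The witness is η = M·ν + e/log α, and what is needed is η·log k ≤ ζ. The part from ν is a power
-- of log n times n^{-θ/2}. In the other part e = O(k√(log n / n)), while log α is at least half of
-- k·log₂ n·log₂ k/√n, so (e/log α)·log k = O(1/√(log n)). Both logarithmic factors of the bias
-- hypothesis are spent here.
set_option maxHeartbeats 1000000 in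
theorem schedule_of_large {κ U C₁ D ξ K ζ δ : ℝ} {M : ℕ}
    (reg : Regime γ p (16 * Real.log n) U κ n k)
    (hC₁ : 1 ≤ C₁) (hlife : ∀ (k : ℕ) (α : ℝ) (m : ℕ), 2 ≤ k → 1 < α →
      (⌈lifeCycle γ α k (m + 1)⌉₊ : ℝ)
        ≤ C₁ * (1 + Real.log k * min 1 (max 0 (Real.logb 2 (Real.logb α k) - m))))
    (hD0 : 0 < D) (hD : ∀ n k S : ℕ, 3 ≤ n → 2 ≤ k → (S : ℝ) ≤ C₁ * (1 + Real.log k) →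
      cycleLoss γ p (16 * Real.log n) n k S ≤ D * (k * Real.sqrt (Real.log n / n)))
    (hζ0 : 0 < ζ) (hζ : ζ ≤ 1 / 8) (hξp : p * (1 + ξ) ^ 2 ≤ 1)
    (hξK : k * Real.exp (-(K / 2 * Real.log k)) ≤ ξ)
    (hKζ : ∀ x : ℝ, x ≤ ζ → p * Real.exp (2 * x * K) ≤ 1)
    (hδ : δ = k * Real.logb 2 n / Real.sqrt n * Real.logb 2 k) (hδ1 : δ ≤ 1)
    (hα : 1 + δ < α) (hkn : (k : ℝ) ≤ n) (hn6 : 6 ≤ Real.log n)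
    (hM : (M : ℝ) ≤ 7 * Real.log n)
    (hz : 84 * C₁ * Real.log n ^ 3 * Real.sqrt (16 * Real.log n / U) ≤ ζ)
    (hDζ : 4 * D ≤ ζ * Real.sqrt (Real.log n))
    (hDn : D * (k * Real.sqrt (Real.log n / n)) ≤ 1 / 2)
    (hκ4 : 4 ≤ κ) (hκn : κ ≤ Real.log n) (hκξ : k * Real.exp (1 - κ) ≤ ξ) :
    ∃ η ν e : ℝ, Schedule γ p (16 * Real.log n) U κ α η ν e K n k M := by
  have hk2 : (2 : ℝ) ≤ k := by exact_mod_cast reg.two_le_k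
  have hk1 : (1 : ℝ) ≤ k := by linarith
  have hn4 : (4 : ℝ) ≤ n := by exact_mod_cast reg.four_le_n
  have hn0 : (0 : ℝ) < n := by linarith
  have hr0 : 0 < Real.sqrt n := Real.sqrt_pos.2 hn0
  have hp0 := reg.p_pos
  have hl2 := log_two_pos'
  have hlk : Real.log 2 ≤ Real.log k := Real.log_le_log (by norm_num) hk2
  have hlk0 : 0 < Real.log k := by linarith
  have hlkn : Real.log k ≤ Real.log n := Real.log_le_log (by linarith) hkn
  have hbk : 1 ≤ Real.logb 2 k := one_le_logb_two hk2
  have hbn : Real.log n ≤ Real.logb 2 n := log_le_logb_two (by linarith)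
  have hbk' : Real.log k ≤ Real.logb 2 k := log_le_logb_two hk1
  have hbn0 : 0 < Real.logb 2 n := by linarith
  have hδ0 : 0 < δ := by rw [hδ]; positivity
  have hα1 : 1 < α := by linarith
  have hlam := half_le_log_of_one_add_lt hδ0.le hδ1 hα
  have hlam0 : 0 < Real.log α := by linarith
  set z := Real.sqrt (16 * Real.log n / U) with hzdef
  have hz0 : 0 ≤ z := Real.sqrt_nonneg _
  set y := Real.log n with hy
  set e := D * (k * Real.sqrt (y / n)) with he
  have he0 : 0 ≤ e := by positivity
  set ν := 3 * z * (C₁ * (1 + y)) with hν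
  have hν0 : 0 ≤ ν := by positivity
  have hν1 : ν ≤ 6 * C₁ * y * z := by
    have : 3 * z * (C₁ * (1 + y)) ≤ 3 * z * (C₁ * (y + y)) := by gcongr; linarith
    rw [hν]; linarith
  have hyν : 14 * y ^ 2 * ν ≤ ζ := by
    calc 14 * y ^ 2 * ν ≤ 14 * y ^ 2 * (6 * C₁ * y * z) := by gcongr
      _ = 84 * C₁ * y ^ 3 * z := by ring
      _ ≤ ζ := hz
  have hyν' : y * ν ≤ ζ / 14 := by
    have h1 : y * ν ≤ y ^ 2 * ν := by gcongr; nlinarith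
    linarith
  have hνs : ν ≤ ζ / 14 := by
    have : 1 * ν ≤ y * ν := by gcongr; linarith
    linarith
  have heta : e / Real.log α * Real.log k ≤ ζ / 2 := by
    have h1 : e / Real.log α ≤ e / (δ / 2) := by gcongr
    have h2 : Real.sqrt y * Real.sqrt y = y := Real.mul_self_sqrt (by linarith)
    have hsy : 0 < Real.sqrt y := Real.sqrt_pos.2 (by linarith)
    have h3 : e / (δ / 2) * Real.log k ≤ 2 * D / Real.sqrt y := by
      rw [he, Real.sqrt_div (by linarith), hδ]
      have h4 : D * (k * (Real.sqrt y / Real.sqrt n))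
          / (k * Real.logb 2 n / Real.sqrt n * Real.logb 2 k / 2) * Real.log k
          = 2 * D * (Real.sqrt y / Real.logb 2 n) * (Real.log k / Real.logb 2 k) := by
        field_simp
      rw [h4]
      have h5 : Real.log k / Real.logb 2 k ≤ 1 := by rw [div_le_one (by linarith)]; exact hbk'
      have h6 : Real.sqrt y / Real.logb 2 n ≤ 1 / Real.sqrt y := by
        rw [div_le_div_iff₀ hbn0 hsy, h2]; linarith
      calc _ ≤ 2 * D * (1 / Real.sqrt y) * 1 := by gcongr
        _ = _ := by ring
    have h7 : 2 * D / Real.sqrt y ≤ ζ / 2 := by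
      rw [div_le_iff₀ hsy]; linarith
    calc e / Real.log α * Real.log k ≤ e / (δ / 2) * Real.log k := by gcongr
      _ ≤ _ := h3.trans h7
  have hη : (M * ν + e / Real.log α) * Real.log k ≤ ζ := by
    have h1 : M * ν * Real.log k ≤ 7 * y * ν * y := by gcongr
    linarith [show 7 * y * ν * y = 14 * y ^ 2 * ν / 2 by ring]
  have hηnn : 0 ≤ M * ν + e / Real.log α := by positivity
  have hXle : ∀ m : ℕ, (⌈lifeCycle γ α k (m + 1)⌉₊ : ℝ) ≤ C₁ * (1 + Real.log k) := by
    intro m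
    refine (hlife k α m reg.two_le_k hα1).trans ?_
    have : Real.log k * min 1 (max 0 (Real.logb 2 (Real.logb α k) - m)) ≤ Real.log k * 1 := by
      gcongr
      exact min_le_left _ _
    gcongr
    linarith
  refine ⟨M * ν + e / Real.log α, ν, e, ⟨reg, hα1, hν0, he0, ?_, ?_, ?_, ?_, by linarith, hDn, ?_,
    hκ4, ?_, ?_, ?_⟩⟩
  · intro m _
    rw [hν]
    gcongr
    refine (hXle m).trans ?_
    gcongr
  · intro m _
    refine hD n k _ (by have := reg.four_le_n; omega) reg.two_le_k (le_trans ?_ (hXle m))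
    exact_mod_cast Nat.sub_le _ _
  · apply le_of_eq; field_simp
  · have h1 : (M * ν + e / Real.log α) * Real.log 2 ≤ ζ :=
      le_trans (by gcongr) hη
    nlinarith [Real.log_two_gt_d9]
  · have h1 : κ * ν ≤ y * ν := by gcongr
    linarith
  · have := hKζ _ hη
    refine le_trans (le_of_eq ?_) this
    congr 2
    ring
  · refine le_trans ?_ hξp
    gcongr
  · refine le_trans ?_ hξp
    gcongr

/-- The total number of generations and the total number of rounds. -/
theorem rounds_le {C₁ C₃ : ℝ} {M S : ℕ} (hM : M + 1 = numGenerations α n) (hC₁ : 1 ≤ C₁)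
    (hk : 2 ≤ k) (hn : 4 ≤ n) (hα : 1 < α) (hC₃ : 0 ≤ C₃)
    (hlife : ∀ m : ℕ, (⌈lifeCycle γ α k (m + 1)⌉₊ : ℝ)
      ≤ C₁ * (1 + Real.log k * min 1 (max 0 (Real.logb 2 (Real.logb α k) - m))))
    (hS : (S : ℝ) ≤ Real.logb 2 (Real.logb 2 n) + C₃) :
    (M : ℝ) ≤ max 0 (Real.logb 2 (Real.logb α k)) + Real.logb 2 (Real.logb 2 n) + 1 ∧
    ((birthTime γ α k (M + 1) + S + 1 : ℕ) : ℝ)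
      ≤ (2 * C₁ + C₃ + 3) * (max 0 (Real.logb 2 (Real.logb α k)) * Real.logb 2 k
        + Real.logb 2 (Real.logb 2 n)) := by
  have hk2 : (2 : ℝ) ≤ k := by exact_mod_cast hk
  have hn4 : (4 : ℝ) ≤ n := by exact_mod_cast hn
  set L := max 0 (Real.logb 2 (Real.logb α k)) with hL
  have hL0 : 0 ≤ L := le_max_left _ _
  set LL := Real.logb 2 (Real.logb 2 n) with hLL
  have hLL1 : 1 ≤ LL := by
    apply one_le_logb_two
    rw [Real.le_logb_iff_rpow_le (by norm_num) (by linarith)]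
    norm_num
    exact hn
  have hbk : 1 ≤ Real.logb 2 k := one_le_logb_two hk2
  have hlk : Real.log k ≤ Real.logb 2 k := log_le_logb_two (by linarith)
  have hMle : (M : ℝ) ≤ L + LL + 1 := by
    have h1 : M = ⌈Real.logb 2 (Real.logb α n)⌉₊ := by
      unfold numGenerations at hM; omega
    rw [h1]
    exact natCeil_le_of_le (by linarith) (logb_logb_le hk (by omega) hα)
  refine ⟨hMle, ?_⟩
  have hB := birthTime_le (by linarith) (by omega : 1 ≤ k) M hlife
  rw [← hL] at hB
  have h1 : Real.log k * L ≤ L * Real.logb 2 k := by rw [mul_comm]; gcongr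
  have h2 : L ≤ L * Real.logb 2 k := le_mul_of_one_le_right hL0 hbk
  set X := L * Real.logb 2 k with hX
  have h3 : C₁ * (M + Real.log k * L) ≤ C₁ * (2 * X + 2 * LL) :=
    mul_le_mul_of_nonneg_left (by linarith) (by linarith)
  have h4 : 0 ≤ X := by linarith
  have h5 : C₃ * 1 ≤ C₃ * (X + LL) := by gcongr; linarith
  push_cast
  linarith

/-- The threshold for the bias is at most `2` and at least `1 + 2 / √n`. -/
theorem bias_threshold_bounds (hn : 2 ≤ n) (hk : 2 ≤ k) (hkn : (k : ℝ) ≤ n)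
    (hkr : k * (n : ℝ) ^ (1 / 2 - ε) ≤ Real.sqrt n)
    (hlog : 4 * Real.log n ^ 2 ≤ (n : ℝ) ^ (1 / 2 - ε)) :
    2 / Real.sqrt n ≤ k * Real.logb 2 n / Real.sqrt n * Real.logb 2 k ∧
      k * Real.logb 2 n / Real.sqrt n * Real.logb 2 k ≤ 1 := by
  have hn2 : (2 : ℝ) ≤ n := by exact_mod_cast hn
  have hk2 : (2 : ℝ) ≤ k := by exact_mod_cast hk
  have hr0 : 0 < Real.sqrt n := Real.sqrt_pos.2 (by linarith)
  have hbn := logb_two_le (by linarith : (1 : ℝ) ≤ n)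
  have hbk := logb_two_le (by linarith : (1 : ℝ) ≤ k)
  have hlkn : Real.log k ≤ Real.log n := Real.log_le_log (by linarith) hkn
  have hbk1 := one_le_logb_two hk2
  have hbn1 := one_le_logb_two hn2
  rw [div_mul_eq_mul_div]
  constructor
  · gcongr
    calc (2 : ℝ) = 2 * 1 * 1 := by norm_num
      _ ≤ _ := by gcongr
  · rw [div_le_one hr0]
    have h1 : Real.logb 2 n * Real.logb 2 k ≤ (2 * Real.log n) * (2 * Real.log n) :=
      mul_le_mul hbn (by linarith) (by linarith) (by linarith)
    calc k * Real.logb 2 n * Real.logb 2 k = k * (Real.logb 2 n * Real.logb 2 k) := by ring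
      _ ≤ k * (4 * Real.log n ^ 2) :=
          mul_le_mul_of_nonneg_left (by linarith) (by linarith)
      _ ≤ k * (n : ℝ) ^ (1 / 2 - ε) := by gcongr
      _ ≤ _ := hkr

/-- With log α ≥ 1/√n, the number log_α k is at most n². This crude bound is enough to see that
there are O(log n) generations. -/
theorem max_logb_logb_le (hn : 2 ≤ n) (hk : 2 ≤ k) (hkn : (k : ℝ) ≤ n)
    (hα : 1 / Real.sqrt n ≤ Real.log α) :
    max 0 (Real.logb 2 (Real.logb α k)) ≤ 2 * Real.logb 2 n := by
  have hn2 : (2 : ℝ) ≤ n := by exact_mod_cast hn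
  have hk2 : (2 : ℝ) ≤ k := by exact_mod_cast hk
  have hn0 : (0 : ℝ) < n := by linarith
  have hr0 : 0 < Real.sqrt n := Real.sqrt_pos.2 hn0
  have hrr : Real.sqrt n * Real.sqrt n = n := Real.mul_self_sqrt hn0.le
  have hr1 : 1 ≤ Real.sqrt n := Real.one_le_sqrt.2 (by linarith)
  have hlam0 : 0 < Real.log α := lt_of_lt_of_le (by positivity) hα
  have hbn1 := one_le_logb_two hn2
  refine max_le (by linarith) ?_
  have hlk0 : 0 < Real.log k := Real.log_pos (by linarith)
  have hlkn : Real.log k ≤ Real.log n := Real.log_le_log (by linarith) hkn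
  have h1 : Real.logb α k ≤ (n : ℝ) ^ 2 := by
    unfold Real.logb
    rw [div_le_iff₀ hlam0]
    have h2 : Real.log n ≤ n := (Real.log_le_sub_one_of_pos hn0).trans (by linarith)
    calc Real.log k ≤ n * 1 := by linarith
      _ ≤ n * Real.sqrt n := by gcongr
      _ = n * n * (1 / Real.sqrt n) := by
          rw [mul_one_div, eq_div_iff hr0.ne', mul_assoc, hrr]
      _ ≤ (n : ℝ) ^ 2 * Real.log α := by rw [sq]; gcongr
  have h4 : 0 < Real.logb α k := by unfold Real.logb; positivity
  calc _ ≤ Real.logb 2 ((n : ℝ) ^ 2) := Real.logb_le_logb_of_le (by norm_num) h4 h1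
    _ = _ := by rw [Real.logb_pow]; norm_num

theorem logb_logb_two_le (hn : 256 ≤ n) :
    Real.logb 2 (Real.logb 2 n) ≤ Real.logb 2 n := by
  have hn256 : (256 : ℝ) ≤ n := by exact_mod_cast hn
  have hn0 : (0 : ℝ) < n := by linarith
  have hbn1 := one_le_logb_two (by linarith : (2 : ℝ) ≤ n)
  have hr0 : 0 < Real.sqrt n := Real.sqrt_pos.2 hn0
  have hrr : Real.sqrt n * Real.sqrt n = n := Real.mul_self_sqrt hn0.le
  apply Real.logb_le_logb_of_le (by norm_num) (by linarith)
  refine (logb_two_le (by linarith)).trans ?_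
  have h1 : Real.log n = 2 * Real.log (Real.sqrt n) := by
    rw [Real.log_sqrt hn0.le]; ring
  have h2 := Real.log_le_sub_one_of_pos hr0
  have h3 : 16 ≤ Real.sqrt n := Real.le_sqrt_of_sq_le (by norm_num; exact hn)
  nlinarith

theorem mul_exp_one_sub_le (hn : 1 ≤ n) (hε : ε ≤ 1 / 2) (hkn : (k : ℝ) ≤ (n : ℝ) ^ ε) :
    (k : ℝ) * Real.exp (1 - 3 / 4 * Real.log n) ≤ 3 / (n : ℝ) ^ (1 / 4 : ℝ) := by
  have hn1 : (1 : ℝ) ≤ n := by exact_mod_cast hn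
  have hn0 : (0 : ℝ) < n := by linarith
  rw [Real.exp_sub, show Real.exp (3 / 4 * Real.log n) = (n : ℝ) ^ (3 / 4 : ℝ) by
    rw [Real.rpow_def_of_pos hn0, mul_comm], mul_div_assoc',
    div_le_div_iff₀ (by positivity) (by positivity)]
  have h1 : (k : ℝ) * (n : ℝ) ^ (1 / 4 : ℝ) ≤ (n : ℝ) ^ (3 / 4 : ℝ) := by
    calc _ ≤ (n : ℝ) ^ ε * (n : ℝ) ^ (1 / 4 : ℝ) := by gcongr
      _ = (n : ℝ) ^ (ε + 1 / 4) := by rw [Real.rpow_add hn0]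
      _ ≤ _ := Real.rpow_le_rpow_of_exponent_le hn1 (by linarith)
  have h2 : Real.exp 1 ≤ 3 := by linarith [Real.exp_one_lt_d9]
  calc (k : ℝ) * Real.exp 1 * (n : ℝ) ^ (1 / 4 : ℝ)
      = Real.exp 1 * (k * (n : ℝ) ^ (1 / 4 : ℝ)) := by ring
    _ ≤ 3 * (n : ℝ) ^ (3 / 4 : ℝ) := by gcongr

theorem mul_sqrt_log_div_le_half {D : ℝ} (hD : 0 ≤ D) (hn : 1 ≤ n) (hlog : 1 ≤ Real.log n)
    (hkr : k * (n : ℝ) ^ (1 / 2 - ε) ≤ Real.sqrt n)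
    (h : 2 * D * Real.log n ≤ (n : ℝ) ^ (1 / 2 - ε)) :
    D * (k * Real.sqrt (Real.log n / n)) ≤ 1 / 2 := by
  have hn1 : (1 : ℝ) ≤ n := by exact_mod_cast hn
  have hr0 : 0 < Real.sqrt n := Real.sqrt_pos.2 (by linarith)
  rw [Real.sqrt_div (by linarith)]
  have h1 : D * (k * (Real.sqrt (Real.log n) / Real.sqrt n))
      = D * Real.sqrt (Real.log n) * k / Real.sqrt n := by ring
  rw [h1, div_le_iff₀ hr0]
  have h2 : Real.sqrt (Real.log n) ≤ Real.log n := by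
    rw [Real.sqrt_le_left (by linarith)]
    nlinarith
  have h3 : k * (2 * D * Real.log n) ≤ k * (n : ℝ) ^ (1 / 2 - ε) := by gcongr
  have h4 : D * Real.sqrt (Real.log n) * k ≤ D * Real.log n * k := by gcongr
  linarith

/-- l = 16 log n makes e^{-l/4} = n⁻⁴, which beats the at most n rounds with k + 2 ≤ 2n events each.
The main term is k/√n ≤ n^{-2c}, and half of that exponent pays for the constant 51. -/
theorem failure_le {T : ℕ} {c : ℝ} (hn : 2 ≤ n) (hk : 2 ≤ k) (hkn1 : (k : ℝ) ≤ n)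
    (hkn : (k : ℝ) ≤ (n : ℝ) ^ ε) (hc : c = (1 / 2 - ε) / 2) (hT : (T : ℝ) ≤ n)
    (h51 : 51 ≤ (n : ℝ) ^ c) :
    (48 * k + 3) / Real.sqrt n + T * ((k + 2) * Real.exp (-(16 * Real.log n) / 4))
      ≤ (n : ℝ) ^ (-c) := by
  have hn2 : (2 : ℝ) ≤ n := by exact_mod_cast hn
  have hk2 : (2 : ℝ) ≤ k := by exact_mod_cast hk
  have hn0 : (0 : ℝ) < n := by linarith
  have hr0 : 0 < Real.sqrt n := Real.sqrt_pos.2 hn0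
  have hexp : Real.exp (-(16 * Real.log n) / 4) = 1 / (n : ℝ) ^ 4 := by
    rw [show -(16 * Real.log n) / 4 = -((4 : ℕ) * Real.log n) by push_cast; ring, Real.exp_neg,
      Real.exp_nat_mul, Real.exp_log hn0, one_div]
  have h1 : T * ((k + 2) * Real.exp (-(16 * Real.log n) / 4)) ≤ 1 / Real.sqrt n := by
    rw [hexp]
    calc _ ≤ (n : ℝ) * ((n + n) * (1 / (n : ℝ) ^ 4)) := by gcongr
      _ = 2 / (n : ℝ) ^ 2 := by field_simp; norm_num
      _ ≤ 1 / Real.sqrt n := by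
          rw [div_le_div_iff₀ (by positivity) hr0]
          have : Real.sqrt n ≤ n := by
            rw [Real.sqrt_le_left hn0.le]
            nlinarith
          nlinarith
  have h2 : (48 * k + 3) / Real.sqrt n + 1 / Real.sqrt n ≤ 51 * (k / Real.sqrt n) := by
    rw [← add_div, mul_div_assoc']
    gcongr
    linarith
  have h3 : k / Real.sqrt n ≤ (n : ℝ) ^ (-c) * (n : ℝ) ^ (-c) := by
    rw [div_le_iff₀ hr0, ← Real.rpow_add hn0, Real.sqrt_eq_rpow, ← Real.rpow_add hn0]
    refine hkn.trans (le_of_eq ?_)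
    congr 1
    rw [hc]; ring
  have hnc : 0 < (n : ℝ) ^ (-c) := Real.rpow_pos_of_pos hn0 _
  have h4 : 51 * ((n : ℝ) ^ (-c) * (n : ℝ) ^ (-c)) ≤ (n : ℝ) ^ (-c) := by
    have h5 : (n : ℝ) ^ c * (n : ℝ) ^ (-c) = 1 := by
      rw [← Real.rpow_add hn0]; simp
    calc 51 * ((n : ℝ) ^ (-c) * (n : ℝ) ^ (-c))
        ≤ (n : ℝ) ^ c * ((n : ℝ) ^ (-c) * (n : ℝ) ^ (-c)) := by gcongr
      _ = _ := by rw [← mul_assoc, h5, one_mul]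
  linarith

theorem rounds_le_nat {C : ℝ} {T : ℕ} (hC : 0 ≤ C) (hn : 256 ≤ n) (hk : 2 ≤ k) (hkn : (k : ℝ) ≤ n)
    (hα : 1 / Real.sqrt n ≤ Real.log α) (h : 12 * C * Real.log n ^ 2 ≤ n)
    (hT : (T : ℝ) ≤ C * (max 0 (Real.logb 2 (Real.logb α k)) * Real.logb 2 k
        + Real.logb 2 (Real.logb 2 n))) : (T : ℝ) ≤ n := by
  have hn256 : (256 : ℝ) ≤ n := by exact_mod_cast hn
  have hk2 : (2 : ℝ) ≤ k := by exact_mod_cast hk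
  have hbk1 := one_le_logb_two hk2
  have hbn1 := one_le_logb_two (by linarith : (2 : ℝ) ≤ n)
  have hbn := logb_two_le (by linarith : (1 : ℝ) ≤ n)
  have hL := max_logb_logb_le (by omega) hk hkn hα
  have hLL := logb_logb_two_le hn
  refine hT.trans (le_trans ?_ h)
  have h1 : max 0 (Real.logb 2 (Real.logb α k)) * Real.logb 2 k
      ≤ 2 * Real.logb 2 n * Real.logb 2 n := by
    have : Real.logb 2 k ≤ Real.logb 2 n :=
      Real.logb_le_logb_of_le (by norm_num) (by linarith) hkn
    gcongr
  have h2 : Real.logb 2 n ≤ Real.logb 2 n * Real.logb 2 n :=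
    le_mul_of_one_le_left (by linarith) hbn1
  have h3 : Real.logb 2 n * Real.logb 2 n ≤ (2 * Real.log n) * (2 * Real.log n) := by gcongr
  calc _ ≤ C * (12 * Real.log n ^ 2) := mul_le_mul_of_nonneg_left (by linarith) hC
    _ = _ := by ring

set_option maxHeartbeats 800000 in
theorem exists_convergence_constants (ε γ : ℝ) (hε0 : 0 < ε) (hε : ε < 1 / 2) (hγ0 : 0 < γ) (hγ1 : γ < 1) :
    ∃ C : ℝ, 0 < C ∧ ∃ c : ℝ, 0 < c ∧ ∃ N : ℕ, ∀ n : ℕ, N ≤ n →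
      ∀ k : ℕ, 2 ≤ k → (k : ℝ) ≤ (n : ℝ) ^ ε →
      ∀ (op : Fin n → Fin k) (a : Fin k) (α : ℝ),
        (∀ b : Fin k, Plurality.support op b ≤ Plurality.support op a) →
        α = Plurality.bias op a →
        1 + (k : ℝ) * Real.logb 2 n / Real.sqrt n * Real.logb 2 k < α →
        1 - (n : ℝ) ^ (-c) ≤
          (Plurality.samplingMeasure n).real
            {ω | Plurality.ConvergedBy γ α op a
              (C * (max 0 (Real.logb 2 (Real.logb α k)) * Real.logb 2 k
                + Real.logb 2 (Real.logb 2 n))) ω} := by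
  have hq : 0 < 2 - γ := by linarith
  obtain ⟨p, hp0, hp⟩ : ∃ p : ℝ, 0 < p ∧ p ^ 2 * (2 - γ) = 1 := by
    refine ⟨(Real.sqrt (2 - γ))⁻¹, inv_pos.2 (Real.sqrt_pos.2 hq), ?_⟩
    rw [inv_pow, Real.sq_sqrt hq.le]
    field_simp
  have hp1 : p < 1 := by
    by_contra h
    have : 1 ≤ p ^ 2 := one_le_pow₀ (not_lt.1 h)
    nlinarith
  obtain ⟨C₁, hC₁, hlife⟩ := exists_ceil_lifeCycle_le hγ0 hγ1
  obtain ⟨D, hD0, hD⟩ := exists_cycleLoss_le hγ0 hp0 hp1 (by linarith : 0 ≤ C₁)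
  obtain ⟨ξ, K, ζ, hξ, hζ0, hζ, hξp, hξK, hKζ⟩ := exists_bias_thresholds hp0 hp1
  have hpγ : 0 < p * γ ^ 2 := by positivity
  have hpγ1 : p * γ ^ 2 < 1 := by
    have : γ ^ 2 ≤ 1 := by nlinarith
    nlinarith
  obtain ⟨C₃, hC₃, hsq⟩ := exists_squaring_rounds (h := 1 - p * γ ^ 2 / 4) (by linarith)
    (by linarith)
  obtain ⟨C, hC⟩ : ∃ C, C = 2 * C₁ + C₃ + 3 := ⟨_, rfl⟩
  have hC0 : 0 < C := by rw [hC]; positivity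
  -- θ ≤ 1/8 makes the cap (1 - 2θ)·log n at least 3/4·log n, as the ending requires.
  obtain ⟨θ, hθ⟩ : ∃ θ, θ = (1 - 2 * ε) / 8 := ⟨_, rfl⟩
  have hθ0 : 0 < θ := by rw [hθ]; linarith
  have hθ1 : θ ≤ 1 / 8 := by rw [hθ]; linarith
  obtain ⟨c, hc⟩ : ∃ c, c = (1 / 2 - ε) / 2 := ⟨_, rfl⟩
  have hc0 : 0 < c := by rw [hc]; linarith
  have hg : 0 < (1 - γ) ^ 2 / 3 := by
    have : 0 < 1 - γ := by linarith
    positivity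
  have hp' : 0 < (1 - p) / 2 := by linarith
  have hlogt : Filter.Tendsto (fun n : ℕ => Real.log n) Filter.atTop Filter.atTop :=
    Real.tendsto_log_atTop.comp tendsto_natCast_atTop_atTop
  have key : ∀ᶠ n : ℕ in Filter.atTop, ∀ k : ℕ, 2 ≤ k → (k : ℝ) ≤ (n : ℝ) ^ ε →
      ∀ (op : Fin n → Fin k) (a : Fin k) (α : ℝ), α = bias op a →
        1 + (k : ℝ) * Real.logb 2 n / Real.sqrt n * Real.logb 2 k < α →
        1 - (n : ℝ) ^ (-c) ≤
          (samplingMeasure n).real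
            {ω | ConvergedBy γ α op a
              (C * (max 0 (Real.logb 2 (Real.logb α k)) * Real.logb 2 k
                + Real.logb 2 (Real.logb 2 n))) ω} := by
    filter_upwards [eventually_log_pow_le (72 * 16) 1 hθ0,
      eventually_log_pow_le (8 / (p * γ ^ 2)) 0 hθ0,
      eventually_log_pow_le (16 * (1 / ((1 - γ) ^ 2 / 3) ^ 2)) 1 hθ0,
      eventually_log_pow_le (16 * (1 / ((1 - p) / 2) ^ 2)) 1 hθ0,
      eventually_log_pow_le (2 / (1 - p) + 1) 0 one_pos,
      eventually_log_pow_le (16 * (84 * C₁ / ζ) ^ 2) 7 hθ0,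
      hlogt.eventually_ge_atTop ((4 * D / ζ) ^ 2),
      eventually_log_pow_le (2 * D) 1 (show 0 < 1 / 2 - ε by linarith),
      eventually_log_pow_le 4 2 (show 0 < 1 / 2 - ε by linarith),
      eventually_log_pow_le (3 / ξ) 0 (show (0 : ℝ) < 1 / 4 by norm_num),
      eventually_log_pow_le 3 0 (show (0 : ℝ) < 1 / 4 by norm_num),
      eventually_log_pow_le (16 / (p * γ ^ 2 / 4) ^ 2) 1 (show (0 : ℝ) < 1 / 2 by norm_num),
      eventually_log_pow_le (12 * C) 2 one_pos,
      eventually_log_pow_le 51 0 hc0,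
      Filter.eventually_ge_atTop 256, hlogt.eventually_ge_atTop 6]
      with n f1 f2 f3 f4 f5 f6 f7 f8 f9 f10 f11 f12 f13 f14 hn hlog6
    intro k hk hkn op a α hα hbias
    simp only [pow_zero, mul_one, pow_one, Real.rpow_one] at f1 f2 f3 f4 f5 f8 f10 f11 f12 f13 f14
    have hn256 : (256 : ℝ) ≤ n := by exact_mod_cast hn
    have hn0 : (0 : ℝ) < n := by linarith
    have hn1 : (1 : ℝ) ≤ n := by linarith
    have hk2 : (2 : ℝ) ≤ k := by exact_mod_cast hk
    have hr0 : 0 < Real.sqrt n := Real.sqrt_pos.2 hn0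
    have hrr : Real.sqrt n * Real.sqrt n = n := Real.mul_self_sqrt hn0.le
    have hr1 : 1 ≤ Real.sqrt n := Real.one_le_sqrt.2 hn1
    have hU0 : 0 < (n : ℝ) ^ θ := Real.rpow_pos_of_pos hn0 _
    have hkn1 : (k : ℝ) ≤ n := by
      refine hkn.trans ?_
      calc (n : ℝ) ^ ε ≤ (n : ℝ) ^ (1 : ℝ) := Real.rpow_le_rpow_of_exponent_le hn1 (by linarith)
        _ = n := Real.rpow_one _
    have hkr : k * (n : ℝ) ^ (1 / 2 - ε) ≤ Real.sqrt n := by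
      calc k * (n : ℝ) ^ (1 / 2 - ε) ≤ (n : ℝ) ^ ε * (n : ℝ) ^ (1 / 2 - ε) := by gcongr
        _ = Real.sqrt n := by
            rw [← Real.rpow_add hn0, Real.sqrt_eq_rpow]; congr 1; ring
    have reg : Regime γ p (16 * Real.log n) ((n : ℝ) ^ θ) ((1 - 2 * θ) * Real.log n) n k :=
      regime_of_large hγ0 hγ1 hp0 hp hθ hε0 hε hk hkn (by omega) (by linarith) f2
        (sqrt_div_le_of_mul_le hU0 hg (by linarith))
        (sqrt_div_le_of_mul_le hU0 hp' (by linarith)) f5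
    obtain ⟨hδ0, hδ1⟩ := bias_threshold_bounds (by omega) hk hkn1 hkr f9
    obtain ⟨δ, hδ⟩ : ∃ δ, δ = (k : ℝ) * Real.logb 2 n / Real.sqrt n * Real.logb 2 k := ⟨_, rfl⟩
    rw [← hδ] at hδ0 hδ1 hbias
    have hδ0' : 0 < δ := lt_of_lt_of_le (by positivity) hδ0
    have hα1 : 1 < α := lt_trans (lt_add_of_pos_right _ hδ0') hbias
    have hlam : 1 / Real.sqrt n ≤ Real.log α := by
      refine le_trans ?_ (half_le_log_of_one_add_lt hδ0'.le hδ1 hbias)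
      rw [le_div_iff₀ two_pos]
      exact (by ring : 1 / Real.sqrt n * 2 = 2 / Real.sqrt n).trans_le hδ0
    obtain ⟨M, hM⟩ : ∃ M, M + 1 = numGenerations α n := ⟨_, rfl⟩
    obtain ⟨S, hS, hS'⟩ := hsq n (by omega)
    obtain ⟨hMle, hrounds⟩ := rounds_le hM hC₁ hk (by omega) hα1 hC₃
      (fun m => hlife k α m hk hα1) hS
    rw [← hC] at hrounds
    have hlog0 : 0 < Real.log n := lt_of_lt_of_le (by norm_num) hlog6
    have hMn : (M : ℝ) ≤ 7 * Real.log n := by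
      have h1 := max_logb_logb_le (by omega) hk hkn1 hlam
      have h2 := logb_logb_two_le hn
      have h3 := logb_two_le hn1
      clear f1 f2 f3 f4 f5 f6 f7 f8 f9 f10 f11 f12 f13 f14 hrounds
      linarith
    have hκ34 : 3 / 4 * Real.log n ≤ (1 - 2 * θ) * Real.log n :=
      mul_le_mul_of_nonneg_right (by linarith only [hθ1]) hlog0.le
    have hκn : (1 - 2 * θ) * Real.log n ≤ Real.log n :=
      mul_le_of_le_one_left hlog0.le (by linarith only [hθ0])
    have hk14 := mul_exp_one_sub_le (by omega) hε.le hkn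
    have hn14 : 0 < (n : ℝ) ^ (1 / 4 : ℝ) := Real.rpow_pos_of_pos hn0 _
    have hz : 84 * C₁ * Real.log n ^ 3 * Real.sqrt (16 * Real.log n / (n : ℝ) ^ θ) ≤ ζ := by
      have h1 : 0 < 84 * C₁ * Real.log n ^ 3 := by positivity
      have h2 := sqrt_div_le_of_mul_le (l := 16 * Real.log n) hU0
        (z := ζ / (84 * C₁ * Real.log n ^ 3)) (by positivity) (by
          refine le_trans (le_of_eq ?_) f6
          field_simp)
      rw [le_div_iff₀ h1] at h2
      rwa [mul_comm]
    have hDζ : 4 * D ≤ ζ * Real.sqrt (Real.log n) := by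
      have h1 : 4 * D / ζ ≤ Real.sqrt (Real.log n) := Real.le_sqrt_of_sq_le f7
      rwa [div_le_iff₀' hζ0] at h1
    have hκξ : (k : ℝ) * Real.exp (1 - (1 - 2 * θ) * Real.log n) ≤ ξ := by
      refine le_trans (mul_le_mul_of_nonneg_left (Real.exp_le_exp.2
        (sub_le_sub_left hκ34 1)) (Nat.cast_nonneg k)) (hk14.trans ?_)
      rw [div_le_iff₀ hn14]
      rwa [div_le_iff₀' hξ] at f10
    obtain ⟨η, ν, e, sch⟩ := schedule_of_large (M := M) reg hC₁ hlife hD0 hD hζ0 hζ hξp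
      (hξK k hk) hKζ hδ hδ1 hbias hkn1 hlog6 hMn hz hDζ
      (mul_sqrt_log_div_le_half hD0.le (by omega) (by linarith only [hlog6]) hkr f8)
      (by linarith only [hκ34, hlog6]) hκn hκξ
    have hconv := sch.converges hM hα S hn hκ34
      (hk14.trans (by rw [div_le_one hn14]; exact f11))
      (by
        rw [Real.sqrt_eq_rpow]
        rw [div_mul_eq_mul_div, div_le_iff₀ (by positivity)] at f12
        linarith only [f12]) hS' hrounds
    have hfail := failure_le (by omega) hk hkn1 hkn hc
      (rounds_le_nat hC0.le hn hk hkn1 hlam f13 hrounds) f14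
    refine le_trans ?_ hconv
    linarith only [hfail]
  obtain ⟨N, hN⟩ := Filter.eventually_atTop.1 key
  exact ⟨C, hC0, c, hc0, N, fun n hn k hk hkn op a α _ hα hb => hN n hn k hk hkn op a α hα hb⟩

end Asymptotics

end Plurality

theorem theorem1 (ε γ : ℝ) (hε0 : 0 < ε) (hε : ε < 1 / 2) (hγ0 : 0 < γ) (hγ1 : γ < 1) :
    ∃ C : ℝ, 0 < C ∧ ∃ c : ℝ, 0 < c ∧ ∃ N : ℕ, ∀ n : ℕ, N ≤ n →
      ∀ k : ℕ, 2 ≤ k → (k : ℝ) ≤ (n : ℝ) ^ ε →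
      ∀ (op : Fin n → Fin k) (a : Fin k) (α : ℝ),
        (∀ b : Fin k, Plurality.support op b ≤ Plurality.support op a) →
        α = Plurality.bias op a →
        1 + (k : ℝ) * Real.logb 2 n / Real.sqrt n * Real.logb 2 k < α →
        1 - (n : ℝ) ^ (-c) ≤
          (Plurality.samplingMeasure n).real
            {ω | Plurality.ConvergedBy γ α op a
              (C * (max 0 (Real.logb 2 (Real.logb α k)) * Real.logb 2 k
                + Real.logb 2 (Real.logb 2 n))) ω} :=
  Plurality.exists_convergence_constants ε γ hε0 hε hγ0 hγ1
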